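/- **Setting.** Fix $\alpha,\beta,r\in(0,1)$. For each $n$ there are $n$ subjects, a set $H_n\subseteq[n]$ of non-nulls with $|H_n|/n\sim n^{-\beta}$ (that is, $|H_n|/n^{1-\beta}\to1$), and no covariates. Subject $i$ has potential outcomes $Y_i^C\sim N(0,1)$ and $Y_i^T\sim N(\mu_i,1)$, where $\mu_i=\mu_n:=\sqrt{2r\log n}$ if $i\in H_n$ and $\mu_i=0$ otherwise; the pairs $(Y_i^C,Y_i^T)$ are independent over $i$. The treatment indicators $A_1,\dots,A_n\in\{0,1\}$ are independent fair coin flips, independent of the potential outcomes, and $Y_i=A_iY_i^T+(1-A_i)Y_i^C$ is observed. For a random set $R_n$ of identified subjects, the false discovery proportion is $\mathrm{FDP}(R_n)=|R_n\setminus H_n|/\max\{|R_n|,1\}$, $\mathrm{FDR}(R_n)=\mathbb E[\mathrm{FDP}(R_n)]$, the power is $\mathbb E\big[|R_n\cap H_n|/\max\{|H_n|,1\}\big]$, and the power among treated subjects is $\mathbb E\big[|R_n\cap H_n\cap T_n|/\max\{|H_n\cap T_n|,1\}\big]$ with $T_n=\{i:A_i=1\}$. *Automated Crossfit-I³ at level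 $\alpha$.* Split $[n]$, uniformly at random and independently of the data, into parts $\mathcal I,\mathcal{II}$ of sizes $\lfloor n/2\rfloor$ and $\lceil n/2\rceil$. For $i$ in one part let $\widehat m$ be the average of $Y_j$ over the other part and $\widehat\Delta_i=4(A_i-\tfrac12)(Y_i-\widehat m)$. In each part separately, start with all its subjects as the candidate set $\mathcal R$, and exclude one by one the candidate with the smallest $|\widehat\Delta_i|$ until $\dfrac{|\{i\in\mathcal R:\widehat\Delta_i\le0\}|+1}{\max\{|\{i\in\mathcal R:\widehat\Delta_i>0\}|,1\}}\le\alpha/2$ for the first time; then identify the $i\in\mathcal R$ with $\widehat\Delta_i>0$ (nobody, if this never happens). The output is the union over both parts. *Linear-BH at level $\alpha$.* Let $\overline Y_b$, $n_b$ and $\widehat\sigma_b^2$ (with denominator $n_b-1$) be the average, the size and the sample variance of the outcomes in arm $b\in\{T,C\}$. Let $\widehat\Delta_i^{\rm BH}=Y_i-\overline Y_C$ with estimated variance $\widehat\sigma_T^2+\widehat\sigma_C^2/n_C$ if $i$ is treated, and $\widehat\Delta_i^{\rm BH}=\overline Y_T-Y_i$ with estimated variance $\widehat\sigma_C^2+\widehat\sigma_T^2/n_T$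 otherwise. Apply the Benjamini–Hochberg procedure at level $\alpha$ to the $p$-values $1-\Phi\big(\widehat\Delta_i^{\rm BH}/\text{(estimated standard deviation)}\big)$, where $\Phi$ is the standard Gaussian distribution function. *Threshold procedures.* Given statistics $V_i$, a threshold procedure identifies the $i$ with $V_i\ge d$. Here $V_i=\widehat\Delta_i$ or $V_i=\widehat\Delta_i^{\rm BH}$, and the threshold $d\in[-\infty,\infty]$ may differ between the two parts of the split (for $\widehat\Delta_i$) or between the two arms (for $\widehat\Delta_i^{\rm BH}$). **Theorem.** As $n\to\infty$: 1. If $r<\beta$, the power of the automated Crossfit-I³ and the power of linear-BH both tend to $0$. Moreover, for every sequence of threshold procedures: (a) if the thresholds are deterministic (depending on $n$) and $\mathrm{FDR}\le\alpha$ for all large $n$, then the power tends to $0$; (b) if the thresholds are arbitrary random variables (for example, functions of the statistics), then for every $\varepsilon>0$ the power is at most $\mathrm{FDR}+\varepsilon$ for all large $n$, and if $\mathbb P(\mathrm{FDP}\le\alpha)\to1$, then the power tends to $0$. 2. If $r>\beta$, the power of the automated Crossfit-I³ and the power of linear-BH both tend to $1/2$, and their powers among treated subjects both tend to $1$. -/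

import Mathlib

open MeasureTheory ProbabilityTheory Filter Topology

namespace ICube

noncomputable section

open scoped Classical

/-! ### The probabilistic model -/

/-- The sparse Gaussian model with `n` subjects and no covariates. `H` is the set of non-null
subjects, `YC i` and `YT i` are the potential outcomes of subject `i` under control and under
treatment, `A i` says whether subject `i` is treated, and `S` is the random split of the subjects
into two halves (labelled `true` and `false`). The dependence between `YC i` and `YT i` is left
free, since only one of the two is ever observed. -/
structure SparseGaussianModel {n : ℕ} {Ω : Type*} [MeasurableSpace Ω] (P : Measure Ω)
    (r : ℝ) (H : Finset (Fin n)) (YC YT : Fin n → Ω → ℝ) (A S : Fin n → Ω → Bool) : Prop where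
  measurable_YC : ∀ i, Measurable (YC i)
  measurable_YT : ∀ i, Measurable (YT i)
  measurable_A : ∀ i, Measurable (A i)
  measurable_S : ∀ i, Measurable (S i)
  /-- control outcomes are standard Gaussian -/
  law_YC : ∀ i, P.map (YC i) = gaussianReal 0 1
  /-- treated outcomes are Gaussian, shifted by `√(2 r log n)` for the non-nulls -/
  law_YT : ∀ i, P.map (YT i) = gaussianReal (if i ∈ H then √(2 * r * Real.log n) else 0) 1
  /-- different subjects have independent potential outcomes -/
  indep_Y : iIndepFun (fun i ω => (YC i ω, YT i ω)) P
  /-- the treatment assignments are independent fair coin flips -/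
  law_A : ∀ a : Fin n → Bool, P {ω | ∀ i, A i ω = a i} = (1 / 2) ^ n
  /-- the assignments are independent of the potential outcomes -/
  indep_A : IndepFun (fun ω i => A i ω) (fun ω i => (YC i ω, YT i ω)) P
  /-- the split is uniform among all splits into parts of sizes `⌊n/2⌋` and `⌈n/2⌉` -/
  law_S : ∀ s : Fin n → Bool, P {ω | ∀ i, S i ω = s i} =
    if (Finset.univ.filter fun i => s i = true).card = n / 2 then
      ((n.choose (n / 2) : ENNReal))⁻¹ else 0
  /-- the split is independent of the data -/
  indep_S : IndepFun (fun ω i => S i ω) (fun ω i => (A i ω, YC i ω, YT i ω)) P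

/-- The observed outcome: the treated outcome of a treated subject, the control outcome of an
untreated one. -/
def observed {n : ℕ} {Ω : Type*} (YC YT : Fin n → Ω → ℝ) (A : Fin n → Ω → Bool) (ω : Ω)
    (i : Fin n) : ℝ :=
  if A i ω = true then YT i ω else YC i ω

/-! ### False discovery proportion, FDR and power -/

/-- The proportion of the subjects in `H` that are in `R`: `|R ∩ H| / max (|H|, 1)`. -/
def truePositiveProp {n : ℕ} (R H : Finset (Fin n)) : ℝ :=
  ((R ∩ H).card : ℝ) / (max H.card 1 : ℕ)

/-- The false discovery proportion `|R ∩ Hᶜ| / max (|R|, 1)`. -/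
def falseDiscoveryProp {n : ℕ} (R H : Finset (Fin n)) : ℝ :=
  ((R \ H).card : ℝ) / (max R.card 1 : ℕ)

/-- The power: the expected proportion of the subjects in the (possibly random) target set `H`
that are in the random rejection set `R`. -/
def power {n : ℕ} {Ω : Type*} [MeasurableSpace Ω] (P : Measure Ω)
    (R H : Ω → Finset (Fin n)) : ℝ :=
  ∫ ω, truePositiveProp (R ω) (H ω) ∂P

/-- The false discovery rate of the random rejection set `R`, with non-nulls `H`. -/
def fdr {n : ℕ} {Ω : Type*} [MeasurableSpace Ω] (P : Measure Ω)
    (R : Ω → Finset (Fin n)) (H : Finset (Fin n)) : ℝ :=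
  ∫ ω, falseDiscoveryProp (R ω) H ∂P

/-! ### The automated Crossfit-I³ -/

/-- The subjects with label `b`. -/
def group {n : ℕ} (g : Fin n → Bool) (b : Bool) : Finset (Fin n) :=
  Finset.univ.filter fun i => g i = b

/-- The average of `y` over `s`. -/
def average {n : ℕ} (y : Fin n → ℝ) (s : Finset (Fin n)) : ℝ :=
  (∑ i ∈ s, y i) / s.card

/-- The cross-fitted estimated effect `4 (A_i - 1/2) (Y_i - m̂)`, where `m̂` is the average outcome
in the half that does not contain subject `i`. -/
def crossfitEffect {n : ℕ} (s a : Fin n → Bool) (y : Fin n → ℝ) (i : Fin n) : ℝ :=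
  4 * ((if a i = true then 1 else 0) - 1 / 2) * (y i - average y (group s (!s i)))

/-- The candidates with positive estimated effect. -/
def positives {n : ℕ} (V : Fin n → ℝ) (R : Finset (Fin n)) : Finset (Fin n) :=
  R.filter fun i => 0 < V i

/-- The candidates with nonpositive estimated effect. -/
def nonpositives {n : ℕ} (V : Fin n → ℝ) (R : Finset (Fin n)) : Finset (Fin n) :=
  R.filter fun i => V i ≤ 0

/-- The estimated FDR of a candidate set. -/
def fdrHat {n : ℕ} (V : Fin n → ℝ) (R : Finset (Fin n)) : ℝ :=
  ((nonpositives V R).card + 1 : ℝ) / (max (positives V R).card 1 : ℕ)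

/-- Exclude from `R` the subject with the smallest `|V i|` (among ties, the smallest index). -/
def excludeSmallest {n : ℕ} (V : Fin n → ℝ) (R : Finset (Fin n)) : Finset (Fin n) :=
  R.filter fun i => ∃ j ∈ R, |V j| < |V i| ∨ (|V j| = |V i| ∧ j < i)

/-- The candidate set after `t` exclusions. -/
def candidates {n : ℕ} (V : Fin n → ℝ) (R₀ : Finset (Fin n)) (t : ℕ) : Finset (Fin n) :=
  (excludeSmallest V)^[t] R₀

/-- The automated I³ at level `γ`, started from the candidate set `R₀`: subjects are excluded one
by one in the order of `|V i|`, up to the first time at which the estimated FDR is at most `γ`; the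
candidates with positive estimated effect are then reported (none, if there is no such time). -/
def autoI3 {n : ℕ} (γ : ℝ) (V : Fin n → ℝ) (R₀ : Finset (Fin n)) : Finset (Fin n) :=
  if h : ∃ t, fdrHat V (candidates V R₀ t) ≤ γ then
    positives V (candidates V R₀ (Nat.find h))
  else ∅

/-- The automated Crossfit-I³ at level `α`: the automated I³ at level `α / 2` on each half. -/
def crossfitI3 {n : ℕ} (α : ℝ) (s a : Fin n → Bool) (y : Fin n → ℝ) : Finset (Fin n) :=
  autoI3 (α / 2) (crossfitEffect s a y) (group s true) ∪
    autoI3 (α / 2) (crossfitEffect s a y) (group s false)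

/-! ### The linear-BH procedure without covariates -/

/-- The effect estimated by imputing the unobserved potential outcome by the linear model fitted on
the other arm; without covariates, the fitted value is the average outcome of that arm. -/
def linearEffect {n : ℕ} (a : Fin n → Bool) (y : Fin n → ℝ) (i : Fin n) : ℝ :=
  if a i = true then y i - average y (group a false) else average y (group a true) - y i

/-- The estimated noise variance in arm `b`, with `n_b - 1` degrees of freedom. -/
def armVariance {n : ℕ} (a : Fin n → Bool) (y : Fin n → ℝ) (b : Bool) : ℝ :=
  (∑ i ∈ group a b, (y i - average y (group a b)) ^ 2) / ((group a b).card - 1 : ℝ)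

/-- The estimated variance of `linearEffect`: the noise variance of the subject's own arm plus the
variance of the average of the other arm. -/
def linearEffectVariance {n : ℕ} (a : Fin n → Bool) (y : Fin n → ℝ) (i : Fin n) : ℝ :=
  armVariance a y (a i) + armVariance a y (!a i) / (group a (!a i)).card

/-- The one-sided Gaussian `p`-value of subject `i`. -/
def linearPValue {n : ℕ} (a : Fin n → Bool) (y : Fin n → ℝ) (i : Fin n) : ℝ :=
  1 - cdf (gaussianReal 0 1) (linearEffect a y i / √(linearEffectVariance a y i))

/-- The Benjamini-Hochberg procedure at level `α`: with `k` the largest number such that at least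
`k` of the `p`-values are at most `k α / n`, reject those that are at most `k α / n`. -/
def benjaminiHochberg {n : ℕ} (α : ℝ) (p : Fin n → ℝ) : Finset (Fin n) :=
  Finset.univ.filter fun i => p i ≤ (Nat.findGreatest
    (fun k : ℕ => k ≤ (Finset.univ.filter fun j => p j ≤ k * α / n).card) n : ℕ) * α / n

/-- The linear-BH procedure at level `α`. -/
def linearBH {n : ℕ} (α : ℝ) (a : Fin n → Bool) (y : Fin n → ℝ) : Finset (Fin n) :=
  benjaminiHochberg α (linearPValue a y)

/-! ### Threshold procedures -/

/-- The threshold procedure with statistics `V` and, in the group with label `b`, the threshold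
`d b` (with value `⊤` if nothing is to be rejected in that group). -/
def thresholdSet {n : ℕ} (V : Fin n → ℝ) (g : Fin n → Bool) (d : Bool → EReal) :
    Finset (Fin n) :=
  Finset.univ.filter fun i => d (g i) ≤ (V i : EReal)

/-- No sequence of threshold procedures based on the statistics `V n` (with thresholds that may
differ between the groups given by `g n`) has asymptotic power:
* if the thresholds are not random and the FDR is eventually at most `α`, the power tends to `0`;
* if the thresholds are random (any random variables whatsoever, in particular functions of the
  statistics), the power is at most the FDR plus a term that tends to `0`, and the power tends to
  `0` if the false discovery proportion is at most `α` with probability tending to one. -/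
def ThresholdProceduresPowerless (α : ℝ) {Ω : ℕ → Type*} [∀ n, MeasurableSpace (Ω n)]
    (P : ∀ n, Measure (Ω n)) (H : ∀ n, Finset (Fin n))
    (V : ∀ n, Ω n → Fin n → ℝ) (g : ∀ n, Ω n → Fin n → Bool) : Prop :=
  (∀ d : ℕ → Bool → EReal,
    (∀ᶠ n in atTop, fdr (P n) (fun ω => thresholdSet (V n ω) (g n ω) (d n)) (H n) ≤ α) →
    Tendsto (fun n => power (P n) (fun ω => thresholdSet (V n ω) (g n ω) (d n))
      (fun _ => H n)) atTop (𝓝 0)) ∧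
  (∀ d : ∀ n, Ω n → Bool → EReal, (∀ n b, Measurable fun ω => d n ω b) →
    (∀ ε : ℝ, 0 < ε → ∀ᶠ n in atTop,
      power (P n) (fun ω => thresholdSet (V n ω) (g n ω) (d n ω)) (fun _ => H n) ≤
        fdr (P n) (fun ω => thresholdSet (V n ω) (g n ω) (d n ω)) (H n) + ε) ∧
    (Tendsto (fun n => P n {ω | falseDiscoveryProp (thresholdSet (V n ω) (g n ω) (d n ω)) (H n)
        ≤ α}) atTop (𝓝 1) →
      Tendsto (fun n => power (P n) (fun ω => thresholdSet (V n ω) (g n ω) (d n ω))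
        (fun _ => H n)) atTop (𝓝 0)))

end

end ICube

/-!
Both procedures, and all threshold procedures, act on estimated effects that differ from a common
*score* by a vanishing error. The score of a subject is its signed noise `W i` (the noise of the
outcome, with reversed sign in the control arm), increased by `√(2 r log n)` if the subject is
non-null and treated. Given the split and the assignment, the signed noise is a vector of
independent standard Gaussian variables (`SparseGaussianModel.measureReal_fiber_inter`). The
structure `SparseNoise` collects this with the sizes of the halves, of the arms and of the sets of
treated non-nulls; everything asymptotic is derived from it. Since the empirical means and variances
deviate from their Gaussian values by less than `(log n) ^ (-3)` (`MomentRegular`; the rare signals do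
not matter), the cross-fitted effect is twice the score, and the (studentized) linear effect is the
score, up to an error `1 / log n`.

The Gaussian tail at the level `√(2 q log n)` is `n ^ (-q + o(1))`. Hence there are about
`n ^ (1 - q)` null subjects with a score above this level, which has to be compared with the
`n ^ (1 - β)` non-null subjects: below `√(2 β log n)` the nulls outnumber the non-nulls, above it the
opposite holds. The number of nulls with a score above `u` agrees with its expectation up to a factor
close to one, simultaneously for all `u` up to a level `√(2 q log n)` with `q < 1`, and so does the
number of those with a score below `-u` (`TailRegular`, `eventually_tailRegular`; Chebyshev's
inequality on a grid).

* The automated I³ stops only when there are at least twice as many positive as nonpositive effects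
  among those with `|V| ≥ u`. By the symmetry of the noise this is impossible for `u` below
  `√(2 q log n)`, for `q < β` (`le_score_of_mem_crossfitI3`). If `β < r`, it happens at a level between
  `√(2 β log n)` and the signal at the latest (`mem_crossfitI3`): most treated non-nulls in each half
  are above it, and few negative effects are below its negative.
* The Benjamini-Hochberg procedure rejects at a level `u` only if the number of statistics above `u`
  is at least `1 / α > 1` times its expectation under the null, and the same comparison applies
  (`le_score_of_mem_linearBH`, `mem_linearBH`).

If `r < q < β`, only a vanishing proportion of the non-nulls has a score above `√(2 q log n)`, so the
powers vanish. A threshold procedure whose threshold is below this level in one of the groups rejects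
mostly nulls, so its false discovery proportion is close to one; otherwise it finds almost no
non-null. If `β < q < r`, almost all treated non-nulls have a score above `√(2 q log n)` and are
identified, while the untreated ones have scores like pure noise and are missed. As about half of the
non-nulls are treated, the power tends to `1 / 2`, and that among the treated subjects to `1`.
-/

open MeasureTheory ProbabilityTheory Filter Topology

namespace ICube

noncomputable section

open scoped Classical

set_option linter.unusedSectionVars false

/-! ### The standard Gaussian tail -/

/-- The upper tail `P(Z ≥ u)` of a standard Gaussian variable. -/
def gaussianTail (u : ℝ) : ℝ := (gaussianReal 0 1).real (Set.Ici u)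

lemma gaussianTail_nonneg (u : ℝ) : 0 ≤ gaussianTail u := measureReal_nonneg

lemma gaussianTail_anti : Antitone gaussianTail := fun _ _ h =>
  measureReal_mono (Set.Ici_subset_Ici.2 h)

lemma one_sub_cdf_gaussianReal (u : ℝ) : 1 - cdf (gaussianReal 0 1) u = gaussianTail u := by
  have := nullSingletonClass_gaussianReal (μ := 0) one_ne_zero
  rw [cdf_eq_real, gaussianTail, ← measureReal_congr (Ioi_ae_eq_Ici (μ := gaussianReal 0 1)),
    ← Set.compl_Iic, measureReal_compl measurableSet_Iic]
  simp

lemma gaussianTail_eq_integral (u : ℝ) :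
    gaussianTail u = ∫ x in Set.Ici u, gaussianPDFReal 0 1 x := by
  rw [gaussianTail, measureReal_def, gaussianReal_apply_eq_integral _ one_ne_zero,
    ENNReal.toReal_ofReal (integral_nonneg fun x => gaussianPDFReal_nonneg _ _ _)]

lemma tendsto_gaussianTail_atTop : Tendsto gaussianTail atTop (𝓝 0) := by
  have h := (tendsto_cdf_atTop (gaussianReal 0 1)).const_sub 1
  simpa [one_sub_cdf_gaussianReal] using h

lemma tendsto_gaussianTail_atBot : Tendsto gaussianTail atBot (𝓝 1) := by
  have h := (tendsto_cdf_atBot (gaussianReal 0 1)).const_sub 1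
  simpa [one_sub_cdf_gaussianReal] using h

/-- The Chernoff bound. -/
lemma gaussianTail_le_exp {u : ℝ} (hu : 0 ≤ u) : gaussianTail u ≤ Real.exp (-(u ^ 2 / 2)) := by
  have h := measure_ge_le_exp_mul_mgf (μ := gaussianReal 0 1) (X := id) u hu
    (integrable_exp_mul_gaussianReal u)
  rw [mgf_id_gaussianReal, ← Real.exp_add] at h
  refine h.trans (le_of_eq ?_)
  congr 1
  simp
  ring

/-- A crude lower bound, from the density on `[u, u + 1]`. -/
lemma gaussianPDFReal_le_gaussianTail {u : ℝ} (hu : 0 ≤ u) :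
    gaussianPDFReal 0 1 (u + 1) ≤ gaussianTail u := by
  rw [gaussianTail_eq_integral]
  have h1 : ∫ _ in Set.Icc u (u + 1), gaussianPDFReal 0 1 (u + 1) ≤
      ∫ x in Set.Icc u (u + 1), gaussianPDFReal 0 1 x := by
    refine setIntegral_mono_on (by simp) (integrable_gaussianPDFReal 0 1).integrableOn
      measurableSet_Icc fun x hx => ?_
    simp only [gaussianPDFReal]
    gcongr
    · linarith [hx.1]
    · linarith [hx.2]
  refine le_trans (by simp) (h1.trans ?_)
  exact setIntegral_mono_set (integrable_gaussianPDFReal 0 1).integrableOn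
    (ae_of_all _ fun x => gaussianPDFReal_nonneg _ _ _)
    (LE.le.eventuallyLE fun x hx => hx.1)

/-- A shift of the argument by `e` changes the tail by a factor close to one, as long as the
argument is well below `1 / e`: the density at `x + e` is `exp (-x e - e² / 2)` times that at `x`,
and the part beyond `M` is negligible. -/
lemma gaussianTail_sub_le (u M : ℝ) {e : ℝ} (he : 0 ≤ e) :
    gaussianTail (u - e) ≤
      Real.exp (M * e + e ^ 2 / 2) * gaussianTail u + gaussianTail M := by
  have hint := integrable_gaussianPDFReal 0 1
  have hshift : gaussianTail u = ∫ x in Set.Ici (u - e), gaussianPDFReal 0 1 (x + e) := by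
    rw [gaussianTail_eq_integral]
    have := (measurePreserving_add_right volume e).setIntegral_preimage_emb
      (measurableEmbedding_addRight e) (gaussianPDFReal 0 1) (Set.Ici u)
    rw [← this]
    simp
  have hsplit : Set.Ici (u - e) ⊆ Set.Ico (u - e) M ∪ Set.Ici M := by
    intro x hx
    rcases lt_or_ge x M with h | h
    · exact Or.inl ⟨hx, h⟩
    · exact Or.inr h
  have h1 : gaussianTail (u - e) ≤ (∫ x in Set.Ico (u - e) M, gaussianPDFReal 0 1 x) +
      gaussianTail M := by
    have : ∫ x in Set.Ico (u - e) M, gaussianPDFReal 0 1 x =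
        (gaussianReal 0 1).real (Set.Ico (u - e) M) := by
      rw [measureReal_def, gaussianReal_apply_eq_integral _ one_ne_zero,
        ENNReal.toReal_ofReal (integral_nonneg fun x => gaussianPDFReal_nonneg _ _ _)]
    rw [this]
    exact (measureReal_mono hsplit).trans (measureReal_union_le _ _)
  refine h1.trans (add_le_add_left ?_ _)
  rw [hshift, ← integral_const_mul]
  have hint' : Integrable fun x => Real.exp (M * e + e ^ 2 / 2) * gaussianPDFReal 0 1 (x + e) :=
    (hint.comp_add_right e).const_mul _
  calc ∫ x in Set.Ico (u - e) M, gaussianPDFReal 0 1 x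
      ≤ ∫ x in Set.Ico (u - e) M, Real.exp (M * e + e ^ 2 / 2) * gaussianPDFReal 0 1 (x + e) := by
        refine setIntegral_mono_on hint.integrableOn hint'.integrableOn measurableSet_Ico
          fun x hx => ?_
        simp only [gaussianPDFReal]
        rw [mul_left_comm, ← Real.exp_add]
        gcongr
        have := mul_le_mul_of_nonneg_right hx.2.le he
        simp
        nlinarith
    _ ≤ _ := setIntegral_mono_set hint'.integrableOn
        (ae_of_all _ fun x => mul_nonneg (Real.exp_pos _).le (gaussianPDFReal_nonneg _ _ _))
        (LE.le.eventuallyLE fun x hx => hx.1)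

/-- The level `√(2 q log n)`, which a standard Gaussian variable exceeds with a probability of
order `n ^ (-q)`, up to logarithmic factors. -/
def level (q : ℝ) (n : ℕ) : ℝ := √(2 * q * Real.log n)

lemma level_nonneg (q : ℝ) (n : ℕ) : 0 ≤ level q n := Real.sqrt_nonneg _

lemma level_sq {q : ℝ} (hq : 0 ≤ q) (n : ℕ) : level q n ^ 2 = 2 * q * Real.log n :=
  Real.sq_sqrt (by have := Real.log_natCast_nonneg n; positivity)

lemma level_eq {q : ℝ} (hq : 0 ≤ q) (n : ℕ) : level q n = √(2 * q) * √(Real.log n) := by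
  rw [level, Real.sqrt_mul (by positivity)]

lemma tendsto_log_natCast : Tendsto (fun n : ℕ => Real.log n) atTop atTop :=
  Real.tendsto_log_atTop.comp tendsto_natCast_atTop_atTop

lemma tendsto_level_atTop {q : ℝ} (hq : 0 < q) : Tendsto (level q) atTop atTop :=
  Real.tendsto_sqrt_atTop.comp (tendsto_log_natCast.const_mul_atTop (by positivity))

lemma tendsto_level_sub_atTop {q q' : ℝ} (hq : 0 ≤ q) (h : q < q') :
    Tendsto (fun n => level q' n - level q n) atTop atTop := by
  simp only [level_eq hq, level_eq (hq.trans h.le), ← sub_mul]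
  refine (Real.tendsto_sqrt_atTop.comp tendsto_log_natCast).const_mul_atTop (sub_pos.2 ?_)
  exact Real.sqrt_lt_sqrt (by positivity) (by linarith)

lemma eventually_level_add_le {q q' : ℝ} (hq : 0 ≤ q) (h : q < q') (C : ℝ) :
    ∀ᶠ n in atTop, level q n + C ≤ level q' n := by
  filter_upwards [(tendsto_level_sub_atTop hq h).eventually_ge_atTop C] with n hn
  linarith

lemma tendsto_level_div_log (q : ℝ) (hq : 0 ≤ q) :
    Tendsto (fun n => level q n / Real.log n) atTop (𝓝 0) := by
  have h : Tendsto (fun n : ℕ => √(2 * q) * (√(Real.log n))⁻¹) atTop (𝓝 0) := by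
    simpa using (tendsto_inv_atTop_zero.comp
      (Real.tendsto_sqrt_atTop.comp tendsto_log_natCast)).const_mul (√(2 * q))
  refine h.congr fun n => ?_
  rw [level_eq hq, mul_div_assoc, Real.sqrt_div_self', one_div]

lemma gaussianTail_level_le {q : ℝ} (hq : 0 ≤ q) {n : ℕ} (hn : 0 < n) :
    gaussianTail (level q n) ≤ (n : ℝ) ^ (-q) := by
  refine (gaussianTail_le_exp (level_nonneg q n)).trans (le_of_eq ?_)
  rw [level_sq hq, Real.rpow_def_of_pos (by positivity)]
  congr 1
  ring

lemma eventually_le_gaussianTail_level {q q' : ℝ} (hq : 0 ≤ q) (h : q < q') :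
    ∀ᶠ n : ℕ in atTop, (n : ℝ) ^ (-q') ≤ gaussianTail (level q n + 1) := by
  set c : ℝ := Real.log √(2 * Real.pi)
  have h1 : Tendsto (fun n : ℕ => 2 * (level q n / Real.log n) + (2 + c) / Real.log n) atTop
      (𝓝 0) := by
    simpa using ((tendsto_level_div_log q hq).const_mul 2).add
      (tendsto_log_natCast.const_div_atTop (2 + c))
  filter_upwards [h1.eventually_le_const (sub_pos.2 h), eventually_gt_atTop 1] with n hn hn1
  have hlog : 0 < Real.log n := Real.log_pos (by exact_mod_cast hn1)
  have h2 : 2 * level q n + (2 + c) ≤ (q' - q) * Real.log n := by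
    rw [← mul_div_assoc, ← add_div, div_le_iff₀ hlog] at hn
    exact hn
  refine le_trans ?_ (gaussianPDFReal_le_gaussianTail (by linarith [level_nonneg q n]))
  rw [Real.rpow_def_of_pos (by positivity), gaussianPDFReal]
  have h3 : (√(2 * Real.pi * ((1 : NNReal) : ℝ)))⁻¹ = Real.exp (-c) := by
    rw [Real.exp_neg, Real.exp_log (by positivity)]
    simp
  rw [h3, ← Real.exp_add]
  gcongr
  have := level_sq hq n
  simp
  nlinarith

/-- Below the level `√(2 q log n)`, a shift of the argument by `C / log n` changes the Gaussian tail
by at most a factor `1 + δ`. -/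
lemma eventually_gaussianTail_sub_le {q : ℝ} (hq : 0 ≤ q) (hq1 : q < 1) {C δ : ℝ} (hC : 0 ≤ C)
    (hδ : 0 < δ) :
    ∀ᶠ n : ℕ in atTop, ∀ u ≤ level q n,
      gaussianTail (u - C / Real.log n) ≤ (1 + δ) * gaussianTail u := by
  have h1 : Tendsto (fun n : ℕ => Real.exp (level 4 n * (C / Real.log n) +
      (C / Real.log n) ^ 2 / 2)) atTop (𝓝 1) := by
    have ha : Tendsto (fun n : ℕ => C / Real.log n) atTop (𝓝 0) :=
      tendsto_log_natCast.const_div_atTop C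
    have hb := ((tendsto_level_div_log 4 (by norm_num)).const_mul C).add ((ha.pow 2).div_const 2)
    have hc := (Real.continuous_exp.tendsto _).comp hb
    simp only [mul_zero, zero_pow two_ne_zero, zero_div, add_zero, Real.exp_zero] at hc
    refine hc.congr fun n => ?_
    simp only [Function.comp]
    congr 2
    ring
  have h2 : Tendsto (fun n : ℕ => (n : ℝ) ^ (-3 : ℝ)) atTop (𝓝 0) :=
    (tendsto_rpow_neg_atTop (by norm_num)).comp tendsto_natCast_atTop_atTop
  filter_upwards [h1.eventually_le_const (show (1 : ℝ) < 1 + δ / 2 by linarith),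
    h2.eventually_le_const (show 0 < δ / 2 by linarith),
    eventually_le_gaussianTail_level hq hq1, eventually_gt_atTop 1] with n h1n h2n h3n hn u hu
  have hn0 : (0 : ℝ) < n := by exact_mod_cast (by omega : 0 < n)
  have hlog : 0 < Real.log n := Real.log_pos (by exact_mod_cast hn)
  -- the tail beyond `√(8 log n)` is at most `n ^ (-4)`, hence negligible compared with the tail at
  -- any `u` up to `√(2 q log n)`, which is at least `n ^ (-1)`
  have h4 : gaussianTail (level 4 n) ≤ δ / 2 * gaussianTail u := by
    have h5 : gaussianTail (level q n + 1) ≤ gaussianTail u := gaussianTail_anti (by linarith)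
    have h6 := gaussianTail_level_le (q := 4) (by norm_num) (n := n) (by omega)
    have h7 : (n : ℝ) ^ (-4 : ℝ) = (n : ℝ) ^ (-3 : ℝ) * (n : ℝ) ^ (-1 : ℝ) := by
      rw [← Real.rpow_add hn0]; norm_num
    calc _ ≤ (n : ℝ) ^ (-3 : ℝ) * (n : ℝ) ^ (-1 : ℝ) := h7 ▸ h6
      _ ≤ δ / 2 * gaussianTail u := by
        gcongr
        exact h3n.trans h5
  have h8 := gaussianTail_sub_le u (level 4 n) (e := C / Real.log n) (by positivity)
  have h9 := mul_le_mul_of_nonneg_right h1n (gaussianTail_nonneg u)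
  linarith

/-! ### Second-moment bounds -/

section Chebyshev

variable {ι Ω : Type*} [MeasurableSpace Ω] {μ : Measure Ω} [IsProbabilityMeasure μ]

/-- Chebyshev's inequality for a sum of pairwise uncorrelated or negatively correlated
variables. -/
lemma measureReal_abs_sum_sub_ge_le {X : ι → Ω → ℝ} {T : Finset ι} {m v x : ℝ}
    (hX : ∀ i ∈ T, MemLp (X i) 2 μ) (hm : ∀ i ∈ T, ∫ ω, X i ω ∂μ = m)
    (hcov : ∀ i ∈ T, ∀ j ∈ T, i ≠ j → cov[X i, X j; μ] ≤ 0)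
    (hvar : ∀ i ∈ T, Var[X i; μ] ≤ v) (hx : 0 < x) :
    μ.real {ω | x ≤ |∑ i ∈ T, X i ω - T.card * m|} ≤ T.card * v / x ^ 2 := by
  have hL : MemLp (fun ω => ∑ i ∈ T, X i ω) 2 μ := memLp_finsetSum _ hX
  have hE : ∫ ω, ∑ i ∈ T, X i ω ∂μ = T.card * m := by
    rw [integral_finsetSum _ fun i hi => (hX i hi).integrable (by norm_num),
      Finset.sum_congr rfl hm]
    simp
  have hV : Var[fun ω => ∑ i ∈ T, X i ω; μ] ≤ T.card * v := by
    rw [variance_fun_sum' hX, ← nsmul_eq_mul]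
    refine Finset.sum_le_card_nsmul _ _ _ fun i hi => ?_
    rw [← Finset.add_sum_erase _ _ hi, covariance_self (hX i hi).aemeasurable]
    have h2 : ∑ j ∈ T.erase i, cov[X i, X j; μ] ≤ 0 := Finset.sum_nonpos fun j hj =>
      hcov i hi j (Finset.mem_of_mem_erase hj) (Finset.ne_of_mem_erase hj).symm
    linarith [hvar i hi]
  have h := meas_ge_le_variance_div_sq hL hx
  rw [hE] at h
  have h3 := ENNReal.toReal_mono ENNReal.ofReal_ne_top h
  rw [ENNReal.toReal_ofReal (div_nonneg (variance_nonneg _ _) (sq_nonneg _))] at h3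
  exact h3.trans (by gcongr)

/-- The number of the events `E i`, `i ∈ T`, that occur is close to its expectation if the events
have the same probability and are pairwise independent or negatively correlated. -/
lemma measureReal_abs_card_sub_ge_le {E : ι → Set Ω} {T : Finset ι} {p δ : ℝ}
    (hE : ∀ i ∈ T, MeasurableSet (E i)) (hp : ∀ i ∈ T, μ.real (E i) = p)
    (hpair : ∀ i ∈ T, ∀ j ∈ T, i ≠ j → μ.real (E i ∩ E j) ≤ p ^ 2)
    (hT : T.Nonempty) (hp0 : 0 < p) (hδ : 0 < δ) :
    μ.real {ω | δ * (T.card * p) ≤ |((T.filter fun i => ω ∈ E i).card : ℝ) - T.card * p|} ≤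
      1 / (δ ^ 2 * (T.card * p)) := by
  have hc : (0 : ℝ) < T.card := by exact_mod_cast hT.card_pos
  have hX : ∀ i ∈ T, MemLp ((E i).indicator (1 : Ω → ℝ)) 2 μ := fun i hi =>
    (memLp_const (1 : ℝ)).indicator (hE i hi)
  have hm : ∀ i ∈ T, ∫ ω, (E i).indicator (1 : Ω → ℝ) ω ∂μ = p := fun i hi => by
    rw [integral_indicator_one (hE i hi), hp i hi]
  have hmul : ∀ i j, ((E i).indicator (1 : Ω → ℝ)) * ((E j).indicator 1) =
      (E i ∩ E j).indicator 1 := fun i j => by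
    ext ω
    by_cases h1 : ω ∈ E i <;> by_cases h2 : ω ∈ E j <;> simp [h1, h2]
  have h := measureReal_abs_sum_sub_ge_le (v := p) (x := δ * (T.card * p)) hX hm ?_ ?_
    (by positivity)
  · refine le_trans (le_of_eq ?_) (h.trans (le_of_eq ?_))
    · congr 1
      ext ω
      simp [Set.indicator_apply, Finset.sum_boole]
    · field_simp
  · intro i hi j hj hij
    rw [covariance_eq_sub (hX i hi) (hX j hj), hmul, hm i hi, hm j hj,
      integral_indicator_one ((hE i hi).inter (hE j hj))]
    nlinarith [hpair i hi j hj hij]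
  · intro i hi
    rw [variance_eq_sub (hX i hi), hm i hi, pow_two, hmul, Set.inter_self, hm i hi]
    nlinarith [sq_nonneg p]

end Chebyshev

/-! ### Independent standard Gaussian noise -/

/-- The law of `n` independent standard Gaussian variables. -/
abbrev gaussianPi (n : ℕ) : Measure (Fin n → ℝ) := Measure.pi fun _ => gaussianReal 0 1

lemma gaussianPi_real_eval_preimage {n : ℕ} (i : Fin n) {B : Set ℝ} (hB : MeasurableSet B) :
    (gaussianPi n).real {w | w i ∈ B} = (gaussianReal 0 1).real B :=
  (measurePreserving_eval (fun _ : Fin n => gaussianReal 0 1) i).measureReal_preimage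
    hB.nullMeasurableSet

lemma gaussianPi_real_neg {n : ℕ} (p : (Fin n → ℝ) → Prop) :
    (gaussianPi n).real {w | p (fun i => -w i)} = (gaussianPi n).real {w | p w} := by
  have h1 : MeasurePreserving (fun x : ℝ => -x) (gaussianReal 0 1) (gaussianReal 0 1) :=
    ⟨measurable_neg, by rw [gaussianReal_map_neg, neg_zero]⟩
  have h2 := measurePreserving_pi (fun _ : Fin n => gaussianReal 0 1) (fun _ => gaussianReal 0 1)
    (fun _ => h1)
  have h3 := h2.measure_preimage_emb (MeasurableEquiv.neg (Fin n → ℝ)).measurableEmbedding {w | p w}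
  exact congrArg ENNReal.toReal h3

lemma gaussianPi_card_sub_ge_le {n : ℕ} {T : Finset (Fin n)} (hT : T.Nonempty) {B : Set ℝ}
    (hB : MeasurableSet B) (hB0 : 0 < (gaussianReal 0 1).real B) {δ : ℝ} (hδ : 0 < δ) :
    (gaussianPi n).real {w | δ * (T.card * (gaussianReal 0 1).real B) ≤
      |((T.filter fun i => w i ∈ B).card : ℝ) - T.card * (gaussianReal 0 1).real B|} ≤
      1 / (δ ^ 2 * (T.card * (gaussianReal 0 1).real B)) := by
  have hm : ∀ i : Fin n, MeasurableSet {w : Fin n → ℝ | w i ∈ B} := fun i => by measurability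
  refine measureReal_abs_card_sub_ge_le (E := fun i => {w : Fin n → ℝ | w i ∈ B})
    (fun i _ => hm i) (fun i _ => gaussianPi_real_eval_preimage i hB) ?_ hT hB0 hδ
  intro i _ j _ hij
  have hind := (iIndepFun_pi (μ := fun _ : Fin n => gaussianReal 0 1) (X := fun _ x => x)
    fun i => aemeasurable_id).indepFun hij
  have h := hind.measure_inter_preimage_eq_mul _ _ hB hB
  have h' := congrArg ENNReal.toReal h
  rw [ENNReal.toReal_mul] at h'
  have hi := gaussianPi_real_eval_preimage i hB
  have hj := gaussianPi_real_eval_preimage j hB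
  refine le_of_eq (h'.trans ?_)
  rw [pow_two]
  exact congrArg₂ (· * ·) hi hj

/-- Markov's inequality for the number of coordinates in `B`. -/
lemma gaussianPi_card_gt_le {n : ℕ} (T : Finset (Fin n)) {B : Set ℝ}
    (hB : MeasurableSet B) {η : ℝ} (hη : 0 < η) :
    (gaussianPi n).real {w | η * T.card < ((T.filter fun i => w i ∈ B).card : ℝ)} ≤
      (gaussianReal 0 1).real B / η := by
  rcases T.eq_empty_or_nonempty with rfl | hT
  · simp only [Finset.card_empty, Nat.cast_zero, mul_zero, Finset.filter_empty, lt_irrefl,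
      Set.ofPred_false, measureReal_empty]
    positivity
  have hc : (0 : ℝ) < T.card := by exact_mod_cast hT.card_pos
  have hm : ∀ i : Fin n, MeasurableSet {w : Fin n → ℝ | w i ∈ B} := fun i => by measurability
  have hi : ∀ i ∈ T, Integrable ({w : Fin n → ℝ | w i ∈ B}.indicator (1 : (Fin n → ℝ) → ℝ))
      (gaussianPi n) := fun i _ => (integrable_const (1 : ℝ)).indicator (hm i)
  have hint := integrable_finsetSum T hi
  have h := mul_meas_ge_le_integral_of_nonneg (μ := gaussianPi n)
    (f := fun w => ∑ i ∈ T, {w : Fin n → ℝ | w i ∈ B}.indicator (1 : (Fin n → ℝ) → ℝ) w)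
    (ae_of_all _ fun w => Finset.sum_nonneg fun i _ => Set.indicator_nonneg (by simp) _)
    hint (η * T.card)
  rw [integral_finsetSum _ hi] at h
  simp only [integral_indicator_one (hm _), gaussianPi_real_eval_preimage _ hB,
    Finset.sum_const, nsmul_eq_mul] at h
  rw [le_div_iff₀ hη]
  refine le_of_mul_le_mul_left (le_trans ?_ h) hc
  rw [mul_comm _ η, ← mul_assoc, mul_comm _ η]
  refine mul_le_mul_of_nonneg_left (measureReal_mono ?_) (by positivity)
  intro w hw
  simp only [Set.mem_ofPred_eq, Set.indicator_apply, Pi.one_apply, Finset.sum_boole] at hw ⊢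
  exact hw.le

/-- Chebyshev's inequality for a sum of functions of the coordinates. -/
lemma gaussianPi_sum_ge_le {n : ℕ} (T : Finset (Fin n)) {f : Fin n → ℝ → ℝ} {v x : ℝ}
    (hf : ∀ i, MemLp (f i) 2 (gaussianReal 0 1)) (hm : ∀ i, ∫ z, f i z ∂(gaussianReal 0 1) = 0)
    (hv : ∀ i, Var[f i; gaussianReal 0 1] ≤ v) (hx : 0 < x) :
    (gaussianPi n).real {w | x ≤ |∑ i ∈ T, f i (w i)|} ≤ T.card * v / x ^ 2 := by
  have hev := fun i => measurePreserving_eval (fun _ : Fin n => gaussianReal 0 1) i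
  have h := measureReal_abs_sum_sub_ge_le (μ := gaussianPi n) (X := fun i w => f i (w i))
    (T := T) (m := 0) (v := v) (x := x) (fun i _ => (hf i).comp_measurePreserving (hev i))
    (fun i _ => ?_) (fun i _ j _ hij => ?_) (fun i _ => ?_) hx
  · simpa using h
  · rw [integral_comp_eval (μ := fun _ : Fin n => gaussianReal 0 1) (hf i).1, hm]
  · have hind := (iIndepFun_pi (μ := fun _ : Fin n => gaussianReal 0 1) (X := f)
      fun i => (hf i).aemeasurable).indepFun hij
    exact (hind.covariance_eq_zero ((hf i).comp_measurePreserving (hev i))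
      ((hf j).comp_measurePreserving (hev j))).le
  · refine le_trans (le_of_eq ?_) (hv i)
    have := variance_map (X := f i) (Y := fun w : Fin n → ℝ => w i) (μ := gaussianPi n)
      (by rw [(hev i).map_eq]; exact (hf i).aemeasurable) (measurable_pi_apply i).aemeasurable
    rw [(hev i).map_eq] at this
    exact this.symm

/-! ### Uniform control of the empirical tails -/

/-- The numbers of coordinates of `w` in `T` that are at least `u` agree with their expectations
under standard Gaussian noise, up to a factor `1 ± δ`, for all `u` in `[lo, hi]`. -/
def TailRegular {n : ℕ} (T : Finset (Fin n)) (δ lo hi : ℝ) (w : Fin n → ℝ) : Prop :=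
  ∀ u, lo ≤ u → u ≤ hi →
    (1 - δ) * (T.card * gaussianTail u) ≤ ((T.filter fun i => u ≤ w i).card : ℝ) ∧
    ((T.filter fun i => u ≤ w i).card : ℝ) ≤ (1 + δ) * (T.card * gaussianTail u)

lemma tendsto_log_pow_mul_rpow_neg (k : ℕ) {s : ℝ} (hs : 0 < s) :
    Tendsto (fun n : ℕ => Real.log n ^ k * (n : ℝ) ^ (-s)) atTop (𝓝 0) := by
  have h := (isLittleO_log_rpow_rpow_atTop (k : ℝ) hs).tendsto_div_nhds_zero.comp
    tendsto_natCast_atTop_atTop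
  refine h.congr fun n => ?_
  simp only [Function.comp, Real.rpow_natCast]
  rw [Real.rpow_neg (by positivity), div_eq_mul_inv]

/-- Tails that are regular at the points of a grid of mesh `e` are regular everywhere, as long as a
shift by `e` changes the Gaussian tail by a factor at most `1 + d`. -/
lemma tailRegular_of_grid {n N : ℕ} {T : Finset (Fin n)} {d B hi l : ℝ} {w : Fin n → ℝ}
    (hd0 : 0 < d) (hd1 : d ≤ 1 / 3) (hl1 : 1 ≤ l)
    (hratio : ∀ u ≤ hi + 1, gaussianTail (u - 1 / l) ≤ (1 + d) * gaussianTail u)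
    (hN : ⌊(hi + B) * l⌋₊ + 1 < N)
    (hgood : ∀ j < N, -B + j / l ≤ hi + 1 →
      (1 - d) * (T.card * gaussianTail (-B + j / l)) ≤
        ((T.filter fun i => -B + j / l ≤ w i).card : ℝ) ∧
      ((T.filter fun i => -B + j / l ≤ w i).card : ℝ) ≤
        (1 + d) * (T.card * gaussianTail (-B + j / l))) :
    TailRegular T (3 * d) (-B) hi w := by
  intro u hu1 hu2
  have hl0 : 0 < l := by linarith
  have hil : 1 / l ≤ 1 := by rw [div_le_one hl0]; exact hl1
  have hx0 : 0 ≤ (u + B) * l := mul_nonneg (by linarith) hl0.le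
  -- `u` lies between the grid points with the numbers `j` and `j + 1`
  obtain ⟨j, hj⟩ : ∃ j, j = ⌊(u + B) * l⌋₊ := ⟨_, rfl⟩
  have hjN : j + 1 < N := by
    have : j ≤ ⌊(hi + B) * l⌋₊ := hj ▸ Nat.floor_mono (by gcongr)
    omega
  have hj1 : -B + (j : ℝ) / l ≤ u := by
    have := Nat.floor_le hx0
    rw [← div_le_iff₀ hl0, ← hj] at this
    linarith
  have hj2 : u ≤ -B + ((j + 1 : ℕ) : ℝ) / l := by
    have := (Nat.lt_floor_add_one ((u + B) * l)).le
    rw [← le_div_iff₀ hl0, ← hj] at this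
    push_cast
    linarith
  have hstep : -B + ((j + 1 : ℕ) : ℝ) / l - 1 / l = -B + (j : ℝ) / l := by
    push_cast
    ring
  obtain ⟨-, hup⟩ := hgood j (by omega) (by linarith)
  obtain ⟨hlo, -⟩ := hgood (j + 1) hjN (by linarith)
  generalize -B + (j : ℝ) / l = x at *
  generalize -B + ((j + 1 : ℕ) : ℝ) / l = x' at *
  have hr1 : gaussianTail x ≤ (1 + d) * gaussianTail u :=
    (gaussianTail_anti (by linarith)).trans (hratio u (by linarith))
  have hr2 : gaussianTail u ≤ (1 + d) * gaussianTail x' :=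
    (gaussianTail_anti (by linarith)).trans (hratio x' (by linarith))
  have hc1 : ((T.filter fun i => u ≤ w i).card : ℝ) ≤ (T.filter fun i => x ≤ w i).card :=
    Nat.cast_le.2 (Finset.card_le_card
      (Finset.monotone_filter_right _ fun i _ h => hj1.trans h))
  have hc2 : ((T.filter fun i => x' ≤ w i).card : ℝ) ≤ (T.filter fun i => u ≤ w i).card :=
    Nat.cast_le.2 (Finset.card_le_card
      (Finset.monotone_filter_right _ fun i _ h => hj2.trans h))
  have hG := gaussianTail_nonneg x'
  have hU := gaussianTail_nonneg u
  have hTc : (0 : ℝ) ≤ T.card := Nat.cast_nonneg _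
  constructor
  · refine le_trans ?_ (hlo.trans hc2)
    rw [mul_left_comm, mul_left_comm (1 - d)]
    refine mul_le_mul_of_nonneg_left ?_ hTc
    calc (1 - 3 * d) * gaussianTail u ≤ (1 - 3 * d) * ((1 + d) * gaussianTail x') :=
          mul_le_mul_of_nonneg_left hr2 (by linarith)
      _ ≤ (1 - d) * gaussianTail x' := by
          rw [← mul_assoc]
          exact mul_le_mul_of_nonneg_right (by nlinarith) hG
  · refine (hc1.trans hup).trans ?_
    rw [mul_left_comm, mul_left_comm (1 + 3 * d)]
    refine mul_le_mul_of_nonneg_left ?_ hTc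
    calc (1 + d) * gaussianTail x ≤ (1 + d) * ((1 + d) * gaussianTail u) :=
          mul_le_mul_of_nonneg_left hr1 (by linarith)
      _ ≤ (1 + 3 * d) * gaussianTail u := by
          rw [← mul_assoc]
          exact mul_le_mul_of_nonneg_right (by nlinarith) hU

/-- Gaussian noise has regular tails up to the level `√(2 q log n)` for `q < 1`, with high
probability. By Chebyshev's inequality this holds at the points of a grid of mesh `1 / log n`, and
between two neighbouring points of the grid the Gaussian tail hardly changes. -/
lemma eventually_tailRegular {q : ℝ} (hq : 0 ≤ q) (hq1 : q < 1) (B : ℝ) {δ : ℝ} (hδ : 0 < δ)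
    (hδ1 : δ ≤ 1) {ε : ℝ} (hε : 0 < ε) :
    ∀ᶠ n : ℕ in atTop, ∀ T : Finset (Fin n), (n : ℝ) ≤ 8 * T.card →
      (gaussianPi n).real {w | ¬ TailRegular T δ (-B) (level q n) w} ≤ ε := by
  -- The grid goes beyond `√(2 q log n)` by at most one, hence stays below `√(2 q₁ log n)`, and up to
  -- there the tails are at least `n ^ (-q₃)`.
  obtain ⟨q₁, hqq₁, hq₁1⟩ := exists_between hq1
  obtain ⟨q₃, hq₁₃, hq₃1⟩ := exists_between hq₁1
  have hq₁ : 0 ≤ q₁ := hq.trans hqq₁.le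
  obtain ⟨d, hd⟩ : ∃ d, δ = 3 * d := ⟨δ / 3, by ring⟩
  have hd0 : 0 < d := by linarith
  have hlim : Tendsto (fun n : ℕ => 8 / d ^ 2 * (2 * (Real.log n ^ 2 * (n : ℝ) ^ (-(1 - q₃))) +
      2 * (n : ℝ) ^ (-(1 - q₃)))) atTop (𝓝 0) := by
    have h1 := tendsto_log_pow_mul_rpow_neg 2 (sub_pos.2 hq₃1)
    have h2 := tendsto_log_pow_mul_rpow_neg 0 (sub_pos.2 hq₃1)
    simp only [pow_zero, one_mul] at h2
    simpa using ((h1.const_mul 2).add (h2.const_mul 2)).const_mul (8 / d ^ 2)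
  filter_upwards [hlim.eventually_le_const hε,
    eventually_gaussianTail_sub_le hq₁ hq₁1 zero_le_one hd0,
    eventually_level_add_le hq hqq₁ 1,
    eventually_le_gaussianTail_level hq₁ hq₁₃,
    (tendsto_level_div_log q hq).eventually_le_const one_pos,
    tendsto_log_natCast.eventually_ge_atTop (max 1 B), eventually_gt_atTop 1]
    with n hn hratio hl1 hlow hlog1 hlogB hn1 T hT
  have hn0 : (0 : ℝ) < n := by exact_mod_cast (by omega : 0 < n)
  have hpow : (n : ℝ) ^ (-(1 - q₃)) * (n * (n : ℝ) ^ (-q₃)) = 1 := by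
    rw [← Real.rpow_one_add' hn0.le (by linarith), ← Real.rpow_add hn0]
    ring_nf
    simp
  have hnp : (0 : ℝ) < (n : ℝ) ^ (-q₃) := by positivity
  have hnp' : (0 : ℝ) < (n : ℝ) ^ (-(1 - q₃)) := by positivity
  generalize (n : ℝ) ^ (-(1 - q₃)) = a at *
  generalize (n : ℝ) ^ (-q₃) = b at *
  generalize Real.log n = l at *
  generalize level q n = L at *
  have hl : 1 ≤ l := (le_max_left _ _).trans hlogB
  have hBl : B ≤ l := (le_max_right _ _).trans hlogB
  have hl0 : 0 < l := by linarith
  have hlevel : L ≤ l := by rwa [div_le_one hl0] at hlog1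
  have hTc : (0 : ℝ) < T.card := by linarith
  have hTne : T.Nonempty := Finset.card_pos.1 (by exact_mod_cast hTc)
  -- there are `O((log n) ^ 2)` grid points, each of which fails with probability
  -- `O(n ^ (-(1 - q₃)))`
  obtain ⟨N, hN⟩ : ∃ N, N = ⌊(L + B) * l⌋₊ + 2 := ⟨_, rfl⟩
  let bad : ℕ → Set (Fin n → ℝ) := fun j => {w | d * (T.card * gaussianTail (-B + j / l)) ≤
    |((T.filter fun i => -B + j / l ≤ w i).card : ℝ) - T.card * gaussianTail (-B + j / l)|}
  let J := (Finset.range N).filter fun j : ℕ => -B + j / l ≤ L + 1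
  have hsub : {w | ¬ TailRegular T δ (-B) L w} ⊆ ⋃ j ∈ J, bad j := by
    intro w hw
    by_contra hcon
    simp only [Set.mem_iUnion, not_exists] at hcon
    refine hw (hd ▸ tailRegular_of_grid (N := N) hd0 (by linarith) hl
      (fun u hu => hratio u (by linarith)) (by omega) fun j hj hj2 => ?_)
    have h := hcon j (Finset.mem_filter.2 ⟨Finset.mem_range.2 hj, hj2⟩)
    simp only [bad, Set.mem_ofPred_eq, not_le] at h
    have := abs_lt.1 h
    constructor <;> linarith
  have hbad : ∀ j ∈ J, (gaussianPi n).real (bad j) ≤ 8 / d ^ 2 * a := by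
    intro j hj
    have hlow' : b ≤ gaussianTail (-B + j / l) := by
      refine hlow.trans (gaussianTail_anti ?_)
      have := (Finset.mem_filter.1 hj).2
      linarith
    have h := gaussianPi_card_sub_ge_le hTne (B := Set.Ici (-B + j / l)) measurableSet_Ici
      (hnp.trans_le hlow') hd0
    refine le_trans h ?_
    change 1 / (d ^ 2 * (T.card * gaussianTail (-B + j / l))) ≤ _
    rw [div_le_iff₀ (by have := hnp.trans_le hlow'; positivity)]
    have h1 : n / 8 * b ≤ T.card * gaussianTail (-B + j / l) := by
      gcongr
      linarith
    calc (1 : ℝ) = 8 / d ^ 2 * a * (d ^ 2 * (n / 8 * b)) := by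
          rw [← hpow]
          field_simp
      _ ≤ _ := by gcongr
  have hNle : (N : ℝ) ≤ 2 * l ^ 2 + 2 := by
    rw [hN]
    push_cast
    gcongr
    rcases le_or_gt 0 ((L + B) * l) with h | h
    · refine (Nat.floor_le h).trans ?_
      nlinarith
    · rw [Nat.floor_of_nonpos h.le, Nat.cast_zero]
      positivity
  calc _ ≤ _ := measureReal_mono hsub (measure_ne_top _ _)
    _ ≤ ∑ j ∈ J, (gaussianPi n).real (bad j) := measureReal_biUnion_finset_le _ _
    _ ≤ ∑ j ∈ J, 8 / d ^ 2 * a := Finset.sum_le_sum hbad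
    _ ≤ N * (8 / d ^ 2 * a) := by
        rw [Finset.sum_const, nsmul_eq_mul]
        gcongr
        exact (Finset.card_filter_le _ _).trans (Finset.card_range N).le
    _ ≤ (2 * l ^ 2 + 2) * (8 / d ^ 2 * a) := by gcongr
    _ ≤ ε := by
        refine le_trans (le_of_eq ?_) hn
        ring

/-! ### Signed noise, treatment assignment and split -/

/-- The noise of the outcomes, with its sign reversed for the untreated subjects. Every estimated
effect of subject `i` is, up to a factor and a small error, the signed noise plus the signal of a
treated non-null subject. -/
def signedNoise {n : ℕ} {Ω : Type*} (μ : ℝ) (H : Finset (Fin n)) (YC YT : Fin n → Ω → ℝ)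
    (A : Fin n → Ω → Bool) (ω : Ω) (i : Fin n) : ℝ :=
  if A i ω = true then YT i ω - (if i ∈ H then μ else 0) else -YC i ω

namespace SparseGaussianModel

variable {n : ℕ} {Ω : Type*} [MeasurableSpace Ω] {P : Measure Ω}
  {r : ℝ} {H : Finset (Fin n)} {YC YT : Fin n → Ω → ℝ} {A S : Fin n → Ω → Bool}

lemma measurable_assignment (h : SparseGaussianModel P r H YC YT A S) :
    Measurable fun ω i => A i ω := measurable_pi_iff.2 h.measurable_A

lemma measurable_split (h : SparseGaussianModel P r H YC YT A S) :
    Measurable fun ω i => S i ω := measurable_pi_iff.2 h.measurable_S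

lemma measurable_outcomes (h : SparseGaussianModel P r H YC YT A S) :
    Measurable fun ω i => (YC i ω, YT i ω) :=
  measurable_pi_iff.2 fun i => (h.measurable_YC i).prodMk (h.measurable_YT i)

variable [IsProbabilityMeasure P]

/-- Given the assignments `a`, the signed noise is a vector of independent standard Gaussian
variables. -/
lemma map_signedNoise_of_assignment (h : SparseGaussianModel P r H YC YT A S)
    (a : Fin n → Bool) :
    P.map (fun ω => signedNoise (level r n) H YC YT (fun i _ => a i) ω) = gaussianPi n := by
  let f : Fin n → ℝ × ℝ → ℝ := fun i z =>
    if a i = true then z.2 - (if i ∈ H then level r n else 0) else -z.1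
  have hf : ∀ i, Measurable (f i) := fun i => by
    by_cases ha : a i = true
    · simp only [f, ha, if_true]; fun_prop
    · simp only [f, if_neg ha]; fun_prop
  have hind := h.indep_Y.comp f hf
  have hm : ∀ i, Measurable (f i ∘ fun ω => (YC i ω, YT i ω)) := fun i =>
    (hf i).comp ((h.measurable_YC i).prodMk (h.measurable_YT i))
  rw [iIndepFun_iff_map_fun_eq_pi_map fun i => (hm i).aemeasurable] at hind
  refine hind.trans ?_
  congr 1
  funext i
  by_cases ha : a i = true
  · have h1 := gaussianReal_map_sub_const (μ := if i ∈ H then level r n else 0) (v := 1)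
      (if i ∈ H then level r n else 0)
    rw [sub_self] at h1
    rw [← h1, level, ← h.law_YT i, Measure.map_map (by fun_prop) (h.measurable_YT i)]
    congr 1
    funext ω
    simp [f, ha, level]
  · have h1 := gaussianReal_map_neg (μ := 0) (v := 1)
    rw [neg_zero] at h1
    rw [← h1, ← h.law_YC i, Measure.map_map (by fun_prop) (h.measurable_YC i)]
    congr 1
    funext ω
    simp [f, ha]

/-- The signed noise is standard Gaussian and independent of the assignments and of the split. -/
lemma measureReal_fiber_inter (h : SparseGaussianModel P r H YC YT A S) (s a : Fin n → Bool)
    {B : Set (Fin n → ℝ)} (hB : MeasurableSet B) :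
    P.real {ω | (fun i => S i ω) = s ∧ (fun i => A i ω) = a ∧
        signedNoise (level r n) H YC YT A ω ∈ B} =
      P.real {ω | (fun i => S i ω) = s ∧ (fun i => A i ω) = a} * (gaussianPi n).real B := by
  let F : (Fin n → ℝ × ℝ) → Fin n → ℝ := fun z i =>
    if a i = true then (z i).2 - (if i ∈ H then level r n else 0) else -(z i).1
  have hF : Measurable F := measurable_pi_iff.2 fun i => by
    by_cases ha : a i = true
    · simp only [F, ha, if_true]; fun_prop
    · simp only [F, if_neg ha]; fun_prop
  have hmap : P ((fun ω i => (YC i ω, YT i ω)) ⁻¹' (F ⁻¹' B)) = gaussianPi n B := by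
    rw [← h.map_signedNoise_of_assignment a, Measure.map_apply ?_ hB]
    · rfl
    · exact hF.comp h.measurable_outcomes
  have hA := h.indep_A.measure_inter_preimage_eq_mul {a} (F ⁻¹' B) (measurableSet_singleton a)
    (hF hB)
  let p : (Fin n → Bool × ℝ × ℝ) → (Fin n → Bool) × (Fin n → ℝ × ℝ) :=
    fun z => (fun i => (z i).1, fun i => (z i).2)
  have hp : Measurable p := by fun_prop
  have hS := h.indep_S.measure_inter_preimage_eq_mul {s} (p ⁻¹' ({a} ×ˢ (F ⁻¹' B)))
    (measurableSet_singleton s) (hp ((measurableSet_singleton a).prod (hF hB)))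
  have hS' := h.indep_S.measure_inter_preimage_eq_mul {s} (p ⁻¹' ({a} ×ˢ Set.univ))
    (measurableSet_singleton s) (hp ((measurableSet_singleton a).prod MeasurableSet.univ))
  have e1 : {ω | (fun i => S i ω) = s ∧ (fun i => A i ω) = a ∧
      signedNoise (level r n) H YC YT A ω ∈ B} = (fun ω i => S i ω) ⁻¹' {s} ∩
      (fun ω i => (A i ω, YC i ω, YT i ω)) ⁻¹' (p ⁻¹' ({a} ×ˢ (F ⁻¹' B))) := by
    ext ω
    simp only [Set.mem_ofPred_eq, Set.mem_inter_iff, Set.mem_preimage, Set.mem_singleton_iff,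
      Set.mem_prod, p]
    refine and_congr_right fun _ => and_congr_right fun ha => ?_
    rw [show signedNoise (level r n) H YC YT A ω = F fun i => (YC i ω, YT i ω) from ?_]
    funext i
    simp only [signedNoise, F, ← congrFun ha i]
  have e2 : {ω | (fun i => S i ω) = s ∧ (fun i => A i ω) = a} = (fun ω i => S i ω) ⁻¹' {s} ∩
      (fun ω i => (A i ω, YC i ω, YT i ω)) ⁻¹' (p ⁻¹' ({a} ×ˢ Set.univ)) := by
    ext ω
    simp [p]
  have e3 : (fun ω i => (A i ω, YC i ω, YT i ω)) ⁻¹' (p ⁻¹' ({a} ×ˢ (F ⁻¹' B))) =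
      (fun ω i => A i ω) ⁻¹' {a} ∩ (fun ω i => (YC i ω, YT i ω)) ⁻¹' (F ⁻¹' B) := by
    ext ω
    simp [p]
  have e4 : (fun ω i => (A i ω, YC i ω, YT i ω)) ⁻¹' (p ⁻¹' ({a} ×ˢ Set.univ)) =
      (fun ω i => A i ω) ⁻¹' {a} := by
    ext ω
    simp [p]
  rw [measureReal_def, measureReal_def, measureReal_def, ← ENNReal.toReal_mul, e1, e2, hS, hS', e3,
    e4, hA, hmap, mul_assoc]

/-- A bound for the noise that holds for all good assignments and splits carries over to the
random assignments and splits. -/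
lemma measureReal_good_and_le (h : SparseGaussianModel P r H YC YT A S)
    (good : (Fin n → Bool) → (Fin n → Bool) → Prop)
    (bad : (Fin n → Bool) → (Fin n → Bool) → Set (Fin n → ℝ)) {ε : ℝ} (hε : 0 ≤ ε)
    (hb : ∀ s a, good s a → (gaussianPi n).real (bad s a) ≤ ε) :
    P.real {ω | good (fun i => S i ω) (fun i => A i ω) ∧
      signedNoise (level r n) H YC YT A ω ∈ bad (fun i => S i ω) (fun i => A i ω)} ≤ ε := by
  let G : Ω → (Fin n → Bool) × (Fin n → Bool) := fun ω => (fun i => S i ω, fun i => A i ω)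
  have hG : Measurable G := h.measurable_split.prodMk h.measurable_assignment
  let J := Finset.univ.filter fun z : (Fin n → Bool) × (Fin n → Bool) => good z.1 z.2
  -- the sets `bad s a` need not be measurable, so they are replaced by measurable hulls
  have hsub : {ω | good (fun i => S i ω) (fun i => A i ω) ∧
      signedNoise (level r n) H YC YT A ω ∈ bad (fun i => S i ω) (fun i => A i ω)} ⊆
      ⋃ z ∈ J, {ω | (fun i => S i ω) = z.1 ∧ (fun i => A i ω) = z.2 ∧
        signedNoise (level r n) H YC YT A ω ∈ toMeasurable (gaussianPi n) (bad z.1 z.2)} := by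
    intro ω hω
    simp only [Set.mem_iUnion]
    exact ⟨G ω, by simpa [J, G] using hω.1, rfl, rfl, subset_toMeasurable _ _ hω.2⟩
  have hfib : ∀ z, G ⁻¹' {z} = {ω | (fun i => S i ω) = z.1 ∧ (fun i => A i ω) = z.2} := by
    intro z
    ext ω
    simp [G, Prod.ext_iff]
  calc _ ≤ _ := measureReal_mono hsub (measure_ne_top _ _)
    _ ≤ ∑ z ∈ J, P.real {ω | (fun i => S i ω) = z.1 ∧ (fun i => A i ω) = z.2 ∧
          signedNoise (level r n) H YC YT A ω ∈ toMeasurable (gaussianPi n) (bad z.1 z.2)} :=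
        measureReal_biUnion_finset_le _ _
    _ ≤ ∑ z ∈ J, P.real (G ⁻¹' {z}) * ε := by
        refine Finset.sum_le_sum fun z hz => ?_
        rw [h.measureReal_fiber_inter _ _ (measurableSet_toMeasurable _ _), hfib]
        refine mul_le_mul_of_nonneg_left ?_ measureReal_nonneg
        rw [measureReal_def, measure_toMeasurable]
        exact hb z.1 z.2 (Finset.mem_filter.1 hz).2
    _ = P.real (G ⁻¹' J) * ε := by
        rw [← Finset.sum_mul, sum_measureReal_preimage_singleton _ fun z _ =>
          hG (measurableSet_singleton z)]
    _ ≤ 1 * ε := by gcongr; exact measureReal_le_one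
    _ = ε := one_mul ε

lemma _root_.ICube.uniformOn_bool_singleton (x : Bool) :
    uniformOn (Set.univ : Set Bool) {x} = 1 / 2 := by
  rw [uniformOn_univ, Measure.count_singleton, Fintype.card_bool]
  norm_num

/-- The assignments are independent fair coin flips. -/
lemma map_assignment (h : SparseGaussianModel P r H YC YT A S) :
    P.map (fun ω i => A i ω) = Measure.pi fun _ => uniformOn (Set.univ : Set Bool) := by
  refine Measure.ext_of_singleton fun a => ?_
  rw [Measure.map_apply h.measurable_assignment (measurableSet_singleton a), Measure.pi_singleton]
  have : (fun ω i => A i ω) ⁻¹' {a} = {ω | ∀ i, A i ω = a i} := by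
    ext ω
    simp [funext_iff]
  rw [this, h.law_A a]
  simp only [uniformOn_bool_singleton, Finset.prod_const, Finset.card_univ, Fintype.card_fin]

lemma measureReal_assignment_eq (h : SparseGaussianModel P r H YC YT A S) (i : Fin n) (x : Bool) :
    P.real {ω | A i ω = x} = 1 / 2 := by
  have h1 : P.map (fun ω => A i ω) = uniformOn (Set.univ : Set Bool) := by
    rw [← (measurePreserving_eval (fun _ : Fin n => uniformOn (Set.univ : Set Bool)) i).map_eq,
      ← h.map_assignment, Measure.map_map (measurable_pi_apply i) h.measurable_assignment]
    rfl
  have h2 := Measure.map_apply (μ := P) (h.measurable_A i) (measurableSet_singleton x)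
  rw [h1] at h2
  have h3 : P.real {ω | A i ω = x} = (P (A i ⁻¹' {x})).toReal := rfl
  rw [h3, ← h2, uniformOn_bool_singleton]
  simp

lemma measureReal_assignment_eq_and_eq (h : SparseGaussianModel P r H YC YT A S) {i j : Fin n}
    (hij : i ≠ j) (x : Bool) : P.real {ω | A i ω = x ∧ A j ω = x} = (1 / 2) ^ 2 := by
  have h0 : iIndepFun (fun i ω => A i ω) P := by
    rw [iIndepFun_iff_map_fun_eq_pi_map fun i => (h.measurable_A i).aemeasurable,
      h.map_assignment]
    congr 1
    funext i
    rw [← (measurePreserving_eval (fun _ : Fin n => uniformOn (Set.univ : Set Bool)) i).map_eq,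
      ← h.map_assignment, Measure.map_map (measurable_pi_apply i) h.measurable_assignment]
    rfl
  have h1 := (h0.indepFun hij).measure_inter_preimage_eq_mul {x} {x} (measurableSet_singleton x)
    (measurableSet_singleton x)
  have h2 := congrArg ENNReal.toReal h1
  rw [ENNReal.toReal_mul] at h2
  rw [pow_two]
  nth_rw 1 [← h.measureReal_assignment_eq i x]
  rw [← h.measureReal_assignment_eq j x]
  exact h2

/-- The size of the part of the split with label `b`. -/
def _root_.ICube.halfSize (n : ℕ) (b : Bool) : ℕ := if b = true then n / 2 else n - n / 2

lemma ae_card_split (h : SparseGaussianModel P r H YC YT A S) :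
    ∀ᵐ ω ∂P, ∀ b, (group (fun i => S i ω) b).card = halfSize n b := by
  have h1 : ∀ᵐ ω ∂P, (group (fun i => S i ω) true).card = n / 2 := by
    have h2 : ∀ s : Fin n → Bool, (group s true).card ≠ n / 2 →
        ∀ᵐ ω ∂P, ¬ (fun i => S i ω) = s := by
      intro s hs
      have := h.law_S s
      simp only [group] at hs
      rw [if_neg hs] at this
      rw [ae_iff, ← this]
      congr 1
      ext ω
      simp [funext_iff]
    have h3 : ∀ᵐ ω ∂P, ∀ s : Fin n → Bool, (group s true).card ≠ n / 2 →
        ¬ (fun i => S i ω) = s :=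
      ae_all_iff.2 fun s => by
        by_cases hs : (group s true).card = n / 2
        · simp [hs]
        · filter_upwards [h2 s hs] with ω hω _ using hω
    filter_upwards [h3] with ω hω
    by_contra hc
    exact hω _ hc rfl
  filter_upwards [h1] with ω hω b
  cases b
  · have h2 := Finset.card_filter_add_card_filter_not (s := (Finset.univ : Finset (Fin n)))
      (fun i => S i ω = true)
    have h3 : group (fun i => S i ω) false = Finset.univ.filter fun i => ¬ S i ω = true := by
      ext i
      simp [group]
    simp only [Finset.card_univ, Fintype.card_fin] at h2
    rw [h3]
    simp only [group] at hω
    simp only [halfSize, Bool.false_eq_true, if_false]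
    omega
  · simpa [halfSize] using hω

/-- The split is exchangeable. -/
lemma map_split_perm (h : SparseGaussianModel P r H YC YT A S) (π : Equiv.Perm (Fin n)) :
    P.map (fun ω i => S (π i) ω) = P.map fun ω i => S i ω := by
  refine Measure.ext_of_singleton fun s => ?_
  rw [Measure.map_apply (measurable_pi_iff.2 fun i => h.measurable_S _) (measurableSet_singleton s),
    Measure.map_apply h.measurable_split (measurableSet_singleton s)]
  have e1 : (fun ω i => S (π i) ω) ⁻¹' {s} = {ω | ∀ i, S i ω = s (π.symm i)} := by
    ext ω
    simp only [Set.mem_preimage, Set.mem_singleton_iff, funext_iff, Set.mem_ofPred_eq]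
    exact ⟨fun hs i => by simpa using hs (π.symm i), fun hs i => by simpa using hs (π i)⟩
  have e2 : (fun ω i => S i ω) ⁻¹' {s} = {ω | ∀ i, S i ω = s i} := by
    ext ω
    simp [funext_iff]
  rw [e1, e2, h.law_S, h.law_S]
  have e3 : (Finset.univ.filter fun i => s (π.symm i) = true).card =
      (Finset.univ.filter fun i => s i = true).card := by
    refine Finset.card_equiv π.symm fun i => ?_
    simp
  rw [e3]

lemma measureReal_split_perm (h : SparseGaussianModel P r H YC YT A S) (π : Equiv.Perm (Fin n))
    (E : Set (Fin n → Bool)) :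
    P.real {ω | (fun i => S (π i) ω) ∈ E} = P.real {ω | (fun i => S i ω) ∈ E} := by
  have hE : MeasurableSet E := (Set.toFinite E).measurableSet
  have h1 : (P.map fun ω i => S (π i) ω).real E = (P.map fun ω i => S i ω).real E := by
    rw [h.map_split_perm π]
  rw [map_measureReal_apply (measurable_pi_iff.2 fun i => h.measurable_S _) hE,
    map_measureReal_apply h.measurable_split hE] at h1
  exact h1

lemma measureReal_split_eq (h : SparseGaussianModel P r H YC YT A S) (i : Fin n) (b : Bool) :
    P.real {ω | S i ω = b} = halfSize n b / n := by
  have hm : ∀ j, MeasurableSet {ω | S j ω = b} := fun j =>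
    h.measurable_S j (measurableSet_singleton b)
  have hex : ∀ j, P.real {ω | S j ω = b} = P.real {ω | S i ω = b} := fun j => by
    have := h.measureReal_split_perm (Equiv.swap i j) {s | s i = b}
    simpa using this
  -- the probabilities are equal by exchangeability, and add up to the size of the part
  have hsum : ∑ j, P.real {ω | S j ω = b} = halfSize n b := by
    have h1 : ∫ ω, ∑ j, ({ω | S j ω = b} : Set Ω).indicator (1 : Ω → ℝ) ω ∂P = halfSize n b := by
      have : ∀ᵐ ω ∂P, ∑ j, ({ω | S j ω = b} : Set Ω).indicator (1 : Ω → ℝ) ω =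
          (halfSize n b : ℝ) := by
        filter_upwards [h.ae_card_split] with ω hω
        rw [← hω b]
        simp [group, Set.indicator_apply, Finset.sum_boole]
      rw [integral_congr_ae this]
      simp
    have hint : ∀ j, Integrable (({ω | S j ω = b} : Set Ω).indicator (1 : Ω → ℝ)) P := fun j =>
      (integrable_const (1 : ℝ)).indicator (hm j)
    rw [integral_finsetSum _ fun j _ => hint j] at h1
    simpa [integral_indicator_one (hm _)] using h1
  have hn : (0 : ℝ) < n := by exact_mod_cast i.pos
  rw [Finset.sum_congr rfl fun j _ => hex j, Finset.sum_const, Finset.card_univ,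
    Fintype.card_fin, nsmul_eq_mul] at hsum
  rw [← hsum]
  field_simp

/-- The labels of two subjects are negatively correlated: both are `b` with probability
`k (k - 1) / (n (n - 1)) ≤ (k / n) ^ 2`, where `k` is the size of the part. -/
lemma measureReal_split_eq_and_eq_le (h : SparseGaussianModel P r H YC YT A S) {i j : Fin n}
    (hij : i ≠ j) (b : Bool) : P.real {ω | S i ω = b ∧ S j ω = b} ≤ (halfSize n b / n : ℝ) ^ 2 := by
  have hm : ∀ i j, MeasurableSet {ω | S i ω = b ∧ S j ω = b} := fun i j =>
    (h.measurable_S i (measurableSet_singleton b)).inter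
      (h.measurable_S j (measurableSet_singleton b))
  -- all pairs of different subjects have the same probability
  have hex : ∀ z ∈ (Finset.univ : Finset (Fin n)).offDiag,
      P.real {ω | S z.1 ω = b ∧ S z.2 ω = b} = P.real {ω | S i ω = b ∧ S j ω = b} := by
    rintro ⟨k, l⟩ hkl
    have hkl : k ≠ l := by simpa using hkl
    obtain ⟨π, hπi, hπj⟩ : ∃ π : Equiv.Perm (Fin n), π i = k ∧ π j = l := by
      refine ⟨(Equiv.swap i k).trans (Equiv.swap (Equiv.swap i k j) l), ?_, ?_⟩
      · have h1 : k ≠ Equiv.swap i k j := fun h => hij (by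
          have := congrArg (Equiv.swap i k) h
          simpa using this)
        simp [Equiv.swap_apply_of_ne_of_ne h1 hkl]
      · simp
    have := h.measureReal_split_perm π {s | s i = b ∧ s j = b}
    simp only [Set.mem_ofPred_eq, hπi, hπj] at this
    exact this
  set k : ℝ := (halfSize n b : ℝ) with hk
  have hn : (2 : ℝ) ≤ n := by
    have h1 := i.isLt
    have h2 := j.isLt
    have h3 : (i : ℕ) ≠ j := fun h => hij (Fin.ext h)
    exact_mod_cast (by omega : 2 ≤ n)
  have hkn : k ≤ n := by
    rw [hk]
    unfold halfSize
    split_ifs <;> exact_mod_cast (by omega)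
  have hk0 : 0 ≤ k := Nat.cast_nonneg _
  have hsum : ∑ z ∈ (Finset.univ : Finset (Fin n)).offDiag,
      P.real {ω | S z.1 ω = b ∧ S z.2 ω = b} = k ^ 2 - k := by
    have h1 : ∫ ω, ∑ z ∈ (Finset.univ : Finset (Fin n)).offDiag,
        ({ω | S z.1 ω = b ∧ S z.2 ω = b} : Set Ω).indicator (1 : Ω → ℝ) ω ∂P = k ^ 2 - k := by
      have : ∀ᵐ ω ∂P, ∑ z ∈ (Finset.univ : Finset (Fin n)).offDiag,
          ({ω | S z.1 ω = b ∧ S z.2 ω = b} : Set Ω).indicator (1 : Ω → ℝ) ω = k ^ 2 - k := by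
        filter_upwards [h.ae_card_split] with ω hω
        have h2 : ((Finset.univ : Finset (Fin n)).offDiag.filter
            fun z => S z.1 ω = b ∧ S z.2 ω = b) = (group (fun i => S i ω) b).offDiag := by
          ext z
          simp [group, Finset.mem_offDiag]
          tauto
        have h3 := Finset.offDiag_card (group (fun i => S i ω) b)
        have h4 : (group (fun i => S i ω) b).card ≤
            (group (fun i => S i ω) b).card * (group (fun i => S i ω) b).card :=
          Nat.le_mul_self _
        simp only [Set.indicator_apply, Set.mem_ofPred_eq, Pi.one_apply, Finset.sum_boole]
        rw [h2, h3, Nat.cast_sub h4, hω b, hk]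
        push_cast
        ring
      rw [integral_congr_ae this]
      simp
    have hint : ∀ z : Fin n × Fin n,
        Integrable (({ω | S z.1 ω = b ∧ S z.2 ω = b} : Set Ω).indicator (1 : Ω → ℝ)) P := fun z =>
      (integrable_const (1 : ℝ)).indicator (hm z.1 z.2)
    rw [integral_finsetSum _ fun z _ => hint z] at h1
    simpa [integral_indicator_one (hm _ _)] using h1
  rw [Finset.sum_congr rfl hex, Finset.sum_const, nsmul_eq_mul, Finset.offDiag_card,
    Finset.card_univ, Fintype.card_fin, Nat.cast_sub (Nat.le_mul_self n)] at hsum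
  push_cast at hsum
  rw [div_pow, le_div_iff₀ (by positivity)]
  have h5 : (n : ℝ) * (n - 1) * P.real {ω | S i ω = b ∧ S j ω = b} = k * (k - 1) := by
    linarith
  have h6 : (n - 1 : ℝ) * (P.real {ω | S i ω = b ∧ S j ω = b} * n ^ 2) ≤ (n - 1) * k ^ 2 := by
    calc _ = n * (k * (k - 1)) := by rw [← h5]; ring
      _ ≤ (n - 1) * k ^ 2 := by nlinarith
  exact le_of_mul_le_mul_left h6 (by linarith)

lemma indepFun_split_assignment (h : SparseGaussianModel P r H YC YT A S) :
    IndepFun (fun ω i => S i ω) (fun ω i => A i ω) P :=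
  h.indep_S.comp (φ := id) (ψ := fun (z : Fin n → Bool × ℝ × ℝ) i => (z i).1)
    measurable_id (by fun_prop)

/-- The number of the subjects in `T` with a given assignment is about `|T| / 2`. -/
lemma measureReal_card_assignment_le (h : SparseGaussianModel P r H YC YT A S)
    {T : Finset (Fin n)} (hT : T.Nonempty) (x : Bool) {δ : ℝ} (hδ : 0 < δ) :
    P.real {ω | δ * (T.card * (1 / 2)) ≤
      |((T ∩ group (fun i => A i ω) x).card : ℝ) - T.card * (1 / 2)|} ≤
      1 / (δ ^ 2 * (T.card * (1 / 2))) := by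
  have := measureReal_abs_card_sub_ge_le (μ := P) (E := fun i => {ω | A i ω = x}) (T := T)
    (fun i _ => h.measurable_A i (measurableSet_singleton x))
    (fun i _ => h.measureReal_assignment_eq i x)
    (fun i _ j _ hij => (h.measureReal_assignment_eq_and_eq hij x).le) hT (by norm_num) hδ
  have e : ∀ ω, T ∩ group (fun i => A i ω) x = T.filter fun i => ω ∈ {ω | A i ω = x} := by
    intro ω
    ext i
    simp [group]
  simp only [e]
  convert this

/-- The number of the treated subjects in `T` in the half with label `b` is about `|T| / 4`. -/
lemma measureReal_card_assignment_split_le (h : SparseGaussianModel P r H YC YT A S)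
    (hn : 2 ≤ n) {T : Finset (Fin n)} (hT : T.Nonempty) (b : Bool) :
    P.real {ω | (16 * (T ∩ group (fun i => A i ω) true ∩ group (fun i => S i ω) b).card : ℝ) ≤
      T.card} ≤ 32 / T.card := by
  have hpos : (1 : ℝ) / 4 ≤ halfSize n b / n := by
    rw [div_le_div_iff₀ (by norm_num) (by positivity)]
    unfold halfSize
    split_ifs <;> exact_mod_cast (by omega)
  have hind : ∀ E F : Set (Fin n → Bool),
      P.real {ω | (fun i => S i ω) ∈ E ∧ (fun i => A i ω) ∈ F} =
        P.real {ω | (fun i => S i ω) ∈ E} * P.real {ω | (fun i => A i ω) ∈ F} := fun E F => by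
    have := h.indepFun_split_assignment.measure_inter_preimage_eq_mul E F
      (Set.toFinite E).measurableSet (Set.toFinite F).measurableSet
    rw [measureReal_def, measureReal_def, measureReal_def, ← ENNReal.toReal_mul]
    exact congrArg ENNReal.toReal this
  have hm : ∀ i, MeasurableSet {ω | S i ω = b ∧ A i ω = true} := fun i =>
    (h.measurable_S i (measurableSet_singleton b)).inter
      (h.measurable_A i (measurableSet_singleton true))
  have key := measureReal_abs_card_sub_ge_le (μ := P) (E := fun i => {ω | S i ω = b ∧ A i ω = true})
    (T := T) (p := halfSize n b / n * (1 / 2)) (δ := 1 / 2) (fun i _ => hm i) ?_ ?_ hT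
    (by linarith) (by norm_num)
  · have hc : (0 : ℝ) < T.card := by exact_mod_cast hT.card_pos
    refine (measureReal_mono ?_ (measure_ne_top _ _)).trans (key.trans ?_)
    · intro ω hω
      have e : T ∩ group (fun i => A i ω) true ∩ group (fun i => S i ω) b =
          T.filter fun i => ω ∈ {ω | S i ω = b ∧ A i ω = true} := by
        ext i
        simp only [group, Finset.mem_inter, Finset.mem_filter, Finset.mem_univ, true_and,
          Set.mem_ofPred_eq]
        tauto
      simp only [Set.mem_ofPred_eq, e] at hω ⊢
      rw [le_abs]
      right
      have : (T.card : ℝ) * (1 / 4) ≤ T.card * (halfSize n b / n) := by gcongr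
      linarith
    · rw [div_le_div_iff₀ (by positivity) hc]
      have : (T.card : ℝ) * (1 / 4) ≤ T.card * (halfSize n b / n) := by gcongr
      linarith
  · intro i _
    have h1 := hind {s | s i = b} {a | a i = true}
    simp only [Set.mem_ofPred_eq] at h1
    rw [h1, h.measureReal_split_eq, h.measureReal_assignment_eq]
  · intro i _ j _ hij
    have h1 := hind {s | s i = b ∧ s j = b} {a | a i = true ∧ a j = true}
    simp only [Set.mem_ofPred_eq] at h1
    have e : {ω | S i ω = b ∧ A i ω = true} ∩ {ω | S j ω = b ∧ A j ω = true} =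
        {ω | (S i ω = b ∧ S j ω = b) ∧ (A i ω = true ∧ A j ω = true)} := by
      ext ω
      simp only [Set.mem_inter_iff, Set.mem_ofPred_eq]
      tauto
    rw [e, h1, h.measureReal_assignment_eq_and_eq hij, mul_pow]
    gcongr
    exact h.measureReal_split_eq_and_eq_le hij b

end SparseGaussianModel

/-! ### The automated I³ as a threshold rule -/

section AutoI3

variable {n : ℕ} {V : Fin n → ℝ} {R₀ : Finset (Fin n)}

lemma excludeSmallest_subset (R : Finset (Fin n)) : excludeSmallest V R ⊆ R :=
  Finset.filter_subset _ _

lemma candidates_succ (t : ℕ) :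
    candidates V R₀ (t + 1) = excludeSmallest V (candidates V R₀ t) :=
  Function.iterate_succ_apply' _ _ _

lemma candidates_anti : Antitone (candidates V R₀) :=
  antitone_nat_of_succ_le fun t => by
    rw [candidates_succ]
    exact excludeSmallest_subset _

/-- The candidate sets are upward closed in `|V|`. -/
lemma mem_candidates_of_abs_lt {i j : Fin n} (hij : |V i| < |V j|) (hj : j ∈ R₀) (t : ℕ)
    (hi : i ∈ candidates V R₀ t) : j ∈ candidates V R₀ t := by
  induction t with
  | zero => exact hj
  | succ t ih =>
    rw [candidates_succ] at hi ⊢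
    have hi' := excludeSmallest_subset _ hi
    exact Finset.mem_filter.2 ⟨ih hi', i, hi', Or.inl hij⟩

lemma excludeSmallest_ne {R : Finset (Fin n)} (hR : R.Nonempty) : excludeSmallest V R ≠ R := by
  intro h
  obtain ⟨i, hi, hmin⟩ := R.exists_min_image (fun i => toLex (|V i|, i)) hR
  have hi' : i ∈ excludeSmallest V R := h.symm ▸ hi
  obtain ⟨j, hj, hlt⟩ := (Finset.mem_filter.1 hi').2
  have := hmin j hj
  rw [Prod.Lex.toLex_le_toLex] at this
  rcases this with h1 | ⟨h1, h2⟩ <;> rcases hlt with h3 | ⟨h3, h4⟩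
  · exact lt_asymm h1 h3
  · exact h1.ne h3.symm
  · exact h3.ne h1.symm
  · exact absurd h2 (not_le.2 h4)

/-- Every set `{|V| ≥ u}` occurs among the candidate sets. -/
lemma exists_candidates_eq (u : ℝ) : ∃ t, candidates V R₀ t = R₀.filter fun i => u ≤ |V i| := by
  -- induction on the number `m` of candidates with `|V| < u`, which are the first to be excluded
  suffices h : ∀ m : ℕ, ∀ R : Finset (Fin n), (R.filter fun i => ¬ u ≤ |V i|).card = m →
      ∃ t, candidates V R t = R.filter fun i => u ≤ |V i| from h _ R₀ rfl
  intro m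
  induction m using Nat.strong_induction_on with
  | _ m ih =>
    intro R hm
    rcases (R.filter fun i => ¬ u ≤ |V i|).eq_empty_or_nonempty with h0 | ⟨k, hk⟩
    · refine ⟨0, ?_⟩
      rw [Finset.filter_eq_empty_iff] at h0
      rw [Finset.filter_true_of_mem fun i hi => not_not.1 (h0 hi)]
      rfl
    · obtain ⟨hkR, hku⟩ := Finset.mem_filter.1 hk
      have hsub : R.filter (fun i => u ≤ |V i|) ⊆ excludeSmallest V R := fun j hj => by
        obtain ⟨hjR, hju⟩ := Finset.mem_filter.1 hj
        exact Finset.mem_filter.2 ⟨hjR, k, hkR, Or.inl ((not_le.1 hku).trans_le hju)⟩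
      have heq : (excludeSmallest V R).filter (fun i => u ≤ |V i|) =
          R.filter fun i => u ≤ |V i| := by
        ext j
        simp only [Finset.mem_filter]
        exact ⟨fun h => ⟨excludeSmallest_subset _ h.1, h.2⟩,
          fun h => ⟨hsub (Finset.mem_filter.2 h), h.2⟩⟩
      obtain ⟨l, hlR, hl⟩ : ∃ l ∈ R, l ∉ excludeSmallest V R := by
        by_contra! hcon
        exact excludeSmallest_ne ⟨k, hkR⟩ ((excludeSmallest_subset R).antisymm hcon)
      have hlu : ¬ u ≤ |V l| := fun h => hl (hsub (Finset.mem_filter.2 ⟨hlR, h⟩))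
      have hlt : ((excludeSmallest V R).filter fun i => ¬ u ≤ |V i|).card < m := by
        rw [← hm]
        refine Finset.card_lt_card ⟨Finset.filter_subset_filter _ (excludeSmallest_subset R),
          fun h => hl ?_⟩
        exact (Finset.mem_filter.1 (h (Finset.mem_filter.2 ⟨hlR, hlu⟩))).1
      obtain ⟨t, ht⟩ := ih _ hlt _ rfl
      exact ⟨t + 1, by rw [← heq, ← ht]; rfl⟩

/-- If the estimated FDR is small at the candidate set `{|V| ≥ u}`, then the automated I³ stops no
later and reports all `V i ≥ u`. -/
lemma mem_autoI3_of_fdrHat_le {γ u : ℝ} (h : fdrHat V (R₀.filter fun i => u ≤ |V i|) ≤ γ)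
    {i : Fin n} (hi : i ∈ R₀) (hu : u ≤ V i) (h0 : 0 < V i) : i ∈ autoI3 γ V R₀ := by
  obtain ⟨t, ht⟩ := exists_candidates_eq (V := V) (R₀ := R₀) u
  have hex : ∃ t, fdrHat V (candidates V R₀ t) ≤ γ := ⟨t, by rwa [ht]⟩
  rw [autoI3, dif_pos hex]
  refine Finset.mem_filter.2 ⟨candidates_anti (Nat.find_min' hex (by rwa [ht])) ?_, h0⟩
  rw [ht]
  exact Finset.mem_filter.2 ⟨hi, hu.trans (le_abs_self _)⟩

/-- The automated I³ stops at a candidate set between `{|V| > u}` and `{|V| ≥ u}`, which has at most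
half as many nonpositive as positive effects. -/
lemma exists_of_mem_autoI3 {γ : ℝ} (hγ : γ ≤ 1 / 2) {i : Fin n} (hi : i ∈ autoI3 γ V R₀) :
    0 < V i ∧ ∃ u ≤ V i, 0 ≤ u ∧
      2 * ((R₀.filter fun j => V j < -u).card : ℝ) < (R₀.filter fun j => u ≤ V j).card := by
  by_cases hex : ∃ t, fdrHat V (candidates V R₀ t) ≤ γ
  swap
  · rw [autoI3, dif_neg hex] at hi
    simp at hi
  rw [autoI3, dif_pos hex] at hi
  have hfdr := Nat.find_spec hex
  obtain ⟨t, ht⟩ : ∃ t, t = Nat.find hex := ⟨_, rfl⟩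
  rw [← ht] at hi hfdr
  obtain ⟨hiC, hi0⟩ := Finset.mem_filter.1 hi
  -- At the stopping time, `u` is the smallest `|V|` among the candidates. Subjects with the same
  -- `|V|` may have been excluded already, so that only `|V| > u` guarantees candidacy.
  obtain ⟨k, hk, hmin⟩ := (candidates V R₀ t).exists_min_image (fun j => |V j|) ⟨i, hiC⟩
  refine ⟨hi0, |V k|, (hmin i hiC).trans (abs_of_pos hi0).le, abs_nonneg _, ?_⟩
  have hsub0 : candidates V R₀ t ⊆ R₀ := candidates_anti (Nat.zero_le t)
  have hpos : (positives V (candidates V R₀ t)).card ≤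
      (R₀.filter fun j => |V k| ≤ V j).card := by
    refine Finset.card_le_card fun j hj => ?_
    obtain ⟨hjC, hj0⟩ := Finset.mem_filter.1 hj
    exact Finset.mem_filter.2 ⟨hsub0 hjC, (hmin j hjC).trans (abs_of_pos hj0).le⟩
  have hneg : (R₀.filter fun j => V j < -|V k|).card ≤
      (nonpositives V (candidates V R₀ t)).card := by
    refine Finset.card_le_card fun j hj => ?_
    obtain ⟨hjR, hj0⟩ := Finset.mem_filter.1 hj
    have h1 : V j < 0 := hj0.trans_le (by simp)
    refine Finset.mem_filter.2 ⟨mem_candidates_of_abs_lt (i := k) ?_ hjR t hk, h1.le⟩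
    rw [abs_of_neg h1]
    linarith
  have hpos1 : 1 ≤ (positives V (candidates V R₀ t)).card := Finset.card_pos.2 ⟨i, hi⟩
  rw [fdrHat, max_eq_left hpos1, div_le_iff₀ (by exact_mod_cast hpos1)] at hfdr
  have h2 : ((positives V (candidates V R₀ t)).card : ℝ) ≤
      (R₀.filter fun j => |V k| ≤ V j).card := by exact_mod_cast hpos
  have h3 : ((R₀.filter fun j => V j < -|V k|).card : ℝ) ≤
      (nonpositives V (candidates V R₀ t)).card := by exact_mod_cast hneg
  have h4 : γ * ((positives V (candidates V R₀ t)).card : ℝ) ≤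
      1 / 2 * (positives V (candidates V R₀ t)).card := by gcongr
  linarith

/-- As long as the tails of the noise of the null subjects are regular and the null subjects
outnumber the non-null ones, the automated I³ goes on: it reports no subject below the level at
which the non-null subjects start to matter. -/
lemma le_of_mem_autoI3 {γ e L hi : ℝ} (hγ : γ ≤ 1 / 2) {H T : Finset (Fin n)}
    {w : Fin n → ℝ} (hT : T = R₀ \ H) (he : 0 < e) (he1 : e ≤ 1)
    (hV : ∀ i ∈ T, |V i / 2 - w i| ≤ e) (hL : L + 2 * e ≤ hi)
    (hreg : TailRegular T (1 / 10) (-1) hi w)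
    (hreg' : TailRegular T (1 / 10) (-1) hi fun i => -w i)
    (hratio : ∀ u ≤ hi, gaussianTail (u - 3 * e) ≤ (1 + 1 / 10) * gaussianTail u)
    (hH : (H.card : ℝ) ≤ 1 / 10 * (T.card * gaussianTail hi)) {i : Fin n}
    (hmem : i ∈ autoI3 γ V R₀) : 0 < V i ∧ 2 * L ≤ V i := by
  obtain ⟨h0, u', hu', hu0, hlt⟩ := exists_of_mem_autoI3 hγ hmem
  refine ⟨h0, ?_⟩
  by_contra! hcon
  obtain ⟨u, rfl⟩ : ∃ u, u' = 2 * u := ⟨u' / 2, by ring⟩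
  -- By the symmetry of the noise, about as many effects are below `-2 u` as are above `2 u`,
  -- apart from the non-nulls; the stopping rule asks for less than half as many.
  have h1 : (R₀.filter fun j => 2 * u ≤ V j).card ≤
      (T.filter fun j => u - e ≤ w j).card + H.card := by
    refine (Finset.card_le_card fun j hj => ?_).trans (Finset.card_union_le _ _)
    obtain ⟨hjR, hj⟩ := Finset.mem_filter.1 hj
    by_cases hjH : j ∈ H
    · exact Finset.mem_union_right _ hjH
    · have hjT : j ∈ T := hT ▸ Finset.mem_sdiff.2 ⟨hjR, hjH⟩
      have := abs_le.1 (hV j hjT)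
      exact Finset.mem_union_left _ (Finset.mem_filter.2 ⟨hjT, by linarith⟩)
  have h2 : (T.filter fun j => u + 2 * e ≤ -w j).card ≤
      (R₀.filter fun j => V j < -(2 * u)).card := by
    refine Finset.card_le_card fun j hj => ?_
    obtain ⟨hjT, hj⟩ := Finset.mem_filter.1 hj
    have := abs_le.1 (hV j hjT)
    have hjR : j ∈ R₀ := by
      rw [hT] at hjT
      exact (Finset.mem_sdiff.1 hjT).1
    exact Finset.mem_filter.2 ⟨hjR, by linarith⟩
  have h1' : ((R₀.filter fun j => 2 * u ≤ V j).card : ℝ) ≤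
      (T.filter fun j => u - e ≤ w j).card + H.card := by exact_mod_cast h1
  have h2' : ((T.filter fun j => u + 2 * e ≤ -w j).card : ℝ) ≤
      (R₀.filter fun j => V j < -(2 * u)).card := by exact_mod_cast h2
  have h3 := (hreg (u - e) (by linarith) (by linarith)).2
  have h4 := (hreg' (u + 2 * e) (by linarith) (by linarith)).1
  have h5 := hratio (u + 2 * e) (by linarith)
  rw [show u + 2 * e - 3 * e = u - e by ring] at h5
  have h6 : gaussianTail hi ≤ gaussianTail (u + 2 * e) := gaussianTail_anti (by linarith)
  have hTc : (0 : ℝ) ≤ T.card := Nat.cast_nonneg _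
  have h7 := mul_le_mul_of_nonneg_left h5 hTc
  have h8 := mul_le_mul_of_nonneg_left h6 hTc
  have h9 : 0 ≤ T.card * gaussianTail (u + 2 * e) := mul_nonneg hTc (gaussianTail_nonneg _)
  linarith

end AutoI3

/-! ### The Benjamini-Hochberg procedure as a threshold rule -/

section BenjaminiHochberg

variable {n : ℕ} {v : Fin n → ℝ} {α L : ℝ}

/-- The Benjamini-Hochberg procedure rejects nobody below `L` if for no `u ≤ L` the number of the
statistics above `u` reaches `1 / α` times its expectation `n gaussianTail u` under the null. -/
lemma le_of_mem_benjaminiHochberg (hα : 0 ≤ α)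
    (h : ∀ u ≤ L, α * ((Finset.univ.filter fun j => u ≤ v j).card : ℝ) < n * gaussianTail u)
    {i : Fin n} (hi : i ∈ benjaminiHochberg α fun j => gaussianTail (v j)) : L ≤ v i := by
  by_contra! hcon
  have hn : (0 : ℝ) < n := by exact_mod_cast i.pos
  unfold benjaminiHochberg at hi
  obtain ⟨k, hk⟩ : ∃ k, k = Nat.findGreatest (fun k : ℕ => k ≤ (Finset.univ.filter
    fun j => gaussianTail (v j) ≤ k * α / n).card) n := ⟨_, rfl⟩
  rw [← hk] at hi
  have hkR : k ≤ (Finset.univ.filter fun j => gaussianTail (v j) ≤ k * α / n).card := by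
    have := Nat.findGreatest_spec (P := fun k : ℕ => k ≤ (Finset.univ.filter
      fun j => gaussianTail (v j) ≤ k * α / n).card) (Nat.zero_le n) (Nat.zero_le _)
    rw [← hk] at this
    exact this
  -- the smallest rejected statistic `v m` violates the hypothesis
  obtain ⟨m, hm, hmin⟩ := (Finset.univ.filter fun j => gaussianTail (v j) ≤ k * α / n)
    |>.exists_min_image v ⟨i, hi⟩
  have h1 := h (v m) ((hmin i hi).trans hcon.le)
  have h2 : (k : ℝ) ≤ (Finset.univ.filter fun j => v m ≤ v j).card := by
    refine Nat.cast_le.2 (hkR.trans (Finset.card_le_card fun j hj => ?_))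
    exact Finset.mem_filter.2 ⟨Finset.mem_univ _, hmin j hj⟩
  have h3 := (Finset.mem_filter.1 hm).2
  rw [le_div_iff₀ hn] at h3
  have h4 := mul_le_mul_of_nonneg_left h2 hα
  linarith

/-- The Benjamini-Hochberg procedure rejects everybody above `L` if there are so many of them that
their `p`-values pass the corresponding test. -/
lemma mem_benjaminiHochberg {k : ℕ} (hk : k ≤ (Finset.univ.filter fun j => L ≤ v j).card)
    (hL : gaussianTail L ≤ k * α / n) (hα : 0 ≤ α) {i : Fin n} (hi : L ≤ v i) :
    i ∈ benjaminiHochberg α fun j => gaussianTail (v j) := by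
  refine Finset.mem_filter.2 ⟨Finset.mem_univ _, ?_⟩
  have h1 : k ≤ Nat.findGreatest (fun k : ℕ => k ≤ (Finset.univ.filter
      fun j => gaussianTail (v j) ≤ k * α / n).card) n := by
    refine Nat.le_findGreatest ?_ ?_
    · exact hk.trans ((Finset.card_filter_le _ _).trans (by simp))
    · refine hk.trans (Finset.card_le_card fun j hj => ?_)
      exact Finset.mem_filter.2 ⟨Finset.mem_univ _,
        (gaussianTail_anti (Finset.mem_filter.1 hj).2).trans hL⟩
  calc gaussianTail (v i) ≤ gaussianTail L := gaussianTail_anti hi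
    _ ≤ k * α / n := hL
    _ ≤ _ := by gcongr

end BenjaminiHochberg

/-! ### The estimated effects in terms of the signed noise -/

section Effects

variable {n : ℕ}

/-- The observed outcomes in terms of the signed noise `w`. -/
def outcome (μ : ℝ) (H : Finset (Fin n)) (a : Fin n → Bool) (w : Fin n → ℝ) (i : Fin n) : ℝ :=
  if a i = true then w i + (if i ∈ H then μ else 0) else -w i

/-- The signed noise plus the signal, which is present for the treated non-null subjects. -/
def score (μ : ℝ) (H : Finset (Fin n)) (a : Fin n → Bool) (w : Fin n → ℝ) (i : Fin n) : ℝ :=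
  w i + if i ∈ H ∧ a i = true then μ else 0

lemma observed_eq_outcome {Ω : Type*} (μ : ℝ) (H : Finset (Fin n)) (YC YT : Fin n → Ω → ℝ)
    (A : Fin n → Ω → Bool) (ω : Ω) :
    observed YC YT A ω = outcome μ H (fun i => A i ω) (signedNoise μ H YC YT A ω) := by
  funext i
  by_cases h : A i ω = true <;> simp [observed, outcome, signedNoise, h]

variable {μ : ℝ} {H : Finset (Fin n)} {s a : Fin n → Bool} {w : Fin n → ℝ}

lemma score_of_notMem {i : Fin n} (hi : i ∉ H) : score μ H a w i = w i := by
  simp [score, hi]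

lemma score_of_treated {i : Fin n} (hi : i ∈ H) (ha : a i = true) :
    score μ H a w i = w i + μ := by
  simp [score, hi, ha]

lemma score_of_untreated {i : Fin n} (ha : ¬ a i = true) : score μ H a w i = w i := by
  simp [score, ha]

lemma score_le (hμ : 0 ≤ μ) (i : Fin n) : score μ H a w i ≤ w i + μ := by
  unfold score
  split_ifs <;> linarith

lemma abs_crossfitEffect_sub_score (i : Fin n) :
    |crossfitEffect s a (outcome μ H a w) i / 2 - score μ H a w i| =
      |average (outcome μ H a w) (group s (!s i))| := by
  unfold crossfitEffect
  generalize average (outcome μ H a w) (group s (!s i)) = m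
  by_cases h : a i = true
  · rw [← abs_neg m]
    congr 1
    simp only [outcome, score, h, if_true, and_true]
    ring
  · congr 1
    simp only [outcome, score, if_neg h, if_neg (fun hc : i ∈ H ∧ a i = true => h hc.2)]
    ring

lemma abs_linearEffect_sub_score (i : Fin n) :
    |linearEffect a (outcome μ H a w) i - score μ H a w i| =
      |average (outcome μ H a w) (group a (!a i))| := by
  unfold linearEffect
  by_cases h : a i = true
  · rw [if_pos h, h, Bool.not_true]
    generalize average (outcome μ H a w) (group a false) = m
    rw [← abs_neg m]
    congr 1
    simp only [outcome, score, h, if_true, and_true]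
    ring
  · have h' : a i = false := by simpa using h
    rw [if_neg h, h', Bool.not_false]
    generalize average (outcome μ H a w) (group a true) = m
    congr 1
    simp only [outcome, score, if_neg h, if_neg (fun hc : i ∈ H ∧ a i = true => h hc.2)]
    ring

/-- The empirical first and second moments of the noise in the group `G` are within `ρ` of those of
the standard Gaussian distribution. The first moment is taken with the original signs. -/
def MomentRegular (a : Fin n → Bool) (G : Finset (Fin n)) (ρ : ℝ) (w : Fin n → ℝ) : Prop :=
  |∑ i ∈ G, (if a i = true then w i else -w i)| ≤ ρ * G.card ∧
    |∑ i ∈ G, (w i ^ 2 - 1)| ≤ ρ * G.card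

lemma outcome_eq (i : Fin n) : outcome μ H a w i =
    (if a i = true then w i else -w i) + (if i ∈ H ∧ a i = true then μ else 0) := by
  by_cases h : a i = true <;> simp [outcome, h]

lemma sum_signal_le {c : ℝ} (hc : 0 ≤ c) (G : Finset (Fin n)) :
    ∑ i ∈ G, (if i ∈ H ∧ a i = true then c else 0) ≤ c * H.card := by
  rw [← Finset.sum_filter, Finset.sum_const, nsmul_eq_mul, mul_comm]
  refine mul_le_mul_of_nonneg_left (Nat.cast_le.2 (Finset.card_le_card fun i hi => ?_)) hc
  exact (Finset.mem_filter.1 hi).2.1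

lemma abs_average_outcome_le {G : Finset (Fin n)} {ρ : ℝ} (hμ : 0 ≤ μ)
    (hG : MomentRegular a G ρ w) (hH : μ * H.card ≤ ρ * G.card) (hG0 : 0 < G.card) :
    |average (outcome μ H a w) G| ≤ 2 * ρ := by
  have hc : (0 : ℝ) < G.card := by exact_mod_cast hG0
  have h1 := sum_signal_le (H := H) (a := a) hμ G
  have h2 : 0 ≤ ∑ i ∈ G, (if i ∈ H ∧ a i = true then μ else 0) :=
    Finset.sum_nonneg fun i _ => by split_ifs <;> linarith
  rw [average, abs_div, Nat.abs_cast, div_le_iff₀ hc]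
  simp only [outcome_eq, Finset.sum_add_distrib]
  refine (abs_add_le _ _).trans ?_
  rw [abs_of_nonneg h2]
  linarith [hG.1]

/-- The arithmetic of the sample variance of `m` outcomes: `Y` and `W` are the sums of the squares of
the outcomes and of the noise, `Z` bounds the contribution of the signals, and `q` is `m` times the
squared average of the outcomes. -/
lemma abs_sampleVariance_sub_one_le {m ρ W Y Z q : ℝ} (hρ : 0 < ρ) (hρ1 : ρ ≤ 1 / 10)
    (hm : 2 ≤ ρ * (m - 1)) (hW1 : (1 - ρ) * m ≤ W) (hW2 : W ≤ (1 + ρ) * m) (hZ : Z ≤ ρ * m)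
    (hq0 : 0 ≤ q) (hq : q ≤ m * (4 * ρ ^ 2)) (hY1 : (1 - ρ) * W - Z ≤ Y)
    (hY2 : Y ≤ (1 + ρ) * W + Z) : |(Y - q) / (m - 1) - 1| ≤ 6 * ρ := by
  have hden : 0 < m - 1 := by
    by_contra! hcon
    nlinarith
  have hm0 : 0 < m := by linarith
  have hρm : ρ * (ρ * m) ≤ 1 / 10 * (ρ * m) := by gcongr
  have hρm0 : 0 < ρ * m := by positivity
  have hA : (1 + ρ) * W ≤ (1 + ρ) * ((1 + ρ) * m) := by gcongr
  have hB : (1 - ρ) * ((1 - ρ) * m) ≤ (1 - ρ) * W :=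
    mul_le_mul_of_nonneg_left hW1 (by linarith)
  have hup : Y - q ≤ m + 3.1 * (ρ * m) := by linarith
  have hlo : m - 3.4 * (ρ * m) ≤ Y - q := by linarith
  have h1 : 1 - 6 * ρ ≤ (Y - q) / (m - 1) := by
    rw [le_div_iff₀ hden]
    linarith
  have h2 : (Y - q) / (m - 1) ≤ 1 + 6 * ρ := by
    rw [div_le_iff₀ hden]
    linarith
  rw [abs_le]
  constructor <;> linarith

/-- A square of a sum is close to the square of its first term, if the second one is small. -/
lemma sq_add_bounds {ρ : ℝ} (hρ : 0 < ρ) (z c : ℝ) :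
    (1 - ρ) * z ^ 2 - (1 + 1 / ρ) * c ^ 2 ≤ (z + c) ^ 2 ∧
      (z + c) ^ 2 ≤ (1 + ρ) * z ^ 2 + (1 + 1 / ρ) * c ^ 2 := by
  have h1 : 0 ≤ (ρ * z + c) ^ 2 / ρ := by positivity
  have h2 : 0 ≤ (ρ * z - c) ^ 2 / ρ := by positivity
  have e1 : (ρ * z + c) ^ 2 / ρ = ρ * z ^ 2 + 1 / ρ * c ^ 2 + 2 * z * c := by
    field_simp
    ring
  have e2 : (ρ * z - c) ^ 2 / ρ = ρ * z ^ 2 + 1 / ρ * c ^ 2 - 2 * z * c := by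
    field_simp
    ring
  have h3 := sq_nonneg c
  constructor <;> linarith

lemma sum_sq_sub_average (G : Finset (Fin n)) (y : Fin n → ℝ) :
    ∑ i ∈ G, (y i - average y G) ^ 2 = ∑ i ∈ G, y i ^ 2 - G.card * average y G ^ 2 := by
  have hsum : ∑ i ∈ G, y i = G.card * average y G := by
    rcases G.eq_empty_or_nonempty with rfl | hG
    · simp
    · have : (G.card : ℝ) ≠ 0 := by exact_mod_cast hG.card_ne_zero
      rw [average]
      field_simp
  have : ∀ i ∈ G, (y i - average y G) ^ 2 =
      y i ^ 2 - 2 * average y G * y i + average y G ^ 2 := fun i _ => by ring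
  rw [Finset.sum_congr rfl this, Finset.sum_add_distrib, Finset.sum_sub_distrib,
    ← Finset.mul_sum, hsum, Finset.sum_const, nsmul_eq_mul]
  ring

/-- The sample variance of an arm is close to one: the signals contribute little to it, as the
non-null subjects are rare. -/
lemma abs_armVariance_sub_one_le {b : Bool} {ρ : ℝ} (hμ : 0 ≤ μ) (hρ : 0 < ρ) (hρ1 : ρ ≤ 1 / 10)
    (hG : MomentRegular a (group a b) ρ w) (hH : μ * H.card ≤ ρ * (group a b).card)
    (hH2 : (1 + 1 / ρ) * μ ^ 2 * H.card ≤ ρ * (group a b).card)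
    (hG0 : 2 ≤ ρ * ((group a b).card - 1 : ℝ)) :
    |armVariance a (outcome μ H a w) b - 1| ≤ 6 * ρ := by
  rw [armVariance, sum_sq_sub_average]
  generalize group a b = G at *
  have hc0 : 0 < G.card := by
    by_contra! hcon
    have : (G.card : ℝ) = 0 := by exact_mod_cast Nat.le_zero.1 hcon
    rw [this] at hG0
    linarith
  have havg := abs_average_outcome_le hμ hG hH hc0
  have hybar : average (outcome μ H a w) G ^ 2 ≤ 4 * ρ ^ 2 := by
    have := sq_le_sq' (abs_le.1 havg).1 (abs_le.1 havg).2
    linarith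
  have hw : ∑ i ∈ G, (w i ^ 2 - 1) = ∑ i ∈ G, w i ^ 2 - G.card := by
    simp [Finset.sum_sub_distrib]
  have hw2 := abs_le.1 (hw ▸ hG.2)
  have hpt : ∀ i, (1 - ρ) * w i ^ 2 - (1 + 1 / ρ) * (if i ∈ H ∧ a i = true then μ ^ 2 else 0) ≤
      outcome μ H a w i ^ 2 ∧ outcome μ H a w i ^ 2 ≤
      (1 + ρ) * w i ^ 2 + (1 + 1 / ρ) * (if i ∈ H ∧ a i = true then μ ^ 2 else 0) := by
    intro i
    have h1 : (if a i = true then w i else -w i) ^ 2 = w i ^ 2 := by split_ifs <;> ring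
    have h2 : (if i ∈ H ∧ a i = true then μ else 0) ^ 2 =
        if i ∈ H ∧ a i = true then μ ^ 2 else 0 := by split_ifs <;> ring
    rw [outcome_eq, ← h1, ← h2]
    exact sq_add_bounds hρ _ _
  refine abs_sampleVariance_sub_one_le hρ hρ1 hG0 (W := ∑ i ∈ G, w i ^ 2)
    (Z := (1 + 1 / ρ) * ∑ i ∈ G, (if i ∈ H ∧ a i = true then μ ^ 2 else 0))
    (by linarith) (by linarith) ?_ (by positivity) (by gcongr) ?_ ?_
  · refine le_trans ?_ hH2
    rw [mul_assoc]
    gcongr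
    exact sum_signal_le (sq_nonneg μ) G
  · rw [Finset.mul_sum, Finset.mul_sum, ← Finset.sum_sub_distrib]
    exact Finset.sum_le_sum fun i _ => (hpt i).1
  · rw [Finset.mul_sum, Finset.mul_sum, ← Finset.sum_add_distrib]
    exact Finset.sum_le_sum fun i _ => (hpt i).2

lemma abs_linearEffectVariance_sub_one_le {ρ : ℝ} (hμ : 0 ≤ μ) (hρ : 0 < ρ) (hρ1 : ρ ≤ 1 / 10)
    (hG : ∀ b, MomentRegular a (group a b) ρ w) (hH : ∀ b, μ * H.card ≤ ρ * (group a b).card)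
    (hH2 : ∀ b, (1 + 1 / ρ) * μ ^ 2 * H.card ≤ ρ * (group a b).card)
    (hG0 : ∀ b, 2 ≤ ρ * ((group a b).card - 1 : ℝ)) (i : Fin n) :
    |linearEffectVariance a (outcome μ H a w) i - 1| ≤ 8 * ρ := by
  have h1 := abs_le.1 (abs_armVariance_sub_one_le hμ hρ hρ1 (hG (a i)) (hH _) (hH2 _) (hG0 _))
  have h2 := abs_le.1 (abs_armVariance_sub_one_le hμ hρ hρ1 (hG (!a i)) (hH _) (hH2 _) (hG0 _))
  have h3 := hG0 (!a i)
  have hm : (0 : ℝ) < (group a (!a i)).card := by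
    by_contra! hcon
    nlinarith
  have h4 : armVariance a (outcome μ H a w) (!a i) / (group a (!a i)).card ≤ 2 * ρ := by
    rw [div_le_iff₀ hm]
    nlinarith
  have h5 : 0 ≤ armVariance a (outcome μ H a w) (!a i) / (group a (!a i)).card :=
    div_nonneg (by linarith) hm.le
  rw [linearEffectVariance, abs_le]
  constructor <;> linarith

lemma abs_sqrt_sub_one_le {x : ℝ} (hx : 0 ≤ x) : |√x - 1| ≤ |x - 1| := by
  have h1 : x - 1 = (√x - 1) * (√x + 1) := by
    have := Real.mul_self_sqrt hx
    linarith
  rw [h1, abs_mul]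
  refine le_mul_of_one_le_right (abs_nonneg _) ?_
  rw [abs_of_nonneg (by positivity)]
  linarith [Real.sqrt_nonneg x]

/-- Studentizing a statistic that is close to the score by an estimated standard deviation that is
close to one moves moderate thresholds only slightly. -/
lemma studentized_threshold {V X sd u ρ M e : ℝ} (hV : |V - X| ≤ 2 * ρ) (hsd : |sd - 1| ≤ 8 * ρ)
    (hρ : 0 ≤ ρ) (hρ1 : ρ ≤ 1 / 10) (hu : |u| ≤ M) (he : 2 * ρ + 8 * ρ * M ≤ e) :
    (u ≤ V / sd → u - e ≤ X) ∧ (u + e ≤ X → u ≤ V / sd) := by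
  have h1 := abs_le.1 hV
  have hsd0 : 0 < sd := by linarith [(abs_le.1 hsd).1]
  have h2 : |u * (sd - 1)| ≤ 8 * ρ * M := by
    rw [abs_mul, mul_comm]
    gcongr
  have h3 := abs_le.1 h2
  constructor
  · intro h
    rw [le_div_iff₀ hsd0] at h
    linarith
  · intro h
    rw [le_div_iff₀ hsd0]
    linarith

end Effects

/-! ### Events of high probability -/

section HighProb

variable {Ω : ℕ → Type*} [∀ n, MeasurableSpace (Ω n)] {P : ∀ n, Measure (Ω n)}
  [∀ n, IsProbabilityMeasure (P n)]

/-- The events `E n` have probabilities that tend to one. They need not be measurable: the condition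
is that the outer measures of their complements tend to zero. -/
def WithHighProb (P : ∀ n, Measure (Ω n)) (E : ∀ n, Ω n → Prop) : Prop :=
  Tendsto (fun n => (P n).real {ω | ¬ E n ω}) atTop (𝓝 0)

lemma withHighProb_of_le {E : ∀ n, Ω n → Prop}
    (h : ∀ ε : ℝ, 0 < ε → ∀ᶠ n in atTop, (P n).real {ω | ¬ E n ω} ≤ ε) : WithHighProb P E := by
  refine tendsto_order.2 ⟨fun x hx => Eventually.of_forall fun n => hx.trans_le measureReal_nonneg,
    fun x hx => ?_⟩
  filter_upwards [h (x / 2) (by positivity)] with n hn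
  linarith

lemma WithHighProb.eventually_le {E : ∀ n, Ω n → Prop} (h : WithHighProb P E) {ε : ℝ}
    (hε : 0 < ε) : ∀ᶠ n in atTop, (P n).real {ω | ¬ E n ω} ≤ ε :=
  h.eventually_le_const hε

lemma WithHighProb.mono {E F : ∀ n, Ω n → Prop} (h : WithHighProb P E)
    (hEF : ∀ᶠ n in atTop, ∀ ω, E n ω → F n ω) : WithHighProb P F := by
  refine withHighProb_of_le fun ε hε => ?_
  filter_upwards [h.eventually_le hε, hEF] with n hn hEFn
  refine (measureReal_mono ?_ (measure_ne_top _ _)).trans hn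
  exact fun ω hω hE => hω (hEFn ω hE)

lemma WithHighProb.and {E F : ∀ n, Ω n → Prop} (hE : WithHighProb P E) (hF : WithHighProb P F) :
    WithHighProb P fun n ω => E n ω ∧ F n ω := by
  refine withHighProb_of_le fun ε hε => ?_
  filter_upwards [hE.eventually_le (half_pos hε), hF.eventually_le (half_pos hε)] with n h1 h2
  have hsub : {ω | ¬ (E n ω ∧ F n ω)} ⊆ {ω | ¬ E n ω} ∪ {ω | ¬ F n ω} := by
    intro ω hω
    by_cases h : E n ω
    · exact Or.inr fun hf => hω ⟨h, hf⟩
    · exact Or.inl h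
  have := (measureReal_mono hsub (measure_ne_top _ _)).trans (measureReal_union_le (μ := P n) _ _)
  linarith

lemma withHighProb_of_forall {E : ∀ n, Ω n → Prop} (h : ∀ n ω, E n ω) : WithHighProb P E :=
  withHighProb_of_le fun ε hε => Eventually.of_forall fun n => by
    have h0 : {ω | ¬ E n ω} = ∅ := Set.eq_empty_of_forall_notMem fun ω hω => hω (h n ω)
    rw [h0, measureReal_empty]
    exact hε.le

lemma withHighProb_forall_bool {E : ∀ n, Bool → Ω n → Prop}
    (h : ∀ b, WithHighProb P fun n ω => E n b ω) : WithHighProb P fun n ω => ∀ b, E n b ω :=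
  ((h true).and (h false)).mono (Eventually.of_forall fun _ _ hω b => by
    cases b
    · exact hω.2
    · exact hω.1)

end HighProb

/-! ### The asymptotic setting -/

section Setting

variable {Ω : ℕ → Type*} [∀ n, MeasurableSpace (Ω n)]

/-- The properties of the sparse Gaussian model in terms of the split `s`, the assignment `a` and
the signed noise `w` on which the asymptotic analysis rests. -/
structure SparseNoise (P : ∀ n, Measure (Ω n)) (β : ℝ) (H : ∀ n, Finset (Fin n))
    (s a : ∀ n, Ω n → Fin n → Bool) (w : ∀ n, Ω n → Fin n → ℝ) : Prop where
  /-- there are about `n ^ (1 - β)` non-null subjects -/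
  card_nonnull : Tendsto (fun n : ℕ => ((H n).card : ℝ) / (n : ℝ) ^ (1 - β)) atTop (𝓝 1)
  /-- bounds for Gaussian noise that hold for all good splits and assignments carry over -/
  noise : ∀ n (good : (Fin n → Bool) → (Fin n → Bool) → Prop)
    (bad : (Fin n → Bool) → (Fin n → Bool) → Set (Fin n → ℝ)) (ε : ℝ), 0 ≤ ε →
    (∀ s a, good s a → (gaussianPi n).real (bad s a) ≤ ε) →
    (P n).real {ω | good (s n ω) (a n ω) ∧ w n ω ∈ bad (s n ω) (a n ω)} ≤ ε
  card_split : WithHighProb P fun n ω => ∀ b, (n : ℝ) ≤ 4 * (group (s n ω) b).card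
  card_arm : WithHighProb P fun n ω => ∀ b, (n : ℝ) ≤ 4 * (group (a n ω) b).card
  card_treated : ∀ δ : ℝ, 0 < δ → WithHighProb P fun n ω =>
    |((H n ∩ group (a n ω) true).card : ℝ) - (H n).card / 2| ≤ δ * (H n).card
  card_treated_split : WithHighProb P fun n ω => ∀ b, ((H n).card : ℝ) ≤
    16 * (H n ∩ group (a n ω) true ∩ group (s n ω) b).card

lemma eventually_card_bounds {β : ℝ} {H : ∀ n, Finset (Fin n)}
    (h : Tendsto (fun n : ℕ => ((H n).card : ℝ) / (n : ℝ) ^ (1 - β)) atTop (𝓝 1)) :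
    ∀ᶠ n : ℕ in atTop, (n : ℝ) ^ (1 - β) / 2 ≤ (H n).card ∧
      ((H n).card : ℝ) ≤ 2 * (n : ℝ) ^ (1 - β) := by
  filter_upwards [h.eventually_le_const (show (1 : ℝ) < 2 by norm_num),
    h.eventually_const_le (show (1 / 2 : ℝ) < 1 by norm_num), eventually_gt_atTop 0] with n h1 h2 hn
  have : (0 : ℝ) < (n : ℝ) ^ (1 - β) := Real.rpow_pos_of_pos (by exact_mod_cast hn) _
  rw [div_le_iff₀ this] at h1
  rw [le_div_iff₀ this] at h2
  constructor <;> linarith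

lemma tendsto_card_atTop {β : ℝ} (hβ : β < 1) {H : ∀ n, Finset (Fin n)}
    (h : Tendsto (fun n : ℕ => ((H n).card : ℝ) / (n : ℝ) ^ (1 - β)) atTop (𝓝 1)) :
    Tendsto (fun n => ((H n).card : ℝ)) atTop atTop := by
  have h1 : Tendsto (fun n : ℕ => (n : ℝ) ^ (1 - β) / 2) atTop atTop :=
    ((tendsto_rpow_atTop (sub_pos.2 hβ)).comp tendsto_natCast_atTop_atTop).atTop_div_const
      (by norm_num)
  refine tendsto_atTop_mono' _ ?_ h1
  filter_upwards [eventually_card_bounds h] with n hn using hn.1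

/-- The non-null subjects are rare, even up to logarithmic factors. -/
lemma eventually_log_pow_mul_card_le {β : ℝ} (hβ : 0 < β) {H : ∀ n, Finset (Fin n)}
    (h : Tendsto (fun n : ℕ => ((H n).card : ℝ) / (n : ℝ) ^ (1 - β)) atTop (𝓝 1))
    (k : ℕ) {c : ℝ} (hc : 0 < c) :
    ∀ᶠ n : ℕ in atTop, Real.log n ^ k * (H n).card ≤ c * n := by
  have h1 := (tendsto_log_pow_mul_rpow_neg k hβ).eventually_le_const (half_pos hc)
  filter_upwards [h1, eventually_card_bounds h, eventually_gt_atTop 0] with n hn hb hn0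
  have hn0' : (0 : ℝ) < n := by exact_mod_cast hn0
  have hlog := Real.log_natCast_nonneg n
  have e : (n : ℝ) ^ (1 - β) = n * (n : ℝ) ^ (-β) := by
    rw [sub_eq_add_neg, Real.rpow_add hn0', Real.rpow_one]
  calc Real.log n ^ k * (H n).card ≤ Real.log n ^ k * (2 * (n * (n : ℝ) ^ (-β))) := by
        rw [← e]
        gcongr
        exact hb.2
    _ = (Real.log n ^ k * (n : ℝ) ^ (-β)) * (2 * n) := by ring
    _ ≤ c / 2 * (2 * n) := by gcongr
    _ = c * n := by ring

/-- Below the level `√(2 β log n)`, the null subjects outnumber the non-null ones. -/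
lemma eventually_card_le_gaussianTail {q β : ℝ} (hq : 0 ≤ q) (hqβ : q < β)
    {H : ∀ n, Finset (Fin n)}
    (h : Tendsto (fun n : ℕ => ((H n).card : ℝ) / (n : ℝ) ^ (1 - β)) atTop (𝓝 1))
    {c : ℝ} (hc : 0 < c) :
    ∀ᶠ n : ℕ in atTop, ((H n).card : ℝ) ≤ c * (n * gaussianTail (level q n + 1)) := by
  obtain ⟨q', hqq', hq'β⟩ := exists_between hqβ
  have h1 : Tendsto (fun n : ℕ => (n : ℝ) ^ (-(β - q'))) atTop (𝓝 0) :=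
    (tendsto_rpow_neg_atTop (sub_pos.2 hq'β)).comp tendsto_natCast_atTop_atTop
  filter_upwards [h1.eventually_le_const (half_pos hc), eventually_card_bounds h,
    eventually_le_gaussianTail_level hq hqq', eventually_gt_atTop 0] with n hn hb hlow hn0
  have hn0' : (0 : ℝ) < n := by exact_mod_cast hn0
  have e : (n : ℝ) ^ (1 - β) = n * ((n : ℝ) ^ (-(β - q')) * (n : ℝ) ^ (-q')) := by
    rw [← Real.rpow_add hn0', Real.rpow_sub hn0', Real.rpow_one, div_eq_mul_inv,
      ← Real.rpow_neg hn0'.le]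
    ring_nf
  calc ((H n).card : ℝ) ≤ 2 * (n * ((n : ℝ) ^ (-(β - q')) * (n : ℝ) ^ (-q'))) := e ▸ hb.2
    _ ≤ 2 * (n * (c / 2 * gaussianTail (level q n + 1))) := by gcongr
    _ = c * (n * gaussianTail (level q n + 1)) := by ring

/-- Above the level `√(2 β log n)`, the non-null subjects outnumber the null ones. -/
lemma eventually_gaussianTail_le_card {q β : ℝ} (hβ : 0 ≤ β) (hβq : β < q)
    {H : ∀ n, Finset (Fin n)}
    (h : Tendsto (fun n : ℕ => ((H n).card : ℝ) / (n : ℝ) ^ (1 - β)) atTop (𝓝 1))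
    {c : ℝ} (hc : 0 < c) :
    ∀ᶠ n : ℕ in atTop, n * gaussianTail (level q n) ≤ c * (H n).card := by
  have h1 : Tendsto (fun n : ℕ => (n : ℝ) ^ (-(q - β))) atTop (𝓝 0) :=
    (tendsto_rpow_neg_atTop (sub_pos.2 hβq)).comp tendsto_natCast_atTop_atTop
  filter_upwards [h1.eventually_le_const (half_pos hc), eventually_card_bounds h,
    eventually_gt_atTop 0] with n hn hb hn0
  have hn0' : (0 : ℝ) < n := by exact_mod_cast hn0
  have e : n * (n : ℝ) ^ (-q) = (n : ℝ) ^ (-(q - β)) * (n : ℝ) ^ (1 - β) := by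
    rw [← Real.rpow_add hn0', show -(q - β) + (1 - β) = 1 + -q by ring, Real.rpow_add hn0',
      Real.rpow_one]
  calc n * gaussianTail (level q n) ≤ n * (n : ℝ) ^ (-q) := by
        gcongr
        exact gaussianTail_level_le (by linarith) hn0
    _ = (n : ℝ) ^ (-(q - β)) * (n : ℝ) ^ (1 - β) := e
    _ ≤ c / 2 * (2 * (H n).card) := by
        gcongr
        linarith [hb.1]
    _ = c * (H n).card := by ring

variable {P : ∀ n, Measure (Ω n)} [∀ n, IsProbabilityMeasure (P n)]

/-- The sparse Gaussian model fits into the setting. -/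
lemma SparseNoise.of_model {r β : ℝ} (hβ : β < 1) {H : ∀ n, Finset (Fin n)}
    (hH : Tendsto (fun n : ℕ => ((H n).card : ℝ) / (n : ℝ) ^ (1 - β)) atTop (𝓝 1))
    {YC YT : ∀ n, Fin n → Ω n → ℝ} {A S : ∀ n, Fin n → Ω n → Bool}
    (hmodel : ∀ n, SparseGaussianModel (P n) r (H n) (YC n) (YT n) (A n) (S n)) :
    SparseNoise P β H (fun n ω i => S n i ω) (fun n ω i => A n i ω)
      (fun n ω => signedNoise (level r n) (H n) (YC n) (YT n) (A n) ω) := by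
  have hcard := tendsto_card_atTop hβ hH
  refine ⟨hH, fun n good bad ε hε h => (hmodel n).measureReal_good_and_le good bad hε h, ?_, ?_,
    ?_, ?_⟩
  · refine withHighProb_of_le fun ε hε => ?_
    filter_upwards [eventually_ge_atTop 2] with n hn
    have h0 : (P n).real {ω | ¬ ∀ b, (n : ℝ) ≤ 4 * (group (fun i => S n i ω) b).card} = 0 := by
      rw [measureReal_eq_zero_iff, ← ae_iff]
      filter_upwards [(hmodel n).ae_card_split] with ω hω b
      rw [hω b]
      unfold halfSize
      split_ifs <;> exact_mod_cast (by omega)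
    rw [h0]
    exact hε.le
  · refine withHighProb_forall_bool fun b => withHighProb_of_le fun ε hε => ?_
    have h1 : Tendsto (fun n : ℕ => 8 / (n : ℝ)) atTop (𝓝 0) :=
      tendsto_const_nhds.div_atTop tendsto_natCast_atTop_atTop
    filter_upwards [h1.eventually_le_const hε, eventually_gt_atTop 0] with n hn hn0
    have hne : (Finset.univ : Finset (Fin n)).Nonempty := ⟨⟨0, hn0⟩, Finset.mem_univ _⟩
    have hn0' : (0 : ℝ) < n := by exact_mod_cast hn0
    have h2 := (hmodel n).measureReal_card_assignment_le hne b (δ := 1 / 2) (by norm_num)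
    simp only [Finset.card_univ, Fintype.card_fin, Finset.univ_inter] at h2
    refine (measureReal_mono ?_ (measure_ne_top _ _)).trans (h2.trans (le_trans (le_of_eq ?_) hn))
    · intro ω hω
      simp only [Set.mem_ofPred_eq, not_le] at hω ⊢
      rw [le_abs]
      right
      linarith
    · field_simp
      norm_num
  · intro δ hδ
    refine withHighProb_of_le fun ε hε => ?_
    have h1 : Tendsto (fun n => 1 / (2 * δ ^ 2) / ((H n).card : ℝ)) atTop (𝓝 0) :=
      tendsto_const_nhds.div_atTop hcard
    filter_upwards [h1.eventually_le_const hε, hcard.eventually_gt_atTop 0] with n hn hn0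
    have hne : (H n).Nonempty := Finset.card_pos.1 (by exact_mod_cast hn0)
    have h2 := (hmodel n).measureReal_card_assignment_le hne true (δ := 2 * δ) (by positivity)
    refine (measureReal_mono ?_ (measure_ne_top _ _)).trans (h2.trans (le_trans (le_of_eq ?_) hn))
    · intro ω hω
      simp only [Set.mem_ofPred_eq, not_le] at hω ⊢
      rw [mul_one_div]
      linarith
    · field_simp
  · refine withHighProb_forall_bool fun b => withHighProb_of_le fun ε hε => ?_
    have h1 : Tendsto (fun n => 32 / ((H n).card : ℝ)) atTop (𝓝 0) :=
      tendsto_const_nhds.div_atTop hcard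
    filter_upwards [h1.eventually_le_const hε, hcard.eventually_gt_atTop 0,
      eventually_ge_atTop 2] with n hn hn0 hn2
    have hne : (H n).Nonempty := Finset.card_pos.1 (by exact_mod_cast hn0)
    have h2 := (hmodel n).measureReal_card_assignment_split_le hn2 hne b
    refine (measureReal_mono ?_ (measure_ne_top _ _)).trans (h2.trans hn)
    intro ω hω
    simp only [Set.mem_ofPred_eq, not_le] at hω ⊢
    exact hω.le

variable {β : ℝ} {H : ∀ n, Finset (Fin n)} {s a : ∀ n, Ω n → Fin n → Bool}
  {w : ∀ n, Ω n → Fin n → ℝ}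

/-- Conditionally on the split and the assignment, the noise is Gaussian. -/
lemma SparseNoise.withHighProb_noise (h : SparseNoise P β H s a w)
    {good : ∀ n, (Fin n → Bool) → (Fin n → Bool) → Prop}
    {E : ∀ n, (Fin n → Bool) → (Fin n → Bool) → (Fin n → ℝ) → Prop}
    (hgood : WithHighProb P fun n ω => good n (s n ω) (a n ω))
    (hE : ∀ ε : ℝ, 0 < ε → ∀ᶠ n in atTop, ∀ s a, good n s a →
      (gaussianPi n).real {w | ¬ E n s a w} ≤ ε) :
    WithHighProb P fun n ω => E n (s n ω) (a n ω) (w n ω) := by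
  have h1 : WithHighProb P fun n ω => ¬ (good n (s n ω) (a n ω) ∧
      w n ω ∈ {w | ¬ E n (s n ω) (a n ω) w}) := by
    refine withHighProb_of_le fun ε hε => ?_
    filter_upwards [hE ε hε] with n hn
    simp only [not_not]
    exact h.noise n (good n) (fun s a => {w | ¬ E n s a w}) ε hε.le hn
  refine (h1.and hgood).mono (Eventually.of_forall fun n ω hω => ?_)
  by_contra hcon
  exact hω.1 ⟨hω.2, hcon⟩

lemma SparseNoise.tailRegular (h : SparseNoise P β H s a w)
    (T : ∀ n, (Fin n → Bool) → (Fin n → Bool) → Finset (Fin n))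
    (hT : WithHighProb P fun n ω => (n : ℝ) ≤ 8 * (T n (s n ω) (a n ω)).card)
    {q : ℝ} (hq : 0 ≤ q) (hq1 : q < 1) (B : ℝ) {δ : ℝ} (hδ : 0 < δ) (hδ1 : δ ≤ 1) :
    WithHighProb P fun n ω =>
      TailRegular (T n (s n ω) (a n ω)) δ (-B) (level q n) (w n ω) ∧
      TailRegular (T n (s n ω) (a n ω)) δ (-B) (level q n) fun i => -w n ω i := by
  have hreg := fun ε hε => eventually_tailRegular hq hq1 B hδ hδ1 (ε := ε) hε
  refine (h.withHighProb_noise (good := fun n s a => (n : ℝ) ≤ 8 * (T n s a).card)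
    (E := fun n s a w => TailRegular (T n s a) δ (-B) (level q n) w) hT fun ε hε => ?_).and
    (h.withHighProb_noise (good := fun n s a => (n : ℝ) ≤ 8 * (T n s a).card)
    (E := fun n s a w => TailRegular (T n s a) δ (-B) (level q n) fun i => -w i) hT fun ε hε => ?_)
  · filter_upwards [hreg ε hε] with n hn s a hsa using hn _ hsa
  · filter_upwards [hreg ε hε] with n hn s a hsa
    rw [gaussianPi_real_neg fun w => ¬ TailRegular (T n s a) δ (-B) (level q n) w]
    exact hn _ hsa

/-- Only a small proportion of the non-null subjects has a noise above a diverging level. -/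
lemma SparseNoise.card_noise_ge_le (h : SparseNoise P β H s a w) {x : ℕ → ℝ}
    (hx : Tendsto x atTop atTop) {η : ℝ} (hη : 0 < η) :
    WithHighProb P fun n ω =>
      (((H n).filter fun i => x n ≤ w n ω i).card : ℝ) ≤ η * (H n).card ∧
      (((H n).filter fun i => x n ≤ -w n ω i).card : ℝ) ≤ η * (H n).card := by
  have hlim := tendsto_gaussianTail_atTop.comp hx
  have key : ∀ ε : ℝ, 0 < ε → ∀ᶠ n in atTop, (gaussianPi n).real
      {w | ¬ (((H n).filter fun i => x n ≤ w i).card : ℝ) ≤ η * (H n).card} ≤ ε := by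
    intro ε hε
    filter_upwards [hlim.eventually_le_const (show 0 < ε * η by positivity)] with n hn
    have h1 := gaussianPi_card_gt_le (H n) (B := Set.Ici (x n)) measurableSet_Ici hη
    simp only [not_le]
    refine h1.trans ?_
    rw [div_le_iff₀ hη]
    exact hn
  have htriv : WithHighProb P fun _ _ => True := withHighProb_of_forall fun _ _ => trivial
  refine (h.withHighProb_noise (good := fun _ _ _ => True)
    (E := fun n s a w => (((H n).filter fun i => x n ≤ w i).card : ℝ) ≤ η * (H n).card)
    htriv fun ε hε => ?_).and (h.withHighProb_noise (good := fun _ _ _ => True)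
    (E := fun n s a w => (((H n).filter fun i => x n ≤ -w i).card : ℝ) ≤ η * (H n).card)
    htriv fun ε hε => ?_)
  · filter_upwards [key ε hε] with n hn s a _ using hn
  · filter_upwards [key ε hε] with n hn s a _
    rw [gaussianPi_real_neg
      fun w => ¬ (((H n).filter fun i => x n ≤ w i).card : ℝ) ≤ η * (H n).card]
    exact hn

lemma memLp_sq_sub_one : MemLp (fun z : ℝ => z ^ 2 - 1) 2 (gaussianReal 0 1) := by
  have h4 : MemLp (fun z : ℝ => z) 4 (gaussianReal 0 1) := memLp_id_gaussianReal 4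
  have : MemLp (fun z : ℝ => z * z) 2 (gaussianReal 0 1) :=
    MemLp.mul' (hpqr := ⟨by
      rw [← two_mul, ← ENNReal.toReal_eq_toReal_iff' (by finiteness) (by finiteness)]
      norm_num⟩) h4 h4
  simp only [pow_two]
  exact this.sub (memLp_const 1)

lemma integral_sq_gaussianReal : ∫ z, z ^ 2 ∂(gaussianReal 0 1) = 1 := by
  have h1 := variance_eq_sub (X := fun z : ℝ => z) (μ := gaussianReal 0 1) (memLp_id_gaussianReal 2)
  rw [variance_fun_id_gaussianReal, integral_id_gaussianReal] at h1
  simpa using h1.symm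

/-- The empirical moments of the noise in a large group are close to the Gaussian ones. -/
lemma eventually_momentRegular {ε : ℝ} (hε : 0 < ε) :
    ∀ᶠ n : ℕ in atTop, ∀ (a : Fin n → Bool) (G : Finset (Fin n)), (n : ℝ) ≤ 4 * G.card →
      (gaussianPi n).real {w | ¬ MomentRegular a G (1 / Real.log n ^ 3) w} ≤ ε := by
  set v := Var[fun z : ℝ => z ^ 2 - 1; gaussianReal 0 1] with hv
  have hv0 : 0 ≤ v := variance_nonneg _ _
  have hlim : Tendsto (fun n : ℕ => 4 * (1 + v) * (Real.log n ^ 6 * (n : ℝ) ^ (-1 : ℝ))) atTop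
      (𝓝 0) := by
    simpa using (tendsto_log_pow_mul_rpow_neg 6 one_pos).const_mul (4 * (1 + v))
  filter_upwards [hlim.eventually_le_const hε, eventually_gt_atTop 1] with n hn hn1 a G hG
  have hn0 : (0 : ℝ) < n := by exact_mod_cast (by omega : 0 < n)
  have hl : 0 < Real.log n := Real.log_pos (by exact_mod_cast hn1)
  have hc : (0 : ℝ) < G.card := by linarith
  have hx : 0 < 1 / Real.log n ^ 3 * G.card := by positivity
  have hid : MemLp (fun z : ℝ => z) 2 (gaussianReal 0 1) := memLp_id_gaussianReal 2
  have h1 := gaussianPi_sum_ge_le G (f := fun i z => if a i = true then z else -z) (v := 1)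
    (fun i => ?_) (fun i => ?_) (fun i => ?_) hx
  rotate_left
  · by_cases ha : a i = true
    · simpa [ha] using hid
    · simp only [if_neg ha]
      exact hid.neg
  · by_cases ha : a i = true
    · simp [ha]
    · simp only [if_neg ha]
      rw [integral_neg, integral_id_gaussianReal, neg_zero]
  · by_cases ha : a i = true
    · simp [ha, variance_fun_id_gaussianReal]
    · simp only [if_neg ha]
      rw [variance_fun_neg, variance_fun_id_gaussianReal]
      simp
  have h2 := gaussianPi_sum_ge_le G (f := fun _ z => z ^ 2 - 1) (v := v)
    (fun _ => memLp_sq_sub_one) (fun _ => ?_) (fun _ => hv.ge) hx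
  rotate_left
  · rw [integral_sub, integral_sq_gaussianReal]
    · simp
    · exact (memLp_two_iff_integrable_sq hid.1).1 hid
    · exact integrable_const _
  have hsub : {w | ¬ MomentRegular a G (1 / Real.log n ^ 3) w} ⊆
      {w | 1 / Real.log n ^ 3 * G.card ≤ |∑ i ∈ G, (if a i = true then w i else -w i)|} ∪
      {w | 1 / Real.log n ^ 3 * G.card ≤ |∑ i ∈ G, (w i ^ 2 - 1)|} := by
    intro w hw
    by_contra hcon
    simp only [Set.mem_union, Set.mem_ofPred_eq, not_or, not_le] at hcon
    exact hw ⟨hcon.1.le, hcon.2.le⟩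
  refine (measureReal_mono hsub (measure_ne_top _ _)).trans ((measureReal_union_le _ _).trans ?_)
  refine (add_le_add h1 h2).trans (le_trans ?_ hn)
  rw [Real.rpow_neg_one, ← add_div, div_le_iff₀ (by positivity)]
  have e : 4 * (1 + v) * (Real.log n ^ 6 * (n : ℝ)⁻¹) * (1 / Real.log n ^ 3 * G.card) ^ 2 =
      (1 + v) * (4 * G.card / n) * G.card := by
    field_simp
  rw [e]
  have h5 : 1 ≤ 4 * (G.card : ℝ) / n := by
    rw [le_div_iff₀ hn0]
    linarith
  calc (G.card : ℝ) * 1 + G.card * v = (1 + v) * 1 * G.card := by ring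
    _ ≤ _ := by gcongr

lemma SparseNoise.momentRegular (h : SparseNoise P β H s a w) :
    WithHighProb P fun n ω => ∀ b,
      MomentRegular (a n ω) (group (s n ω) b) (1 / Real.log n ^ 3) (w n ω) ∧
      MomentRegular (a n ω) (group (a n ω) b) (1 / Real.log n ^ 3) (w n ω) := by
  refine withHighProb_forall_bool fun b => ?_
  refine (h.withHighProb_noise
    (good := fun n s a => (n : ℝ) ≤ 4 * (group s b).card)
    (E := fun n s a w => MomentRegular a (group s b) (1 / Real.log n ^ 3) w)
    (h.card_split.mono (Eventually.of_forall fun n ω hω => hω b)) fun ε hε => ?_).and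
    (h.withHighProb_noise
    (good := fun n s a => (n : ℝ) ≤ 4 * (group a b).card)
    (E := fun n s a w => MomentRegular a (group a b) (1 / Real.log n ^ 3) w)
    (h.card_arm.mono (Eventually.of_forall fun n ω hω => hω b)) fun ε hε => ?_)
  · filter_upwards [eventually_momentRegular hε] with n hn s a hsa using hn _ _ hsa
  · filter_upwards [eventually_momentRegular hε] with n hn s a hsa using hn _ _ hsa

end Setting

/-! ### Localization of the rejection sets -/

section Localization

variable {Ω : ℕ → Type*} [∀ n, MeasurableSpace (Ω n)] {P : ∀ n, Measure (Ω n)}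
  [∀ n, IsProbabilityMeasure (P n)] {β : ℝ} {H : ∀ n, Finset (Fin n)}
  {s a : ∀ n, Ω n → Fin n → Bool} {w : ∀ n, Ω n → Fin n → ℝ}

lemma eventually_level_le_log {q : ℝ} (hq : 0 ≤ q) : ∀ᶠ n : ℕ in atTop, level q n ≤ Real.log n := by
  filter_upwards [(tendsto_level_div_log q hq).eventually_le_const one_pos,
    tendsto_log_natCast.eventually_gt_atTop 0] with n hn hl
  rwa [div_le_one hl] at hn

/-- The signals are negligible in the empirical moments of the outcomes of a large group. -/
lemma eventually_signal_small {r : ℝ} (hr : 0 ≤ r) (hβ : 0 < β)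
    (hH : Tendsto (fun n : ℕ => ((H n).card : ℝ) / (n : ℝ) ^ (1 - β)) atTop (𝓝 1)) :
    ∀ᶠ n : ℕ in atTop, ∀ m : ℝ, (n : ℝ) ≤ 4 * m →
      level r n * (H n).card ≤ 1 / Real.log n ^ 3 * m ∧
      (1 + 1 / (1 / Real.log n ^ 3)) * level r n ^ 2 * (H n).card ≤ 1 / Real.log n ^ 3 * m ∧
      2 ≤ 1 / Real.log n ^ 3 * (m - 1) := by
  filter_upwards [eventually_level_le_log hr, tendsto_log_natCast.eventually_ge_atTop 1,
    eventually_log_pow_mul_card_le hβ hH 8 (show (0 : ℝ) < 1 / 8 by norm_num),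
    (tendsto_log_pow_mul_rpow_neg 3 one_pos).eventually_le_const
      (show (0 : ℝ) < 1 / 12 by norm_num), eventually_gt_atTop 0] with n hlev hl hc h3 hn0 m hm
  have hn0' : (0 : ℝ) < n := by exact_mod_cast hn0
  have hlev0 := level_nonneg r n
  rw [Real.rpow_neg_one, ← div_eq_mul_inv, div_le_iff₀ hn0'] at h3
  generalize Real.log n = l at *
  generalize level r n = t at *
  have hl0 : 0 < l := by linarith
  have hl3 : 1 ≤ l ^ 3 := one_le_pow₀ hl
  have hh : (0 : ℝ) ≤ (H n).card := Nat.cast_nonneg _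
  generalize ((H n).card : ℝ) = h at *
  rw [one_div_one_div]
  simp only [one_div_mul_eq_div]
  have hl3' : 0 < l ^ 3 := by positivity
  refine ⟨?_, ?_, ?_⟩ <;> rw [le_div_iff₀ hl3']
  · have h1 : t * h * l ^ 3 ≤ l * h * l ^ 3 := by gcongr
    have h2 : l * h * l ^ 3 ≤ l ^ 8 * h := by
      have : l ^ 4 ≤ l ^ 8 := pow_le_pow_right₀ hl (by norm_num)
      have := mul_le_mul_of_nonneg_right this hh
      calc l * h * l ^ 3 = l ^ 4 * h := by ring
        _ ≤ _ := this
    linarith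
  · have h1 : (1 + l ^ 3) * t ^ 2 * h * l ^ 3 ≤ (l ^ 3 + l ^ 3) * l ^ 2 * h * l ^ 3 := by gcongr
    have h2 : (l ^ 3 + l ^ 3) * l ^ 2 * h * l ^ 3 = 2 * (l ^ 8 * h) := by ring
    linarith
  · linarith

lemma eventually_rate_le {C : ℝ} (hC : 0 < C) :
    ∀ᶠ n : ℕ in atTop, C * (1 / Real.log n ^ 3) ≤ 1 / Real.log n ∧
      C * (1 / Real.log n ^ 3) * Real.log n ≤ 1 / Real.log n := by
  filter_upwards [tendsto_log_natCast.eventually_ge_atTop (max 1 C)] with n hn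
  have hl : 1 ≤ Real.log n := (le_max_left _ _).trans hn
  have hC' : C ≤ Real.log n := (le_max_right _ _).trans hn
  generalize Real.log n = l at *
  have hl0 : 0 < l := by linarith
  have e : C * (1 / l ^ 3) * l ≤ 1 / l := by
    rw [le_div_iff₀ hl0]
    have : C * (1 / l ^ 3) * l * l = C / l := by field_simp
    rw [this, div_le_one hl0]
    exact hC'
  exact ⟨(le_mul_of_one_le_right (by positivity) hl).trans e, e⟩

/-- The cross-fitted effects are close to twice the scores. -/
lemma SparseNoise.crossfitEffect_close (h : SparseNoise P β H s a w) {r : ℝ} (hr : 0 ≤ r)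
    (hβ : 0 < β) : WithHighProb P fun n ω => ∀ i,
      |crossfitEffect (s n ω) (a n ω) (outcome (level r n) (H n) (a n ω) (w n ω)) i / 2 -
        score (level r n) (H n) (a n ω) (w n ω) i| ≤ 1 / Real.log n := by
  refine (h.momentRegular.and h.card_split).mono ?_
  filter_upwards [eventually_signal_small hr hβ h.card_nonnull, eventually_rate_le two_pos,
    eventually_gt_atTop 0] with n hsmall hrate hn ω ⟨hmom, hcard⟩ i
  rw [abs_crossfitEffect_sub_score]
  have hn' : (0 : ℝ) < n := by exact_mod_cast hn
  have hc := hcard (!s n ω i)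
  refine (abs_average_outcome_le (level_nonneg r n) (hmom _).1 (hsmall _ hc).1 ?_).trans hrate.1
  have : (0 : ℝ) < (group (s n ω) (!s n ω i)).card := by linarith
  exact_mod_cast this

/-- The linear effects and their studentized versions are close to the scores. -/
lemma SparseNoise.linearEffect_close (h : SparseNoise P β H s a w) {r : ℝ} (hr : 0 ≤ r)
    (hβ : 0 < β) : WithHighProb P fun n ω => ∀ i,
      |linearEffect (a n ω) (outcome (level r n) (H n) (a n ω) (w n ω)) i -
        score (level r n) (H n) (a n ω) (w n ω) i| ≤ 1 / Real.log n ∧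
      ∀ u, |u| ≤ Real.log n →
        (u ≤ linearEffect (a n ω) (outcome (level r n) (H n) (a n ω) (w n ω)) i /
            √(linearEffectVariance (a n ω) (outcome (level r n) (H n) (a n ω) (w n ω)) i) →
          u - 1 / Real.log n ≤ score (level r n) (H n) (a n ω) (w n ω) i) ∧
        (u + 1 / Real.log n ≤ score (level r n) (H n) (a n ω) (w n ω) i →
          u ≤ linearEffect (a n ω) (outcome (level r n) (H n) (a n ω) (w n ω)) i /
            √(linearEffectVariance (a n ω) (outcome (level r n) (H n) (a n ω) (w n ω)) i)) := by
  refine (h.momentRegular.and h.card_arm).mono ?_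
  filter_upwards [eventually_signal_small hr hβ h.card_nonnull,
    eventually_rate_le (show (0 : ℝ) < 10 by norm_num),
    tendsto_log_natCast.eventually_ge_atTop 10, eventually_gt_atTop 0]
    with n hsmall hrate hl hn ω ⟨hmom, hcard⟩ i
  have hn' : (0 : ℝ) < n := by exact_mod_cast hn
  have hl0 : 0 < Real.log n := by linarith
  have hρ : 0 < 1 / Real.log n ^ 3 := by positivity
  have hρ1 : 1 / Real.log n ^ 3 ≤ 1 / 10 := by
    refine one_div_le_one_div_of_le (by norm_num) (hl.trans ?_)
    exact le_self_pow₀ (by linarith) (by norm_num)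
  have hc := hcard (!a n ω i)
  have hV : |linearEffect (a n ω) (outcome (level r n) (H n) (a n ω) (w n ω)) i -
      score (level r n) (H n) (a n ω) (w n ω) i| ≤ 2 * (1 / Real.log n ^ 3) := by
    rw [abs_linearEffect_sub_score]
    refine abs_average_outcome_le (level_nonneg r n) (hmom _).2 (hsmall _ hc).1 ?_
    have : (0 : ℝ) < (group (a n ω) (!a n ω i)).card := by linarith
    exact_mod_cast this
  have hvar := abs_linearEffectVariance_sub_one_le (level_nonneg r n) hρ hρ1
    (fun b => (hmom b).2) (fun b => (hsmall _ (hcard b)).1) (fun b => (hsmall _ (hcard b)).2.1)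
    (fun b => (hsmall _ (hcard b)).2.2) i
  have hvar0 : 0 ≤ linearEffectVariance (a n ω) (outcome (level r n) (H n) (a n ω) (w n ω)) i := by
    linarith [(abs_le.1 hvar).1]
  refine ⟨hV.trans (le_trans ?_ hrate.1), fun u hu => ?_⟩
  · linarith
  · refine studentized_threshold hV ((abs_sqrt_sub_one_le hvar0).trans hvar) hρ.le hρ1 hu ?_
    have : 1 / Real.log n ^ 3 * 1 ≤ 1 / Real.log n ^ 3 * Real.log n := by
      gcongr
      linarith
    linarith [hrate.2]

lemma card_group_sdiff_ge {n : ℕ} {G H : Finset (Fin n)} (hG : (n : ℝ) ≤ 4 * G.card)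
    (hH : (H.card : ℝ) ≤ 1 / 8 * n) : (n : ℝ) ≤ 8 * (G \ H).card := by
  have h1 : (G.card : ℝ) ≤ (G \ H).card + H.card := by
    exact_mod_cast tsub_le_iff_right.1 (Finset.le_card_sdiff H G)
  linarith

lemma SparseNoise.eventually_card_le (h : SparseNoise P β H s a w) (hβ : 0 < β) :
    ∀ᶠ n : ℕ in atTop, ((H n).card : ℝ) ≤ 1 / 8 * n := by
  filter_upwards [eventually_log_pow_mul_card_le hβ h.card_nonnull 0
    (show (0 : ℝ) < 1 / 8 by norm_num)] with n hn
  simpa using hn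

/-- The automated Crossfit-I³ identifies nobody with a score much below `√(2 β log n)`. -/
lemma SparseNoise.le_score_of_mem_crossfitI3 (h : SparseNoise P β H s a w) {r : ℝ} (hr : 0 ≤ r)
    (hβ1 : β < 1) {α : ℝ} (hα : α ≤ 1) {q : ℝ} (hq : 0 ≤ q) (hqβ : q < β) :
    WithHighProb P fun n ω =>
      ∀ i ∈ crossfitI3 α (s n ω) (a n ω) (outcome (level r n) (H n) (a n ω) (w n ω)),
        level q n - 1 ≤ score (level r n) (H n) (a n ω) (w n ω) i := by
  have hβ : 0 < β := hq.trans_lt hqβ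
  obtain ⟨q', hqq', hq'β⟩ := exists_between hqβ
  have hq' : 0 ≤ q' := hq.trans hqq'.le
  have hT : ∀ b, WithHighProb P fun n ω => (n : ℝ) ≤ 8 * (group (s n ω) b \ H n).card := fun b =>
    h.card_split.mono (by
      filter_upwards [h.eventually_card_le hβ] with n hn ω hω using card_group_sdiff_ge (hω b) hn)
  have hreg := withHighProb_forall_bool fun b =>
    (h.tailRegular (fun n s _ => group s b \ H n) (hT b) hq' (hq'β.trans hβ1) 1
      (show (0 : ℝ) < 1 / 10 by norm_num) (by norm_num)).and (hT b)
  refine (hreg.and (h.crossfitEffect_close hr hβ)).mono ?_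
  filter_upwards [eventually_level_add_le hq hqq' 2, tendsto_log_natCast.eventually_ge_atTop 1,
    eventually_gaussianTail_sub_le hq' (hq'β.trans hβ1) (show (0 : ℝ) ≤ 3 by norm_num)
      (show (0 : ℝ) < 1 / 10 by norm_num),
    eventually_card_le_gaussianTail hq' hq'β h.card_nonnull
      (show (0 : ℝ) < 1 / 80 by norm_num)] with n hlev hl hratio hcard ω ⟨hω, hclose⟩ i hi
  have hl1 : 1 / Real.log n ≤ 1 := by
    rw [div_le_one (by linarith)]
    exact hl
  have hb : ∀ b, i ∈ autoI3 (α / 2) (crossfitEffect (s n ω) (a n ω)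
      (outcome (level r n) (H n) (a n ω) (w n ω))) (group (s n ω) b) →
      level q n - 1 ≤ score (level r n) (H n) (a n ω) (w n ω) i := by
    intro b hi
    have h1 := (le_of_mem_autoI3 (e := 1 / Real.log n) (L := level q n) (hi := level q' n)
      (H := H n) (w := w n ω) (by linarith) rfl (by positivity) hl1 (fun j hj => ?_) (by linarith)
      (hω b).1.1 (hω b).1.2 (fun u hu => ?_) ?_ hi).2
    · have := abs_le.1 (hclose i)
      linarith
    · have := hclose j
      rwa [score_of_notMem (Finset.mem_sdiff.1 hj).2] at this
    · rw [mul_one_div]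
      exact hratio u hu
    · have h2 : gaussianTail (level q' n + 1) ≤ gaussianTail (level q' n) :=
        gaussianTail_anti (by linarith)
      have h3 := mul_le_mul (hω b).2 h2 (gaussianTail_nonneg _) (by positivity)
      linarith
  rcases Finset.mem_union.1 hi with hi | hi
  · exact hb _ hi
  · exact hb _ hi

lemma linearBH_eq {n : ℕ} (α : ℝ) (a : Fin n → Bool) (y : Fin n → ℝ) :
    linearBH α a y = benjaminiHochberg α fun i =>
      gaussianTail (linearEffect a y i / √(linearEffectVariance a y i)) := by
  unfold linearBH
  congr 1
  funext i
  exact one_sub_cdf_gaussianReal _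

/-- The linear-BH procedure identifies nobody with a score much below `√(2 β log n)`. -/
lemma SparseNoise.le_score_of_mem_linearBH (h : SparseNoise P β H s a w) {r : ℝ} (hr : 0 ≤ r)
    (hβ1 : β < 1) {α : ℝ} (hα0 : 0 < α) (hα : α < 1) {q : ℝ} (hq : 0 ≤ q) (hqβ : q < β) :
    WithHighProb P fun n ω =>
      ∀ i ∈ linearBH α (a n ω) (outcome (level r n) (H n) (a n ω) (w n ω)),
        level q n - 1 ≤ score (level r n) (H n) (a n ω) (w n ω) i := by
  have hβ : 0 < β := hq.trans_lt hqβ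
  have hq1 : q < 1 := hqβ.trans hβ1
  -- with this `δ`, the factor `(1 + δ) ^ 2 + δ` lost below is smaller than `1 / α`
  obtain ⟨δ, hδ⟩ : ∃ δ, δ = (1 - α) / 4 := ⟨_, rfl⟩
  have hδ0 : 0 < δ := by linarith
  have hδ1 : δ ≤ 1 := by linarith
  -- below `-B`, the `p`-values are larger than `α`, so that no regularity of the tails is needed
  obtain ⟨B, hB, hB0⟩ : ∃ B, α < gaussianTail (-B) ∧ 0 ≤ B := by
    have h1 := (tendsto_gaussianTail_atBot.comp tendsto_neg_atTop_atBot).eventually_const_lt hα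
    obtain ⟨B, hB⟩ := (h1.and (eventually_ge_atTop 0)).exists
    exact ⟨B, hB.1, hB.2⟩
  have hreg := h.tailRegular (fun n _ _ => Finset.univ)
    (withHighProb_of_forall fun n _ => by
      rw [Finset.card_univ, Fintype.card_fin]
      linarith [(Nat.cast_nonneg n : (0 : ℝ) ≤ n)]) hq hq1 (B + 1) hδ0 hδ1
  refine (hreg.and (h.linearEffect_close hr hβ)).mono ?_
  filter_upwards [eventually_level_le_log hq,
    tendsto_log_natCast.eventually_ge_atTop (max 1 B),
    eventually_gaussianTail_sub_le hq hq1 zero_le_one hδ0,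
    eventually_card_le_gaussianTail hq hqβ h.card_nonnull hδ0, eventually_gt_atTop 0]
    with n hlev hl hratio hcard hn ω ⟨⟨hω, _⟩, hclose⟩ i hi
  have hn0 : (0 : ℝ) < n := by exact_mod_cast hn
  have hl1 : 1 ≤ Real.log n := (le_max_left _ _).trans hl
  have hBl : B ≤ Real.log n := (le_max_right _ _).trans hl
  have hil : 1 / Real.log n ≤ 1 := by
    rw [div_le_one (by linarith)]
    exact hl1
  have hlev0 := level_nonneg q n
  rw [linearBH_eq] at hi
  have hL := le_of_mem_benjaminiHochberg (L := level q n) hα0.le (fun u hu => ?_) hi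
  · have := ((hclose i).2 (level q n) (by rwa [abs_of_nonneg hlev0])).1 hL
    linarith
  rcases lt_or_ge u (-B) with huB | huB
  · have h1 : ((Finset.univ.filter fun j => u ≤ linearEffect (a n ω)
        (outcome (level r n) (H n) (a n ω) (w n ω)) j / √(linearEffectVariance (a n ω)
        (outcome (level r n) (H n) (a n ω) (w n ω)) j)).card : ℝ) ≤ n := by
      refine (Nat.cast_le.2 (Finset.card_filter_le _ _)).trans ?_
      simp
    calc _ ≤ α * n := by gcongr
      _ < gaussianTail (-B) * n := by gcongr
      _ ≤ gaussianTail u * n := by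
          gcongr
          exact gaussianTail_anti huB.le
      _ = _ := mul_comm _ _
  · have hul : |u| ≤ Real.log n := abs_le.2 ⟨by linarith, by linarith⟩
    have h1 : (Finset.univ.filter fun j => u ≤ linearEffect (a n ω)
        (outcome (level r n) (H n) (a n ω) (w n ω)) j / √(linearEffectVariance (a n ω)
        (outcome (level r n) (H n) (a n ω) (w n ω)) j)).card ≤
        (Finset.univ.filter fun j => u - 1 / Real.log n ≤ w n ω j).card + (H n).card := by
      refine (Finset.card_le_card fun j hj => ?_).trans (Finset.card_union_le _ _)
      by_cases hjH : j ∈ H n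
      · exact Finset.mem_union_right _ hjH
      · have := ((hclose j).2 u hul).1 (Finset.mem_filter.1 hj).2
        rw [score_of_notMem hjH] at this
        exact Finset.mem_union_left _ (Finset.mem_filter.2 ⟨Finset.mem_univ _, this⟩)
    have h2 := (hω (u - 1 / Real.log n) (by linarith)
      (by linarith [show 0 ≤ 1 / Real.log n by positivity])).2
    rw [Finset.card_univ, Fintype.card_fin] at h2
    have h3 := mul_le_mul_of_nonneg_left (hratio u hu) hn0.le
    rw [mul_left_comm] at h3
    have h4 : n * gaussianTail (level q n + 1) ≤ n * gaussianTail u := by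
      gcongr
      exact gaussianTail_anti (by linarith)
    have h5 : 0 < n * gaussianTail u := by
      refine mul_pos hn0 (lt_of_lt_of_le ?_ (gaussianTail_anti hu))
      exact lt_of_lt_of_le (gaussianPDFReal_pos _ _ _ one_ne_zero)
        (gaussianPDFReal_le_gaussianTail hlev0)
    generalize hN : (Finset.univ.filter fun j => u ≤ linearEffect (a n ω)
        (outcome (level r n) (H n) (a n ω) (w n ω)) j / √(linearEffectVariance (a n ω)
        (outcome (level r n) (H n) (a n ω) (w n ω)) j)).card = N at h1 ⊢
    have h1' : (N : ℝ) ≤ (Finset.univ.filter fun j => u - 1 / Real.log n ≤ w n ω j).card +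
        (H n).card := by exact_mod_cast h1
    generalize n * gaussianTail u = x at *
    have h6 : (1 + δ) * (n * gaussianTail (u - 1 / Real.log n)) ≤ (1 + δ) * ((1 + δ) * x) :=
      mul_le_mul_of_nonneg_left h3 (by linarith)
    have h7 : δ * (n * gaussianTail (level q n + 1)) ≤ δ * x := by gcongr
    have h8 : (N : ℝ) ≤ (1 + 4 * δ) * x := by
      have : δ * δ * x ≤ 1 * δ * x := by gcongr
      linarith
    calc α * (N : ℝ) ≤ α * ((1 + 4 * δ) * x) := by gcongr
      _ = (1 - (1 - α) ^ 2) * x := by rw [hδ]; ring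
      _ < 1 * x := by
          have : 0 < (1 - α) ^ 2 := by
            have : 0 < 1 - α := by linarith
            positivity
          gcongr
          linarith
      _ = x := one_mul x

/-- Only a small proportion of the treated non-null subjects has a score below a level that is much
lower than the signal. -/
lemma SparseNoise.card_score_lt_le (h : SparseNoise P β H s a w) {q r : ℝ} (hq : 0 ≤ q)
    (hqr : q < r) {η : ℝ} (hη : 0 < η) : WithHighProb P fun n ω =>
      (((H n ∩ group (a n ω) true).filter fun i =>
        score (level r n) (H n) (a n ω) (w n ω) i < level q n + 1).card : ℝ) ≤
          η * (H n).card := by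
  have hx : Tendsto (fun n => level r n - level q n - 1) atTop atTop :=
    tendsto_atTop_add_const_right _ _ (tendsto_level_sub_atTop hq hqr)
  refine (h.card_noise_ge_le hx hη).mono (Eventually.of_forall fun n ω hω => ?_)
  refine le_trans (Nat.cast_le.2 (Finset.card_le_card fun i hi => ?_)) hω.2
  obtain ⟨hi, hlt⟩ := Finset.mem_filter.1 hi
  obtain ⟨hiH, hiT⟩ := Finset.mem_inter.1 hi
  rw [score_of_treated hiH (Finset.mem_filter.1 hiT).2] at hlt
  exact Finset.mem_filter.2 ⟨hiH, by linarith⟩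

/-- If the signal is above `√(2 β log n)`, the automated Crossfit-I³ identifies everybody with a
score above a level in between. -/
lemma SparseNoise.mem_crossfitI3 (h : SparseNoise P β H s a w) {r : ℝ} (hr1 : r < 1)
    (hβ : 0 < β) (hβ1 : β < 1) {α : ℝ} (hα : 0 < α) {q : ℝ} (hβq : β < q) (hqr : q < r) :
    WithHighProb P fun n ω => ∀ i,
      level q n + 1 ≤ score (level r n) (H n) (a n ω) (w n ω) i →
        i ∈ crossfitI3 α (s n ω) (a n ω) (outcome (level r n) (H n) (a n ω) (w n ω)) := by
  obtain ⟨q₁, hβq₁, hq₁q⟩ := exists_between hβq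
  have hq₁ : 0 ≤ q₁ := hβ.le.trans hβq₁.le
  have hq : 0 < q := hβ.trans hβq
  have hreg := h.tailRegular (fun n _ _ => Finset.univ)
    (withHighProb_of_forall fun n _ => by
      rw [Finset.card_univ, Fintype.card_fin]
      linarith [(Nat.cast_nonneg n : (0 : ℝ) ≤ n)]) hq₁ ((hq₁q.trans hqr).trans hr1) 0 one_pos le_rfl
  refine (((hreg.and (h.crossfitEffect_close (hq.trans hqr).le hβ)).and
    h.card_treated_split).and (h.card_score_lt_le hq.le hqr
      (show (0 : ℝ) < 1 / 32 by norm_num))).mono ?_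
  filter_upwards [eventually_level_add_le hq₁ hq₁q 1,
    tendsto_log_natCast.eventually_ge_atTop 1,
    eventually_gaussianTail_le_card hβ.le hβq₁ h.card_nonnull
      (show (0 : ℝ) < α / 400 by positivity),
    (tendsto_level_atTop hq).eventually_gt_atTop 0,
    (tendsto_card_atTop hβ1 h.card_nonnull).eventually_ge_atTop (200 / α)]
    with n hlev hl htail hlev0 hcard ω ⟨⟨⟨⟨_, hω⟩, hclose⟩, hsplit⟩, hmiss⟩ i hi
  have hil : 1 / Real.log n ≤ 1 := by
    rw [div_le_one (by linarith)]
    exact hl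
  have hα1 : 1 ≤ α / 200 * (H n).card := by
    rw [div_le_iff₀ hα] at hcard
    linarith
  set V := crossfitEffect (s n ω) (a n ω) (outcome (level r n) (H n) (a n ω) (w n ω)) with hV
  set X := score (level r n) (H n) (a n ω) (w n ω) with hX
  have hVX : ∀ j, level q n + 1 ≤ X j → 2 * level q n ≤ V j := fun j hj => by
    have := abs_le.1 (hclose j)
    linarith
  have hfdr : ∀ b, fdrHat V ((group (s n ω) b).filter fun i => 2 * level q n ≤ |V i|) ≤ α / 2 := by
    intro b
    set U := (group (s n ω) b).filter fun i => 2 * level q n ≤ |V i|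
    -- these have a signed noise below `-√(2 q₁ log n)`, which is rare as `q₁ > β`
    have hneg : ((nonpositives V U).card : ℝ) ≤ α / 200 * (H n).card := by
      have h1 : (nonpositives V U).card ≤
          (Finset.univ.filter fun j => level q₁ n ≤ -w n ω j).card := by
        refine Finset.card_le_card fun j hj => Finset.mem_filter.2 ⟨Finset.mem_univ _, ?_⟩
        obtain ⟨hjU, hj0⟩ := Finset.mem_filter.1 hj
        have h2 := (Finset.mem_filter.1 hjU).2
        rw [abs_of_nonpos hj0] at h2
        have h3 := abs_le.1 (hclose j)
        have h4 : w n ω j ≤ X j := by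
          rw [hX, score]
          split_ifs
          · linarith [level_nonneg r n]
          · linarith
        linarith
      have h2 := (hω (level q₁ n) (by linarith [level_nonneg q₁ n]) le_rfl).2
      rw [Finset.card_univ, Fintype.card_fin] at h2
      have h1' : ((nonpositives V U).card : ℝ) ≤
          (Finset.univ.filter fun j => level q₁ n ≤ -w n ω j).card := by exact_mod_cast h1
      linarith
    -- at least `|H| / 16` treated non-nulls are in this half, and at most `|H| / 32` are too small
    have hpos : ((H n).card : ℝ) / 32 ≤ (positives V U).card := by
      have h1 : H n ∩ group (a n ω) true ∩ group (s n ω) b ⊆ positives V U ∪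
          (H n ∩ group (a n ω) true).filter fun i => X i < level q n + 1 := by
        intro j hj
        obtain ⟨hj1, hj2⟩ := Finset.mem_inter.1 hj
        rcases lt_or_ge (X j) (level q n + 1) with hlt | hge
        · exact Finset.mem_union_right _ (Finset.mem_filter.2 ⟨hj1, hlt⟩)
        · have h2 := hVX j hge
          exact Finset.mem_union_left _ (Finset.mem_filter.2 ⟨Finset.mem_filter.2
            ⟨hj2, h2.trans (le_abs_self _)⟩, by linarith⟩)
      have h2 : ((H n ∩ group (a n ω) true ∩ group (s n ω) b).card : ℝ) ≤ (positives V U).card +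
          ((H n ∩ group (a n ω) true).filter fun i => X i < level q n + 1).card := by
        exact_mod_cast (Finset.card_le_card h1).trans (Finset.card_union_le _ _)
      have h3 := hsplit b
      linarith
    have hden : ((positives V U).card : ℝ) ≤ ((max (positives V U).card 1 : ℕ) : ℝ) := by
      exact_mod_cast le_max_left _ _
    rw [fdrHat, div_le_iff₀ (by positivity)]
    calc ((nonpositives V U).card + 1 : ℝ) ≤ α / 2 * ((H n).card / 32) := by
          have : 0 ≤ α * (H n).card := by positivity
          linarith
      _ ≤ _ := by
          gcongr
          exact hpos.trans hden
  have hVi := hVX i hi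
  have hmem : ∀ b, s n ω i = b → i ∈ autoI3 (α / 2) V (group (s n ω) b) := fun b hb =>
    mem_autoI3_of_fdrHat_le (hfdr b) (Finset.mem_filter.2 ⟨Finset.mem_univ _, hb⟩) hVi
      (by linarith)
  by_cases hb : s n ω i = true
  · exact Finset.mem_union_left _ (hmem _ hb)
  · exact Finset.mem_union_right _ (hmem false (by simpa using hb))

/-- If the signal is above `√(2 β log n)`, the linear-BH procedure identifies everybody with a
score above a level in between. -/
lemma SparseNoise.mem_linearBH (h : SparseNoise P β H s a w) {r : ℝ}
    (hβ : 0 < β) {α : ℝ} (hα : 0 < α) {q : ℝ} (hβq : β < q) (hqr : q < r) :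
    WithHighProb P fun n ω => ∀ i,
      level q n + 1 ≤ score (level r n) (H n) (a n ω) (w n ω) i →
        i ∈ linearBH α (a n ω) (outcome (level r n) (H n) (a n ω) (w n ω)) := by
  have hq : 0 < q := hβ.trans hβq
  refine (((h.linearEffect_close (hq.trans hqr).le hβ).and
    (h.card_treated (1 / 4) (by norm_num))).and (h.card_score_lt_le hq.le hqr
      (show (0 : ℝ) < 1 / 8 by norm_num))).mono ?_
  filter_upwards [eventually_level_le_log hq.le, tendsto_log_natCast.eventually_ge_atTop 1,
    eventually_gaussianTail_le_card hβ.le hβq h.card_nonnull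
      (show (0 : ℝ) < α / 8 by positivity), eventually_gt_atTop 0]
    with n hlev hl htail hn ω ⟨⟨hclose, htreated⟩, hmiss⟩ i hi
  have hn0 : (0 : ℝ) < n := by exact_mod_cast hn
  have hil : 1 / Real.log n ≤ 1 := by
    rw [div_le_one (by linarith)]
    exact hl
  set X := score (level r n) (H n) (a n ω) (w n ω) with hX
  rw [linearBH_eq]
  set v := fun i => linearEffect (a n ω) (outcome (level r n) (H n) (a n ω) (w n ω)) i /
    √(linearEffectVariance (a n ω) (outcome (level r n) (H n) (a n ω) (w n ω)) i) with hv
  have hvX : ∀ j, level q n + 1 ≤ X j → level q n ≤ v j := fun j hj =>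
    ((hclose j).2 (level q n) (by rwa [abs_of_nonneg (level_nonneg q n)])).2 (by linarith)
  -- there are at least `|H| / 8` scores above the level, many more than `n` times the Gaussian tail
  refine mem_benjaminiHochberg (v := v) (L := level q n)
    (k := (Finset.univ.filter fun j => level q n + 1 ≤ X j).card)
    (Finset.card_le_card fun j hj => ?_) ?_ hα.le (hvX i hi)
  · exact Finset.mem_filter.2 ⟨Finset.mem_univ _, hvX j (Finset.mem_filter.1 hj).2⟩
  · have h1 : H n ∩ group (a n ω) true ⊆ (Finset.univ.filter fun j => level q n + 1 ≤ X j) ∪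
        (H n ∩ group (a n ω) true).filter fun i => X i < level q n + 1 := by
      intro j hj
      rcases lt_or_ge (X j) (level q n + 1) with hlt | hge
      · exact Finset.mem_union_right _ (Finset.mem_filter.2 ⟨hj, hlt⟩)
      · exact Finset.mem_union_left _ (Finset.mem_filter.2 ⟨Finset.mem_univ _, hge⟩)
    have h2 : ((H n ∩ group (a n ω) true).card : ℝ) ≤
        (Finset.univ.filter fun j => level q n + 1 ≤ X j).card +
          ((H n ∩ group (a n ω) true).filter fun i => X i < level q n + 1).card := by
      exact_mod_cast (Finset.card_le_card h1).trans (Finset.card_union_le _ _)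
    have h3 := (abs_le.1 htreated).1
    rw [le_div_iff₀ hn0, mul_comm]
    refine htail.trans ?_
    have h4 : ((H n).card : ℝ) / 8 ≤ (Finset.univ.filter fun j => level q n + 1 ≤ X j).card := by
      linarith
    calc α / 8 * ((H n).card : ℝ) = (H n).card / 8 * α := by ring
      _ ≤ _ := by gcongr

end Localization

/-! ### Measurability of the procedures -/

section Measurability

variable {n : ℕ} {Ω : Type*} [MeasurableSpace Ω]

/-- A random set of subjects is measurable if so are the events that it contains a subject. -/
def MeasurableRandomSet (R : Ω → Finset (Fin n)) : Prop := ∀ i, MeasurableSet {ω | i ∈ R ω}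

lemma MeasurableRandomSet.inter {R R' : Ω → Finset (Fin n)} (h : MeasurableRandomSet R)
    (h' : MeasurableRandomSet R') : MeasurableRandomSet fun ω => R ω ∩ R' ω := fun i => by
  simp only [Finset.mem_inter]
  exact (h i).inter (h' i)

lemma MeasurableRandomSet.union {R R' : Ω → Finset (Fin n)} (h : MeasurableRandomSet R)
    (h' : MeasurableRandomSet R') : MeasurableRandomSet fun ω => R ω ∪ R' ω := fun i => by
  simp only [Finset.mem_union]
  exact (h i).union (h' i)

lemma MeasurableRandomSet.sdiff {R R' : Ω → Finset (Fin n)} (h : MeasurableRandomSet R)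
    (h' : MeasurableRandomSet R') : MeasurableRandomSet fun ω => R ω \ R' ω := fun i => by
  simp only [Finset.mem_sdiff]
  exact (h i).diff (h' i)

lemma measurableRandomSet_const (H : Finset (Fin n)) :
    MeasurableRandomSet fun _ : Ω => H := fun _ => MeasurableSet.const _

lemma MeasurableRandomSet.filter {R : Ω → Finset (Fin n)} (h : MeasurableRandomSet R)
    {p : Ω → Fin n → Prop} (hp : ∀ i, MeasurableSet {ω | p ω i}) :
    MeasurableRandomSet fun ω => (R ω).filter (p ω) := fun i => by
  simp only [Finset.mem_filter]
  exact (h i).inter (hp i)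

lemma MeasurableRandomSet.card {R : Ω → Finset (Fin n)} (h : MeasurableRandomSet R) :
    Measurable fun ω => (R ω).card := by
  have : ∀ ω, (R ω).card = ∑ i, if i ∈ R ω then 1 else 0 := fun ω => by simp
  simp only [this]
  exact Finset.measurable_sum _ fun i _ => Measurable.ite (h i) measurable_const measurable_const

lemma MeasurableRandomSet.truePositiveProp {R H : Ω → Finset (Fin n)}
    (hR : MeasurableRandomSet R) (hH : MeasurableRandomSet H) :
    Measurable fun ω => truePositiveProp (R ω) (H ω) :=
  ((measurable_of_countable fun k : ℕ => (k : ℝ)).comp (hR.inter hH).card).div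
    ((measurable_of_countable fun k : ℕ => ((max k 1 : ℕ) : ℝ)).comp hH.card)

lemma MeasurableRandomSet.falseDiscoveryProp {R : Ω → Finset (Fin n)}
    (hR : MeasurableRandomSet R) (H : Finset (Fin n)) :
    Measurable fun ω => falseDiscoveryProp (R ω) H :=
  ((measurable_of_countable fun k : ℕ => (k : ℝ)).comp
      (hR.sdiff (measurableRandomSet_const H)).card).div
    ((measurable_of_countable fun k : ℕ => ((max k 1 : ℕ) : ℝ)).comp hR.card)

lemma measurableRandomSet_group {g : Ω → Fin n → Bool} (hg : ∀ i, Measurable fun ω => g ω i)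
    {b : Ω → Bool} (hb : Measurable b) : MeasurableRandomSet fun ω => group (g ω) (b ω) :=
  fun i => by
    simp only [group, Finset.mem_filter, Finset.mem_univ, true_and]
    exact measurableSet_eq_fun (hg i) hb

lemma MeasurableRandomSet.average {R : Ω → Finset (Fin n)} (hR : MeasurableRandomSet R)
    {y : Ω → Fin n → ℝ} (hy : ∀ i, Measurable fun ω => y ω i) :
    Measurable fun ω => average (y ω) (R ω) := by
  have : ∀ ω, ∑ i ∈ R ω, y ω i = ∑ i, if i ∈ R ω then y ω i else 0 := fun ω => by simp
  simp only [ICube.average, this]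
  exact (Finset.measurable_sum _ fun i _ => Measurable.ite (hR i) (hy i) measurable_const).div
    ((measurable_of_countable fun k : ℕ => (k : ℝ)).comp hR.card)

variable {V : Ω → Fin n → ℝ} {R₀ : Ω → Finset (Fin n)}

lemma measurableRandomSet_candidates (hV : ∀ i, Measurable fun ω => V ω i)
    (hR : MeasurableRandomSet R₀) (t : ℕ) :
    MeasurableRandomSet fun ω => candidates (V ω) (R₀ ω) t := by
  induction t with
  | zero => exact hR
  | succ t ih =>
    intro i
    simp only [candidates_succ, excludeSmallest, Finset.mem_filter]
    have hm : MeasurableSet {ω | ∃ j ∈ candidates (V ω) (R₀ ω) t,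
        |V ω j| < |V ω i| ∨ (|V ω j| = |V ω i| ∧ j < i)} := by
      have e : {ω | ∃ j ∈ candidates (V ω) (R₀ ω) t,
          |V ω j| < |V ω i| ∨ (|V ω j| = |V ω i| ∧ j < i)} =
          ⋃ j, {ω | j ∈ candidates (V ω) (R₀ ω) t} ∩
            ({ω | |V ω j| < |V ω i|} ∪ ({ω | |V ω j| = |V ω i|} ∩ {_ω | j < i})) := by
        ext ω
        simp
      rw [e]
      exact MeasurableSet.iUnion fun j => (ih j).inter
        ((measurableSet_lt (hV j).abs (hV i).abs).union
          ((measurableSet_eq_fun (hV j).abs (hV i).abs).inter (MeasurableSet.const _)))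
    exact (ih i).inter hm

lemma measurable_fdrHat (hV : ∀ i, Measurable fun ω => V ω i) (hR : MeasurableRandomSet R₀) :
    Measurable fun ω => fdrHat (V ω) (R₀ ω) := by
  have h1 : MeasurableRandomSet fun ω => nonpositives (V ω) (R₀ ω) :=
    hR.filter fun i => measurableSet_le (hV i) measurable_const
  have h2 : MeasurableRandomSet fun ω => positives (V ω) (R₀ ω) :=
    hR.filter fun i => measurableSet_lt measurable_const (hV i)
  exact ((measurable_of_countable fun k : ℕ => (k + 1 : ℝ)).comp h1.card).div
    ((measurable_of_countable fun k : ℕ => ((max k 1 : ℕ) : ℝ)).comp h2.card)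

lemma measurableRandomSet_autoI3 (γ : ℝ) (hV : ∀ i, Measurable fun ω => V ω i)
    (hR : MeasurableRandomSet R₀) : MeasurableRandomSet fun ω => autoI3 γ (V ω) (R₀ ω) := by
  intro i
  have hF : ∀ t, MeasurableSet {ω | fdrHat (V ω) (candidates (V ω) (R₀ ω) t) ≤ γ} := fun t =>
    measurableSet_le (measurable_fdrHat hV (measurableRandomSet_candidates hV hR t))
      measurable_const
  have hmem : {ω | i ∈ autoI3 γ (V ω) (R₀ ω)} = ⋃ t,
      (({ω | fdrHat (V ω) (candidates (V ω) (R₀ ω) t) ≤ γ} ∩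
        ⋂ t' : Fin t, {ω | fdrHat (V ω) (candidates (V ω) (R₀ ω) t') ≤ γ}ᶜ) ∩
        ({ω | i ∈ candidates (V ω) (R₀ ω) t} ∩ {ω | 0 < V ω i})) := by
    ext ω
    simp only [Set.mem_ofPred_eq, Set.mem_iUnion, Set.mem_inter_iff, Set.mem_iInter,
      Set.mem_compl_iff]
    constructor
    · intro hi
      by_cases hex : ∃ t, fdrHat (V ω) (candidates (V ω) (R₀ ω) t) ≤ γ
      · rw [autoI3, dif_pos hex] at hi
        exact ⟨Nat.find hex, ⟨Nat.find_spec hex, fun t' => Nat.find_min hex t'.2⟩,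
          Finset.mem_filter.1 hi⟩
      · rw [autoI3, dif_neg hex] at hi
        simp at hi
    · rintro ⟨t, ⟨h1, h2⟩, h3⟩
      have hex : ∃ t, fdrHat (V ω) (candidates (V ω) (R₀ ω) t) ≤ γ := ⟨t, h1⟩
      have ht : Nat.find hex = t := (Nat.find_eq_iff hex).2 ⟨h1, fun m hm => h2 ⟨m, hm⟩⟩
      rw [autoI3, dif_pos hex, ht]
      exact Finset.mem_filter.2 h3
  rw [hmem]
  exact MeasurableSet.iUnion fun t => ((hF t).inter (MeasurableSet.iInter
    fun (t' : Fin t) => (hF t').compl)).inter ((measurableRandomSet_candidates hV hR t i).inter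
      (measurableSet_lt measurable_const (hV i)))

lemma mem_benjaminiHochberg_iff {α : ℝ} (hα : 0 ≤ α) (p : Fin n → ℝ) (i : Fin n) :
    i ∈ benjaminiHochberg α p ↔ ∃ k : Fin (n + 1),
      (k : ℕ) ≤ (Finset.univ.filter fun j => p j ≤ (k : ℕ) * α / n).card ∧
        p i ≤ (k : ℕ) * α / n := by
  constructor
  · intro hi
    have hspec := Nat.findGreatest_spec (P := fun k : ℕ => k ≤ (Finset.univ.filter
      fun j => p j ≤ k * α / n).card) (Nat.zero_le n) (Nat.zero_le _)
    exact ⟨⟨_, Nat.lt_succ_of_le (Nat.findGreatest_le n)⟩, hspec, (Finset.mem_filter.1 hi).2⟩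
  · rintro ⟨k, hk, hi⟩
    refine Finset.mem_filter.2 ⟨Finset.mem_univ _, hi.trans ?_⟩
    have := Nat.le_findGreatest (P := fun k : ℕ => k ≤ (Finset.univ.filter
      fun j => p j ≤ k * α / n).card) (Nat.lt_succ_iff.1 k.2) hk
    gcongr

lemma measurableRandomSet_benjaminiHochberg {α : ℝ} (hα : 0 ≤ α) {p : Ω → Fin n → ℝ}
    (hp : ∀ i, Measurable fun ω => p ω i) :
    MeasurableRandomSet fun ω => benjaminiHochberg α (p ω) := by
  intro i
  simp only [mem_benjaminiHochberg_iff hα]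
  have hc : ∀ c : ℝ, MeasurableRandomSet fun ω => Finset.univ.filter fun j => p ω j ≤ c :=
    fun c => (measurableRandomSet_const _).filter fun j => measurableSet_le (hp j) measurable_const
  have : {ω | ∃ k : Fin (n + 1),
      (k : ℕ) ≤ (Finset.univ.filter fun j => p ω j ≤ (k : ℕ) * α / n).card ∧
        p ω i ≤ (k : ℕ) * α / n} = ⋃ k : Fin (n + 1),
      {ω | (k : ℕ) ≤ (Finset.univ.filter fun j => p ω j ≤ (k : ℕ) * α / n).card} ∩
        {ω | p ω i ≤ (k : ℕ) * α / n} := by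
    ext ω
    simp
  rw [this]
  exact MeasurableSet.iUnion fun k => (measurableSet_le measurable_const (hc _).card).inter
    (measurableSet_le (hp i) measurable_const)

variable {s a : Ω → Fin n → Bool} {y : Ω → Fin n → ℝ}

lemma measurable_crossfitEffect (hs : ∀ i, Measurable fun ω => s ω i)
    (ha : ∀ i, Measurable fun ω => a ω i) (hy : ∀ i, Measurable fun ω => y ω i) (i : Fin n) :
    Measurable fun ω => crossfitEffect (s ω) (a ω) (y ω) i := by
  have h1 : Measurable fun ω => average (y ω) (group (s ω) (!s ω i)) :=
    (measurableRandomSet_group hs ((measurable_of_countable fun b : Bool => !b).comp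
      (hs i))).average hy
  have h2 : Measurable fun ω => 4 * ((if a ω i = true then (1 : ℝ) else 0) - 1 / 2) :=
    (measurable_of_countable fun b : Bool => 4 * ((if b = true then (1 : ℝ) else 0) - 1 / 2)).comp
      (ha i)
  exact h2.mul ((hy i).sub h1)

lemma measurable_linearEffect (ha : ∀ i, Measurable fun ω => a ω i)
    (hy : ∀ i, Measurable fun ω => y ω i) (i : Fin n) :
    Measurable fun ω => linearEffect (a ω) (y ω) i := by
  have h1 : ∀ b, Measurable fun ω => average (y ω) (group (a ω) b) := fun b =>
    (measurableRandomSet_group ha measurable_const).average hy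
  exact Measurable.ite (ha i (measurableSet_singleton true)) ((hy i).sub (h1 false))
    ((h1 true).sub (hy i))

lemma measurable_armVariance (ha : ∀ i, Measurable fun ω => a ω i)
    (hy : ∀ i, Measurable fun ω => y ω i) {b : Ω → Bool} (hb : Measurable b) :
    Measurable fun ω => armVariance (a ω) (y ω) (b ω) := by
  have hg := measurableRandomSet_group ha hb
  have : ∀ ω, ∑ i ∈ group (a ω) (b ω), (y ω i - average (y ω) (group (a ω) (b ω))) ^ 2 =
      ∑ i, if i ∈ group (a ω) (b ω) then (y ω i - average (y ω) (group (a ω) (b ω))) ^ 2 else 0 :=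
    fun ω => by simp
  simp only [armVariance, this]
  exact (Finset.measurable_sum _ fun i _ => Measurable.ite (hg i)
    (((hy i).sub (hg.average hy)).pow_const 2) measurable_const).div
    ((measurable_of_countable fun k : ℕ => (k - 1 : ℝ)).comp hg.card)

lemma measurable_linearPValue (ha : ∀ i, Measurable fun ω => a ω i)
    (hy : ∀ i, Measurable fun ω => y ω i) (i : Fin n) :
    Measurable fun ω => linearPValue (a ω) (y ω) i := by
  have hb := (measurable_of_countable fun b : Bool => !b).comp (ha i)
  have hvar : Measurable fun ω => linearEffectVariance (a ω) (y ω) i :=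
    (measurable_armVariance ha hy (ha i)).add ((measurable_armVariance ha hy hb).div
      ((measurable_of_countable fun k : ℕ => (k : ℝ)).comp (measurableRandomSet_group ha hb).card))
  exact measurable_const.sub ((monotone_cdf (gaussianReal 0 1)).measurable.comp
    ((measurable_linearEffect ha hy i).div hvar.sqrt))

lemma measurableRandomSet_thresholdSet {g : Ω → Fin n → Bool}
    (hV : ∀ i, Measurable fun ω => V ω i) (hg : ∀ i, Measurable fun ω => g ω i)
    {d : Ω → Bool → EReal} (hd : ∀ b, Measurable fun ω => d ω b) :
    MeasurableRandomSet fun ω => thresholdSet (V ω) (g ω) (d ω) := by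
  intro i
  simp only [thresholdSet, Finset.mem_filter, Finset.mem_univ, true_and]
  have h1 : Measurable fun ω => d ω (g ω i) := by
    have : ∀ ω, d ω (g ω i) = if g ω i = true then d ω true else d ω false := fun ω => by
      cases g ω i <;> simp
    simp only [this]
    exact Measurable.ite (hg i (measurableSet_singleton true)) (hd true) (hd false)
  exact measurableSet_le h1 (hV i).coe_real_ereal

end Measurability

/-! ### Limits of the power -/

section Power

lemma truePositiveProp_nonneg {n : ℕ} (R H : Finset (Fin n)) : 0 ≤ truePositiveProp R H :=
  div_nonneg (Nat.cast_nonneg _) (Nat.cast_nonneg _)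

lemma truePositiveProp_le_one {n : ℕ} (R H : Finset (Fin n)) : truePositiveProp R H ≤ 1 := by
  refine div_le_one_of_le₀ ?_ (Nat.cast_nonneg _)
  exact_mod_cast (Finset.card_le_card Finset.inter_subset_right).trans (le_max_left _ _)

lemma falseDiscoveryProp_nonneg {n : ℕ} (R H : Finset (Fin n)) : 0 ≤ falseDiscoveryProp R H :=
  div_nonneg (Nat.cast_nonneg _) (Nat.cast_nonneg _)

lemma falseDiscoveryProp_le_one {n : ℕ} (R H : Finset (Fin n)) : falseDiscoveryProp R H ≤ 1 := by
  refine div_le_one_of_le₀ ?_ (Nat.cast_nonneg _)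
  exact_mod_cast (Finset.card_le_card Finset.sdiff_subset).trans (le_max_left _ _)

lemma truePositiveProp_of_pos {n : ℕ} {R H : Finset (Fin n)} (hH : 0 < H.card) :
    truePositiveProp R H = (R ∩ H).card / H.card := by
  rw [truePositiveProp, max_eq_left hH]

lemma integrable_of_unit {Ω : Type*} [MeasurableSpace Ω] {P : Measure Ω} [IsProbabilityMeasure P]
    {f : Ω → ℝ} (hf : Measurable f) (h0 : ∀ ω, 0 ≤ f ω) (h1 : ∀ ω, f ω ≤ 1) : Integrable f P :=
  Integrable.of_bound hf.aestronglyMeasurable 1 (ae_of_all _ fun ω => by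
    rw [Real.norm_of_nonneg (h0 ω)]
    exact h1 ω)

/-- If `f ≤ g + ε` holds outside an exceptional event, then the expectations satisfy the same
inequality up to the probability of that event. -/
lemma integral_le_integral_add {Ω : Type*} [MeasurableSpace Ω] {P : Measure Ω}
    [IsProbabilityMeasure P] {f g : Ω → ℝ} {E : Ω → Prop} {ε : ℝ} (hε : 0 ≤ ε)
    (hf : Integrable f P) (hg : Integrable g P) (hf1 : ∀ ω, f ω ≤ 1) (hg0 : ∀ ω, 0 ≤ g ω)
    (h : ∀ ω, E ω → f ω ≤ g ω + ε) :
    ∫ ω, f ω ∂P ≤ ∫ ω, g ω ∂P + ε + P.real {ω | ¬ E ω} := by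
  set B := toMeasurable P {ω | ¬ E ω}
  have hB : MeasurableSet B := measurableSet_toMeasurable _ _
  have hI : Integrable (B.indicator (1 : Ω → ℝ)) P := (integrable_const (1 : ℝ)).indicator hB
  have hPB : P.real B = P.real {ω | ¬ E ω} := by
    rw [measureReal_def, measure_toMeasurable, measureReal_def]
  have hgε : Integrable (fun ω => g ω + ε) P := hg.add (integrable_const ε)
  calc ∫ ω, f ω ∂P ≤ ∫ ω, (g ω + ε + B.indicator (1 : Ω → ℝ) ω) ∂P := by
        refine integral_mono hf (hgε.add hI) fun ω => ?_
        by_cases hω : ω ∈ B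
        · simp only [Set.indicator_of_mem hω, Pi.one_apply]
          linarith [hf1 ω, hg0 ω]
        · have hE : E ω := by
            by_contra hcon
            exact hω (subset_toMeasurable _ _ hcon)
          simp only [Set.indicator_of_notMem hω, add_zero]
          exact h ω hE
    _ = ∫ ω, g ω ∂P + ε + P.real {ω | ¬ E ω} := by
        rw [integral_add hgε hI, integral_add hg (integrable_const ε),
          integral_indicator_one hB, hPB]
        simp

variable {Ω : ℕ → Type*} [∀ n, MeasurableSpace (Ω n)] {P : ∀ n, Measure (Ω n)}
  [∀ n, IsProbabilityMeasure (P n)]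

/-- Convergence in probability of proportions implies convergence of their expectations. -/
lemma tendsto_integral_of_withHighProb {f : ∀ n, Ω n → ℝ} (hf : ∀ n, Measurable (f n))
    (h0 : ∀ n ω, 0 ≤ f n ω) (h1 : ∀ n ω, f n ω ≤ 1) {c : ℝ} (hc0 : 0 ≤ c) (hc1 : c ≤ 1)
    (h : ∀ ε : ℝ, 0 < ε → WithHighProb P fun n ω => |f n ω - c| ≤ ε) :
    Tendsto (fun n => ∫ ω, f n ω ∂P n) atTop (𝓝 c) := by
  rw [Metric.tendsto_nhds]
  intro ε hε
  have hε3 : 0 < ε / 3 := by positivity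
  filter_upwards [(h _ hε3).eventually_le hε3] with n hn
  have hint := integrable_of_unit (P := P n) (hf n) (h0 n) (h1 n)
  have h2 := integral_le_integral_add (P := P n) (g := fun _ => c)
    (E := fun ω => |f n ω - c| ≤ ε / 3) hε3.le hint (integrable_const c) (h1 n) (fun _ => hc0)
    fun ω hω => by linarith [(abs_le.1 hω).2]
  have h3 := integral_le_integral_add (P := P n) (f := fun _ => c)
    (E := fun ω => |f n ω - c| ≤ ε / 3) hε3.le (integrable_const c) hint (fun _ => hc1) (h0 n)
    fun ω hω => by linarith [(abs_le.1 hω).1]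
  simp only [integral_const, probReal_univ, one_smul] at h2 h3
  rw [Real.dist_eq, abs_lt]
  constructor <;> linarith

variable {β : ℝ} {H : ∀ n, Finset (Fin n)} {s a : ∀ n, Ω n → Fin n → Bool}
  {w : ∀ n, Ω n → Fin n → ℝ} {R : ∀ n, Ω n → Finset (Fin n)}

lemma tendsto_power_zero (hR : ∀ n, MeasurableRandomSet (R n))
    (h : ∀ η : ℝ, 0 < η → WithHighProb P fun n ω => truePositiveProp (R n ω) (H n) ≤ η) :
    Tendsto (fun n => power (P n) (R n) (fun _ => H n)) atTop (𝓝 0) := by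
  refine tendsto_integral_of_withHighProb
    (fun n => (hR n).truePositiveProp (measurableRandomSet_const _))
    (fun n ω => truePositiveProp_nonneg _ _) (fun n ω => truePositiveProp_le_one _ _) le_rfl
    zero_le_one fun ε hε => (h ε hε).mono (Eventually.of_forall fun n ω hω => ?_)
  rw [sub_zero, abs_of_nonneg (truePositiveProp_nonneg _ _)]
  exact hω

lemma card_le_of_subset_filter {n : ℕ} {R H : Finset (Fin n)} {p : Fin n → Prop} {η : ℝ}
    (hH : 0 < H.card) (hR : ∀ i ∈ R, i ∈ H → p i) (hp : ((H.filter p).card : ℝ) ≤ η * H.card) :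
    truePositiveProp R H ≤ η := by
  have hc : (0 : ℝ) < H.card := by exact_mod_cast hH
  rw [truePositiveProp_of_pos hH, div_le_iff₀ hc]
  refine le_trans (Nat.cast_le.2 (Finset.card_le_card fun i hi => ?_)) hp
  obtain ⟨hiR, hiH⟩ := Finset.mem_inter.1 hi
  exact Finset.mem_filter.2 ⟨hiH, hR i hiR hiH⟩

lemma SparseNoise.eventually_card_pos (h : SparseNoise P β H s a w) (hβ1 : β < 1) :
    ∀ᶠ n in atTop, 0 < (H n).card := by
  filter_upwards [(tendsto_card_atTop hβ1 h.card_nonnull).eventually_gt_atTop 0] with n hn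
  exact_mod_cast hn

/-- A procedure that identifies only subjects with scores above a level that is much higher than
the signal has no power. -/
lemma SparseNoise.tendsto_power_zero (h : SparseNoise P β H s a w) (hβ1 : β < 1) {q r : ℝ}
    (hr : 0 ≤ r) (hrq : r < q) (hR : ∀ n, MeasurableRandomSet (R n))
    (hup : WithHighProb P fun n ω => ∀ i ∈ R n ω,
      level q n - 1 ≤ score (level r n) (H n) (a n ω) (w n ω) i) :
    Tendsto (fun n => power (P n) (R n) (fun _ => H n)) atTop (𝓝 0) := by
  have hx : Tendsto (fun n => level q n - level r n - 1) atTop atTop :=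
    tendsto_atTop_add_const_right _ _ (tendsto_level_sub_atTop hr hrq)
  refine ICube.tendsto_power_zero hR fun η hη => (hup.and (h.card_noise_ge_le hx hη)).mono ?_
  filter_upwards [h.eventually_card_pos hβ1] with n hn ω ⟨h1, h2, _⟩
  refine card_le_of_subset_filter hn (fun i hi _ => ?_) h2
  have h3 := h1 i hi
  have h4 := score_le (H := H n) (a := a n ω) (w := w n ω) (level_nonneg r n) i
  linarith

/-- A procedure that identifies the subjects with scores above a level much lower than the signal,
and nobody with a score below another diverging level, has full power among the treated subjects and
no power among the untreated ones. -/
lemma SparseNoise.tendsto_power (h : SparseNoise P β H s a w) (hβ1 : β < 1) {q₀ q r : ℝ}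
    (hq₀ : 0 < q₀) (hq : 0 ≤ q) (hqr : q < r) (ha : ∀ n i, Measurable fun ω => a n ω i)
    (hR : ∀ n, MeasurableRandomSet (R n))
    (hup : WithHighProb P fun n ω => ∀ i ∈ R n ω,
      level q₀ n - 1 ≤ score (level r n) (H n) (a n ω) (w n ω) i)
    (hlow : WithHighProb P fun n ω => ∀ i,
      level q n + 1 ≤ score (level r n) (H n) (a n ω) (w n ω) i → i ∈ R n ω) :
    Tendsto (fun n => power (P n) (R n) (fun _ => H n)) atTop (𝓝 (1 / 2)) ∧
    Tendsto (fun n => power (P n) (R n) (fun ω => H n ∩ group (a n ω) true)) atTop (𝓝 1) := by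
  have hx : Tendsto (fun n => level q₀ n - 1) atTop atTop :=
    tendsto_atTop_add_const_right _ _ (tendsto_level_atTop hq₀)
  -- almost all treated non-null subjects are identified
  have hT : ∀ δ : ℝ, 0 < δ → WithHighProb P fun n ω =>
      ((H n ∩ group (a n ω) true).card : ℝ) ≤
        (R n ω ∩ (H n ∩ group (a n ω) true)).card + δ * (H n).card := by
    intro δ hδ
    refine (hlow.and (h.card_score_lt_le hq hqr hδ)).mono (Eventually.of_forall ?_)
    rintro n ω ⟨h1, h2⟩
    have h3 : H n ∩ group (a n ω) true ⊆ (R n ω ∩ (H n ∩ group (a n ω) true)) ∪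
        (H n ∩ group (a n ω) true).filter fun i =>
          score (level r n) (H n) (a n ω) (w n ω) i < level q n + 1 := by
      intro i hi
      rcases lt_or_ge (score (level r n) (H n) (a n ω) (w n ω) i) (level q n + 1) with hlt | hge
      · exact Finset.mem_union_right _ (Finset.mem_filter.2 ⟨hi, hlt⟩)
      · exact Finset.mem_union_left _ (Finset.mem_inter.2 ⟨h1 i hge, hi⟩)
    have h4 : ((H n ∩ group (a n ω) true).card : ℝ) ≤
        (R n ω ∩ (H n ∩ group (a n ω) true)).card +
          ((H n ∩ group (a n ω) true).filter fun i =>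
            score (level r n) (H n) (a n ω) (w n ω) i < level q n + 1).card := by
      exact_mod_cast (Finset.card_le_card h3).trans (Finset.card_union_le _ _)
    linarith
  constructor
  · refine tendsto_integral_of_withHighProb
      (fun n => (hR n).truePositiveProp (measurableRandomSet_const _))
      (fun n ω => truePositiveProp_nonneg _ _) (fun n ω => truePositiveProp_le_one _ _)
      (by norm_num) (by norm_num) fun ε hε => ?_
    have hε2 := half_pos hε
    refine ((((hT _ hε2).and (h.card_treated _ hε2)).and hup).and
      (h.card_noise_ge_le hx hε2)).mono ?_
    filter_upwards [h.eventually_card_pos hβ1] with n hn ω ⟨⟨⟨h1, h2⟩, h3⟩, h4, _⟩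
    have hc : (0 : ℝ) < (H n).card := by exact_mod_cast hn
    have h2' := abs_le.1 h2
    have h5 : ((R n ω ∩ (H n ∩ group (a n ω) true)).card : ℝ) ≤ (R n ω ∩ H n).card :=
      Nat.cast_le.2 (Finset.card_le_card
        (Finset.inter_subset_inter_left Finset.inter_subset_left))
    have h6 : R n ω ∩ H n ⊆ (H n ∩ group (a n ω) true) ∪
        (H n).filter fun i => level q₀ n - 1 ≤ w n ω i := by
      intro i hi
      obtain ⟨hiR, hiH⟩ := Finset.mem_inter.1 hi
      by_cases hia : a n ω i = true
      · exact Finset.mem_union_left _ (Finset.mem_inter.2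
          ⟨hiH, Finset.mem_filter.2 ⟨Finset.mem_univ _, hia⟩⟩)
      · have := h3 i hiR
        rw [score_of_untreated hia] at this
        exact Finset.mem_union_right _ (Finset.mem_filter.2 ⟨hiH, this⟩)
    have h7 : ((R n ω ∩ H n).card : ℝ) ≤ (H n ∩ group (a n ω) true).card +
        ((H n).filter fun i => level q₀ n - 1 ≤ w n ω i).card := by
      exact_mod_cast (Finset.card_le_card h6).trans (Finset.card_union_le _ _)
    have e : truePositiveProp (R n ω) (H n) - 1 / 2 =
        ((R n ω ∩ H n).card - (H n).card / 2) / (H n).card := by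
      rw [truePositiveProp_of_pos hn]
      field_simp
    rw [e, abs_div, abs_of_pos hc, div_le_iff₀ hc, abs_le]
    constructor <;> linarith
  · refine tendsto_integral_of_withHighProb
      (fun n => (hR n).truePositiveProp ((measurableRandomSet_const _).inter
        (measurableRandomSet_group (ha n) measurable_const)))
      (fun n ω => truePositiveProp_nonneg _ _) (fun n ω => truePositiveProp_le_one _ _)
      zero_le_one le_rfl fun ε hε => ?_
    refine ((hT (ε / 4) (by positivity)).and (h.card_treated (1 / 4) (by norm_num))).mono ?_
    filter_upwards [h.eventually_card_pos hβ1] with n hn ω ⟨h1, h2⟩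
    have hc : (0 : ℝ) < (H n).card := by exact_mod_cast hn
    have h2' := abs_le.1 h2
    have hcT : (0 : ℝ) < (H n ∩ group (a n ω) true).card := by linarith
    have h3 : 1 - ε ≤ truePositiveProp (R n ω) (H n ∩ group (a n ω) true) := by
      rw [truePositiveProp_of_pos (by exact_mod_cast hcT), le_div_iff₀ hcT]
      have : ε / 4 * (H n).card ≤ ε / 4 * (4 * (H n ∩ group (a n ω) true).card) := by
        gcongr
        linarith
      linarith
    have h4 := truePositiveProp_le_one (R n ω) (H n ∩ group (a n ω) true)
    rw [abs_le]
    constructor <;> linarith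

end Power

/-! ### Threshold procedures -/

section Threshold

/-- A threshold procedure with a low threshold in one of the groups makes almost only false
discoveries if many null subjects of each group exceed that threshold. -/
lemma le_falseDiscoveryProp_thresholdSet {n : ℕ} {V : Fin n → ℝ} {g : Fin n → Bool}
    {d : Bool → EReal} {H : Finset (Fin n)} {κ t : ℝ} (hκ : 0 < κ) (hH : 0 < H.card) {b : Bool}
    (hb : d b ≤ (t : EReal))
    (hcard : 1 / κ * H.card ≤ (((group g b \ H).filter fun i => t ≤ V i).card : ℝ)) :
    1 - κ ≤ falseDiscoveryProp (thresholdSet V g d) H := by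
  set R := thresholdSet V g d with hR
  have h1 : (((group g b \ H).filter fun i => t ≤ V i).card : ℝ) ≤ (R \ H).card := by
    refine Nat.cast_le.2 (Finset.card_le_card fun i hi => ?_)
    obtain ⟨hi1, hi2⟩ := Finset.mem_filter.1 hi
    obtain ⟨hi3, hi4⟩ := Finset.mem_sdiff.1 hi1
    refine Finset.mem_sdiff.2 ⟨Finset.mem_filter.2 ⟨Finset.mem_univ _, ?_⟩, hi4⟩
    rw [(Finset.mem_filter.1 hi3).2]
    exact hb.trans (EReal.coe_le_coe_iff.2 hi2)
  have hc : (0 : ℝ) < H.card := by exact_mod_cast hH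
  have h2 : (H.card : ℝ) ≤ κ * (R \ H).card := by
    have := hcard.trans h1
    rw [one_div_mul_eq_div, div_le_iff₀ hκ] at this
    linarith
  have h3 : (R.card : ℝ) ≤ (R \ H).card + H.card := by
    exact_mod_cast tsub_le_iff_right.1 (Finset.le_card_sdiff H R)
  have h4 : 0 < (R \ H).card := by
    by_contra! hcon
    have : ((R \ H).card : ℝ) = 0 := by exact_mod_cast Nat.le_zero.1 hcon
    rw [this] at h2
    linarith
  have h5 : 0 < R.card := h4.trans_le (Finset.card_le_card Finset.sdiff_subset)
  have h5' : (0 : ℝ) < R.card := by exact_mod_cast h5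
  have h6 : ((R \ H).card : ℝ) ≤ R.card := Nat.cast_le.2 (Finset.card_le_card Finset.sdiff_subset)
  rw [falseDiscoveryProp, max_eq_left h5, le_div_iff₀ h5']
  have := mul_le_mul_of_nonneg_left h6 hκ.le
  linarith

variable {Ω : ℕ → Type*} [∀ n, MeasurableSpace (Ω n)] {P : ∀ n, Measure (Ω n)}
  [∀ n, IsProbabilityMeasure (P n)] {H : ∀ n, Finset (Fin n)}
  {V : ∀ n, Ω n → Fin n → ℝ} {g : ∀ n, Ω n → Fin n → Bool}

/-- Threshold procedures are powerless if there is a level above which there are, in each group,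
many more null than non-null subjects, but only few of the non-null ones: a threshold below the
level in one of the groups makes the false discovery proportion close to one, and thresholds above
it make few true discoveries. -/
lemma thresholdProceduresPowerless_of_level {α : ℝ} (hα1 : α < 1)
    (hV : ∀ n i, Measurable fun ω => V n ω i) (hg : ∀ n i, Measurable fun ω => g n ω i)
    (hH : ∀ᶠ n in atTop, 0 < (H n).card) (t : ℕ → ℝ)
    (hnull : ∀ K : ℝ, 0 < K → WithHighProb P fun n ω => ∀ b, K * (H n).card ≤
      (((group (g n ω) b \ H n).filter fun i => t n ≤ V n ω i).card : ℝ))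
    (hnonnull : ∀ η : ℝ, 0 < η → WithHighProb P fun n ω =>
      (((H n).filter fun i => t n ≤ V n ω i).card : ℝ) ≤ η * (H n).card) :
    ThresholdProceduresPowerless α P H V g := by
  have hhigh : ∀ {n : ℕ} {ω : Ω n} {d : Bool → EReal} {η : ℝ}, 0 < (H n).card →
      (∀ b, ¬ d b ≤ (t n : EReal)) →
      (((H n).filter fun i => t n ≤ V n ω i).card : ℝ) ≤ η * (H n).card →
      truePositiveProp (thresholdSet (V n ω) (g n ω) d) (H n) ≤ η := by
    intro n ω d η hn hd hη
    refine card_le_of_subset_filter hn (fun i hi _ => ?_) hη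
    have h1 := (Finset.mem_filter.1 hi).2
    exact EReal.coe_le_coe_iff.1 ((not_le.1 (hd _)).le.trans h1)
  -- a false discovery proportion of at least `1 - κ` with probability at least `1 - κ` makes the FDR
  -- at least `1 - 2 κ > α`
  obtain ⟨κ, hκ⟩ : ∃ κ, κ = (1 - α) / 3 := ⟨_, rfl⟩
  have hκ0 : 0 < κ := by linarith
  refine ⟨fun d hfdr => ?_, fun d hd => ⟨fun ε hε => ?_, fun hfdp => ?_⟩⟩
  · have hR : ∀ n, MeasurableRandomSet fun ω => thresholdSet (V n ω) (g n ω) (d n) := fun n =>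
      measurableRandomSet_thresholdSet (hV n) (hg n) fun _ => measurable_const
    have hd : ∀ᶠ n in atTop, ∀ b, ¬ d n b ≤ (t n : EReal) := by
      filter_upwards [hfdr, (hnull (1 / κ) (by positivity)).eventually_le hκ0, hH]
        with n h1 h2 h3 b hb
      have h4 := integral_le_integral_add (P := P n) (f := fun _ => 1 - κ)
        (g := fun ω => falseDiscoveryProp (thresholdSet (V n ω) (g n ω) (d n)) (H n))
        (E := fun ω => ∀ b, 1 / κ * (H n).card ≤
          (((group (g n ω) b \ H n).filter fun i => t n ≤ V n ω i).card : ℝ)) le_rfl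
        (integrable_const _)
        (integrable_of_unit ((hR n).falseDiscoveryProp _) (fun ω => falseDiscoveryProp_nonneg _ _)
          fun ω => falseDiscoveryProp_le_one _ _) (fun _ => by linarith)
        (fun ω => falseDiscoveryProp_nonneg _ _)
        fun ω hω => by
          rw [add_zero]
          exact le_falseDiscoveryProp_thresholdSet hκ0 h3 hb (hω b)
      simp only [integral_const, probReal_univ, one_smul] at h4
      unfold fdr at h1
      linarith
    refine tendsto_power_zero hR fun η hη => (hnonnull η hη).mono ?_
    filter_upwards [hd, hH] with n h1 h2 ω hω using hhigh h2 h1 hω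
  · have hR : ∀ n, MeasurableRandomSet fun ω => thresholdSet (V n ω) (g n ω) (d n ω) := fun n =>
      measurableRandomSet_thresholdSet (hV n) (hg n) (hd n)
    have hε2 := half_pos hε
    filter_upwards [((hnull (1 / (ε / 2)) (by positivity)).and
      (hnonnull (ε / 2) hε2)).eventually_le hε2, hH] with n h1 h2
    refine (integral_le_integral_add (P := P n) (E := fun ω => (∀ b, 1 / (ε / 2) * (H n).card ≤
      (((group (g n ω) b \ H n).filter fun i => t n ≤ V n ω i).card : ℝ)) ∧
      (((H n).filter fun i => t n ≤ V n ω i).card : ℝ) ≤ ε / 2 * (H n).card) hε2.le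
      (integrable_of_unit ((hR n).truePositiveProp (measurableRandomSet_const _))
        (fun ω => truePositiveProp_nonneg _ _) fun ω => truePositiveProp_le_one _ _)
      (integrable_of_unit ((hR n).falseDiscoveryProp (H n))
        (fun ω => falseDiscoveryProp_nonneg _ _) fun ω => falseDiscoveryProp_le_one _ _)
      (fun ω => truePositiveProp_le_one _ _) (fun ω => falseDiscoveryProp_nonneg _ _)
      fun ω hω => ?_).trans (by unfold fdr; linarith)
    by_cases hcase : ∃ b, d n ω b ≤ (t n : EReal)
    · obtain ⟨b, hb⟩ := hcase
      have h3 := le_falseDiscoveryProp_thresholdSet hε2 h2 hb (hω.1 b)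
      have h4 := truePositiveProp_le_one (thresholdSet (V n ω) (g n ω) (d n ω)) (H n)
      linarith
    · push Not at hcase
      have h3 := hhigh h2 (fun b => not_le.2 (hcase b)) hω.2
      have h4 := falseDiscoveryProp_nonneg (thresholdSet (V n ω) (g n ω) (d n ω)) (H n)
      linarith
  · have hR : ∀ n, MeasurableRandomSet fun ω => thresholdSet (V n ω) (g n ω) (d n ω) := fun n =>
      measurableRandomSet_thresholdSet (hV n) (hg n) (hd n)
    have hfdp' : WithHighProb P fun n ω =>
        falseDiscoveryProp (thresholdSet (V n ω) (g n ω) (d n ω)) (H n) ≤ α := by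
      have h1 := ((ENNReal.tendsto_toReal ENNReal.one_ne_top).comp hfdp).const_sub 1
      simp only [ENNReal.toReal_one, sub_self] at h1
      refine h1.congr fun n => ?_
      have hm : MeasurableSet {ω | falseDiscoveryProp (thresholdSet (V n ω) (g n ω) (d n ω)) (H n)
          ≤ α} := measurableSet_le ((hR n).falseDiscoveryProp (H n)) measurable_const
      exact (probReal_compl_eq_one_sub hm).symm
    refine tendsto_power_zero hR fun η hη => (((hnull (1 / κ) (by positivity)).and
      (hnonnull η hη)).and hfdp').mono ?_
    filter_upwards [hH] with n h2 ω ⟨⟨h3, h4⟩, h5⟩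
    by_cases hcase : ∃ b, d n ω b ≤ (t n : EReal)
    · obtain ⟨b, hb⟩ := hcase
      have h6 := le_falseDiscoveryProp_thresholdSet hκ0 h2 hb (h3 b)
      linarith
    · push Not at hcase
      exact hhigh h2 (fun b => not_le.2 (hcase b)) h4

variable {β : ℝ} {s a : ∀ n, Ω n → Fin n → Bool} {w : ∀ n, Ω n → Fin n → ℝ}

/-- Below the detection boundary, threshold procedures are powerless if their statistics are close
to the scores at the level `√(2 q log n)`, where `r < q < β`. -/
lemma SparseNoise.thresholdProceduresPowerless (h : SparseNoise P β H s a w) (hβ1 : β < 1)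
    {α q r : ℝ} (hα1 : α < 1) (hr : 0 ≤ r) (hrq : r < q) (hqβ : q < β)
    (G : ∀ n, (Fin n → Bool) → (Fin n → Bool) → Fin n → Bool)
    (hG : WithHighProb P fun n ω => ∀ b, (n : ℝ) ≤ 4 * (group (G n (s n ω) (a n ω)) b).card)
    (hV : ∀ n i, Measurable fun ω => V n ω i)
    (hGm : ∀ n i, Measurable fun ω => G n (s n ω) (a n ω) i) (t : ℕ → ℝ)
    (hclose : WithHighProb P fun n ω => ∀ i,
      (level q n + 1 ≤ score (level r n) (H n) (a n ω) (w n ω) i → t n ≤ V n ω i) ∧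
      (t n ≤ V n ω i → level q n - 1 ≤ score (level r n) (H n) (a n ω) (w n ω) i)) :
    ThresholdProceduresPowerless α P H V fun n ω => G n (s n ω) (a n ω) := by
  have hq : 0 ≤ q := hr.trans hrq.le
  have hβ : 0 < β := hq.trans_lt hqβ
  obtain ⟨q', hqq', hq'β⟩ := exists_between hqβ
  refine thresholdProceduresPowerless_of_level hα1 hV hGm (h.eventually_card_pos hβ1) t
    (fun K hK => withHighProb_forall_bool fun b => ?_) fun η hη => ?_
  · have hT : WithHighProb P fun n ω =>
        (n : ℝ) ≤ 8 * (group (G n (s n ω) (a n ω)) b \ H n).card :=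
      hG.mono (by
        filter_upwards [h.eventually_card_le hβ] with n hn ω hω using card_group_sdiff_ge (hω b) hn)
    have hreg := h.tailRegular (fun n s a => group (G n s a) b \ H n) hT (hq.trans hqq'.le)
      (hq'β.trans hβ1) 0 (show (0 : ℝ) < 1 / 2 by norm_num) (by norm_num)
    refine ((hreg.and hT).and hclose).mono ?_
    filter_upwards [eventually_level_add_le hq hqq' 1,
      eventually_card_le_gaussianTail hq hqβ h.card_nonnull
        (show (0 : ℝ) < 1 / (16 * K) by positivity)] with n hlev hcard ω ⟨⟨⟨h1, _⟩, h2⟩, h3⟩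
    have h4 := (h1 (level q n + 1) (by linarith [level_nonneg q n]) hlev).1
    have h5 : (((group (G n (s n ω) (a n ω)) b \ H n).filter
        fun i => level q n + 1 ≤ w n ω i).card : ℝ) ≤
        ((group (G n (s n ω) (a n ω)) b \ H n).filter fun i => t n ≤ V n ω i).card := by
      refine Nat.cast_le.2 (Finset.card_le_card fun i hi => ?_)
      obtain ⟨hi1, hi2⟩ := Finset.mem_filter.1 hi
      refine Finset.mem_filter.2 ⟨hi1, (h3 i).1 ?_⟩
      rwa [score_of_notMem (Finset.mem_sdiff.1 hi1).2]
    have h6 := mul_le_mul_of_nonneg_right h2 (gaussianTail_nonneg (level q n + 1))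
    have h7 : K * (H n).card ≤ 1 / 16 * (n * gaussianTail (level q n + 1)) := by
      calc K * ((H n).card : ℝ) ≤ K * (1 / (16 * K) * (n * gaussianTail (level q n + 1))) := by
            gcongr
        _ = _ := by field_simp
    linarith
  · have hx : Tendsto (fun n => level q n - level r n - 1) atTop atTop :=
      tendsto_atTop_add_const_right _ _ (tendsto_level_sub_atTop hr hrq)
    refine (hclose.and (h.card_noise_ge_le hx hη)).mono (Eventually.of_forall ?_)
    rintro n ω ⟨h1, h2, -⟩
    refine le_trans (Nat.cast_le.2 (Finset.card_le_card fun i hi => ?_)) h2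
    obtain ⟨hi1, hi2⟩ := Finset.mem_filter.1 hi
    refine Finset.mem_filter.2 ⟨hi1, ?_⟩
    have h3 := (h1 i).2 hi2
    have h4 := score_le (H := H n) (a := a n ω) (w := w n ω) (level_nonneg r n) i
    linarith

end Threshold

end

end ICube

theorem theorem3 (α β r : ℝ) (hα₀ : 0 < α) (hα₁ : α < 1) (hβ₀ : 0 < β) (hβ₁ : β < 1)
    (hr₀ : 0 < r) (hr₁ : r < 1)
    (Ω : ℕ → Type*) [∀ n, MeasurableSpace (Ω n)]
    (P : ∀ n, Measure (Ω n)) [∀ n, IsProbabilityMeasure (P n)]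
    (H : ∀ n, Finset (Fin n))
    (hH : Tendsto (fun n : ℕ => ((H n).card : ℝ) / (n : ℝ) ^ (1 - β)) atTop (𝓝 1))
    (YC YT : ∀ n, Fin n → Ω n → ℝ) (A S : ∀ n, Fin n → Ω n → Bool)
    (hmodel : ∀ n, ICube.SparseGaussianModel (P n) r (H n) (YC n) (YT n) (A n) (S n)) :
    let a : ∀ n, Ω n → Fin n → Bool := fun n ω i => A n i ω
    let s : ∀ n, Ω n → Fin n → Bool := fun n ω i => S n i ω
    let y : ∀ n, Ω n → Fin n → ℝ := fun n => ICube.observed (YC n) (YT n) (A n)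
    let RI3 : ∀ n, Ω n → Finset (Fin n) := fun n ω => ICube.crossfitI3 α (s n ω) (a n ω) (y n ω)
    let RBH : ∀ n, Ω n → Finset (Fin n) := fun n ω => ICube.linearBH α (a n ω) (y n ω)
    let treatedNonnulls : ∀ n, Ω n → Finset (Fin n) := fun n ω => H n ∩ ICube.group (a n ω) true
    (r < β →
      Tendsto (fun n => ICube.power (P n) (RI3 n) (fun _ => H n)) atTop (𝓝 0) ∧
      Tendsto (fun n => ICube.power (P n) (RBH n) (fun _ => H n)) atTop (𝓝 0) ∧
      ICube.ThresholdProceduresPowerless α P H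
        (fun n ω => ICube.crossfitEffect (s n ω) (a n ω) (y n ω)) s ∧
      ICube.ThresholdProceduresPowerless α P H
        (fun n ω => ICube.linearEffect (a n ω) (y n ω)) a) ∧
    (β < r →
      Tendsto (fun n => ICube.power (P n) (RI3 n) (fun _ => H n)) atTop (𝓝 (1 / 2)) ∧
      Tendsto (fun n => ICube.power (P n) (RBH n) (fun _ => H n)) atTop (𝓝 (1 / 2)) ∧
      Tendsto (fun n => ICube.power (P n) (RI3 n) (treatedNonnulls n)) atTop (𝓝 1) ∧
      Tendsto (fun n => ICube.power (P n) (RBH n) (treatedNonnulls n)) atTop (𝓝 1)) := by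
  intro a s y RI3 RBH treatedNonnulls
  have hs : ICube.SparseNoise P β H s a fun n ω =>
      ICube.signedNoise (ICube.level r n) (H n) (YC n) (YT n) (A n) ω :=
    ICube.SparseNoise.of_model hβ₁ hH hmodel
  have hy : ∀ n ω, y n ω = ICube.outcome (ICube.level r n) (H n) (a n ω)
      (ICube.signedNoise (ICube.level r n) (H n) (YC n) (YT n) (A n) ω) := fun n ω =>
    ICube.observed_eq_outcome _ _ _ _ _ _
  have ham : ∀ n i, Measurable fun ω => a n ω i := fun n i => (hmodel n).measurable_A i
  have hsm : ∀ n i, Measurable fun ω => s n ω i := fun n i => (hmodel n).measurable_S i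
  have hym : ∀ n i, Measurable fun ω => y n ω i := fun n i =>
    Measurable.ite (measurableSet_eq_fun ((hmodel n).measurable_A i) measurable_const)
      ((hmodel n).measurable_YT i) ((hmodel n).measurable_YC i)
  have hIm : ∀ n i, Measurable fun ω => ICube.crossfitEffect (s n ω) (a n ω) (y n ω) i :=
    fun n i => ICube.measurable_crossfitEffect (hsm n) (ham n) (hym n) i
  have hBm : ∀ n i, Measurable fun ω => ICube.linearEffect (a n ω) (y n ω) i :=
    fun n i => ICube.measurable_linearEffect (ham n) (hym n) i
  have hI3 : ∀ n, ICube.MeasurableRandomSet (RI3 n) := fun n =>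
    (ICube.measurableRandomSet_autoI3 _ (hIm n)
      (ICube.measurableRandomSet_group (hsm n) measurable_const)).union
    (ICube.measurableRandomSet_autoI3 _ (hIm n)
      (ICube.measurableRandomSet_group (hsm n) measurable_const))
  have hBH : ∀ n, ICube.MeasurableRandomSet (RBH n) := fun n =>
    ICube.measurableRandomSet_benjaminiHochberg hα₀.le fun i =>
      ICube.measurable_linearPValue (ham n) (hym n) i
  -- rejected subjects have a score of at least about `√(2 q log n)`, whenever `q < β`
  have hupI3 := fun (q : ℝ) (hq : 0 ≤ q) (hqβ : q < β) =>
    hs.le_score_of_mem_crossfitI3 hr₀.le hβ₁ hα₁.le hq hqβ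
  have hupBH := fun (q : ℝ) (hq : 0 ≤ q) (hqβ : q < β) =>
    hs.le_score_of_mem_linearBH hr₀.le hβ₁ hα₀ hα₁ hq hqβ
  have hlog : ∀ᶠ n : ℕ in atTop, 1 / Real.log n ≤ 1 := by
    filter_upwards [ICube.tendsto_log_natCast.eventually_ge_atTop 1] with n hn
    exact (div_le_one (by linarith)).2 hn
  simp only [← hy] at hupI3 hupBH
  refine ⟨fun hrβ => ?_, fun hβr => ?_⟩
  · obtain ⟨q, hrq, hqβ⟩ := exists_between hrβ
    have hq : 0 ≤ q := hr₀.le.trans hrq.le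
    have hcI3 := hs.crossfitEffect_close hr₀.le hβ₀
    have hcBH := hs.linearEffect_close hr₀.le hβ₀
    refine ⟨hs.tendsto_power_zero hβ₁ hr₀.le hrq hI3 (hupI3 q hq hqβ),
      hs.tendsto_power_zero hβ₁ hr₀.le hrq hBH (hupBH q hq hqβ),
      hs.thresholdProceduresPowerless hβ₁ hα₁ hr₀.le hrq hqβ (fun _ s _ => s) hs.card_split hIm
        hsm (fun n => 2 * ICube.level q n) (hcI3.mono ?_),
      hs.thresholdProceduresPowerless hβ₁ hα₁ hr₀.le hrq hqβ (fun _ _ a => a) hs.card_arm hBm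
        ham (fun n => ICube.level q n) (hcBH.mono ?_)⟩
    · filter_upwards [hlog] with n hn ω hω i
      have h1 := abs_le.1 (hω i)
      rw [hy]
      constructor <;> intro h2 <;> linarith [h1.1, h1.2]
    · filter_upwards [hlog] with n hn ω hω i
      have h1 := abs_le.1 (hω i).1
      rw [hy]
      constructor <;> intro h2 <;> linarith [h1.1, h1.2]
  · obtain ⟨q, hβq, hqr⟩ := exists_between hβr
    have hlowI3 := hs.mem_crossfitI3 hr₁ hβ₀ hβ₁ hα₀ hβq hqr
    have hlowBH := hs.mem_linearBH hβ₀ hα₀ hβq hqr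
    have hq : 0 ≤ q := hβ₀.le.trans hβq.le
    have h1 := hs.tendsto_power hβ₁ (half_pos hβ₀) hq hqr ham hI3
      (hupI3 _ (half_pos hβ₀).le (half_lt_self hβ₀)) (by simpa only [← hy] using hlowI3)
    have h2 := hs.tendsto_power hβ₁ (half_pos hβ₀) hq hqr ham hBH
      (hupBH _ (half_pos hβ₀).le (half_lt_self hβ₀)) (by simpa only [← hy] using hlowBH)
    exact ⟨h1.1, h2.1, h1.2, h2.2⟩
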